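/- Let $n\ge 1$, let $M\in\mathbb R^{n\times n}$ be symmetric positive semidefinite, $q\in\mathbb R^n$ and $0<u_i\le\infty$ for $i=1,\dots,n$. Consider the quadratic program $$\text{(QP)}\qquad \min_{0\le x\le u}\ \theta(x)=q^\top x+\tfrac12 x^\top Mx .$$ The comparison matrix $\overline A$ of a square matrix $A$ has entries $\overline A_{ii}=a_{ii}$ and $\overline A_{ij}=-|a_{ij}|$ for $i\ne j$. Suppose that every principal submatrix of $M$ of order $n-1$ has a positive semidefinite comparison matrix. The following algorithm ("Algorithm III") is applied to (QP). For $i=1,\dots,n$ in turn, with $M^{-i},q^{-i},u^{-i}$ obtained by removing the $i$-th row, column and component: 1. Apply PPPA (below) to the problem with data $(M^{-i},q^{-i},u^{-i})$. If it has no optimal solution, report that (QP) has none and terminate. Otherwise let $y$ be the solution computed; if $q_i+\sum_{j\ne i}m_{ij}y_j\ge 0$, return $x$ with $x_i=0$, $x^{-i}=y$ and terminate. 2. If $u_i<\infty$, apply PPPA to the problem with data $(M^{-i},(q_j+m_{ji}u_i)_{j\ne i},u^{-i})$. If it has no optimal solution, report that (QP) has none and terminate. Otherwise let $y$ be the solution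 computed; if $q_i+m_{ii}u_i+\sum_{j\ne i}m_{ij}y_j\le 0$, return $x$ with $x_i=u_i$, $x^{-i}=y$ and terminate. If none of these (at most $2n$) reduced problems has led to termination, solve the system $q+Mx=0$, $0\le x\le u$, one irreducible diagonal block of $M$ at a time: in a block choose an index set $\beta$ of two elements (one, if the block has order one) with complement $\alpha$ in the block, eliminate $x_\alpha=-M_{\alpha\alpha}^{-1}(q_\alpha+M_{\alpha\beta}x_\beta)$, and solve the remaining system of linear equations and inequalities in $x_\beta$ by Fourier–Motzkin elimination. If the system is infeasible, report that (QP) has no optimal solution; otherwise return the solution found. PPPA, for a problem with data $(M,q,u)$ and $\overline M$ positive semidefinite, is the parametric principal pivoting algorithm. By elimination it computes $d>0$ with $\overline Md\ge0$ and sets $p=\tfrac12(M+\overline M)d$; variables with $m_{ii}=0$ are separated (they occur only in $q_ix_i$). While there is an $i$ with $p_i=0$ and $q_i<0$, the problem is reduced: if $u_i=\infty$, $x_i$ is eliminated, which leaves the Schur complement of $m_{ii}$; if $u_i<\infty$, $x_i$ is replaced by $u_i-z_i$ and $z_i$ is only required to be nonnegative. Then the solution of $\min_{0\le x\le u}(q+\tau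 p)^\top x+\tfrac12x^\top Mx$ is traced for $\tau$ decreasing to $0$: starting from $\alpha=\gamma=\emptyset$, the indices are partitioned into sets $\alpha,\beta,\gamma$ of variables between their bounds, at their lower and at their upper bounds; put $(\bar q_\alpha,\bar p_\alpha)=M_{\alpha\alpha}^{-1}(q_\alpha+M_{\alpha\gamma}u_\gamma,\,p_\alpha)$ and $(\bar q_i,\bar p_i)=(q_i+M_{i\gamma}u_\gamma,\,p_i)-M_{i\alpha}(\bar q_\alpha,\bar p_\alpha)$ for $i\notin\alpha$. The next critical value $\tau$ is the largest of $0$, the $-\bar q_i/\bar p_i$ with $i\in\beta$, $\bar p_i>0$, and the $-(u_i+\bar q_i)/\bar p_i$ with $i\in\alpha$, $\bar p_i>0$, $u_i<\infty$. If it is $0$, then $(x_\alpha,x_\beta,x_\gamma)=(-\bar q_\alpha,0,u_\gamma)$ is the solution. Otherwise the first maximizing index $i$ moves from $\alpha$ to $\gamma$, or from $\beta$ to $\alpha$ provided that its entry $m_{ii}-M_{i\alpha}M_{\alpha\alpha}^{-1}M_{\alpha i}$ is positive. If that entry is zero, let $h=M_{\alpha\alpha}^{-1}M_{\alpha i}$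 and take the smallest of the ratios $(-\bar q_j-\tau\bar p_j)/h_j$ ($j\in\alpha$, $h_j>0$), $(u_j+\bar q_j+\tau\bar p_j)/(-h_j)$ ($j\in\alpha$, $h_j<0$, $u_j<\infty$), and $u_i$ (if finite): if there is no ratio, the problem has no optimal solution; if $u_i$ is the smallest, $i$ moves to $\gamma$; otherwise $i$ moves to $\alpha$ and the minimizing $j$ moves to $\beta$ (first kind of ratio) or to $\gamma$ (second kind). The inverse $M_{\alpha\alpha}^{-1}$ is updated at every pivot. Then there is an absolute constant $C$, independent of $n,M,q,u$, such that Algorithm III terminates after at most $Cn^4$ operations (arithmetic operations, comparisons, and passes through loops), and either returns an optimal solution of (QP), or reports that (QP) has no optimal solution, in which case indeed none exists. -/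

import Mathlib

namespace BoundedQP

/-! ## The quadratic program

Minimize `qᵀx + ½ xᵀMx` over `0 ≤ x ≤ u`; the value `⊤` of an upper bound means that the
variable has no upper bound. -/

/-- The comparison matrix: the diagonal is kept, every off-diagonal entry `m` becomes `-|m|`. -/
def comparisonMatrix {ι : Type*} [DecidableEq ι] (M : Matrix ι ι ℝ) : Matrix ι ι ℝ :=
  Matrix.of fun i j => if i = j then M i i else -|M i j|

/-- `M` is symmetric positive semidefinite, and each of its principal submatrices of order `n - k`
has a positive semidefinite comparison matrix. -/
def WeaklyQuasiDominant {n : ℕ} (k : ℕ) (M : Matrix (Fin n) (Fin n) ℝ) : Prop :=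
  M.PosSemidef ∧ ∀ κ : Finset (Fin n), κ.card + k = n →
    (comparisonMatrix (M.submatrix (fun i : κ => (i : Fin n)) (fun i : κ => (i : Fin n)))).PosSemidef

/-- The objective function `qᵀx + ½ xᵀMx`. -/
noncomputable def objective {n : ℕ} (M : Matrix (Fin n) (Fin n) ℝ) (q x : Fin n → ℝ) : ℝ :=
  q ⬝ᵥ x + (1 / 2) * (x ⬝ᵥ M.mulVec x)

/-- The constraints `0 ≤ x ≤ u`. -/
def Feasible {n : ℕ} (u : Fin n → WithTop ℝ) (x : Fin n → ℝ) : Prop :=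
  ∀ i, 0 ≤ x i ∧ (x i : WithTop ℝ) ≤ u i

/-- `x` is an optimal solution of the quadratic program. -/
def IsOptimal {n : ℕ} (M : Matrix (Fin n) (Fin n) ℝ) (q : Fin n → ℝ) (u : Fin n → WithTop ℝ)
    (x : Fin n → ℝ) : Prop :=
  Feasible u x ∧ ∀ y, Feasible u y → objective M q x ≤ objective M q y

/-! ## Programs with counted operations

A program over a type `K` of numbers can get at its numbers only through the constructors below;
all programs in this file are written for an arbitrary type `K` without any structure, so that
no arithmetic operation and no comparison escapes the count. -/

/-- The four arithmetic operations. -/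
inductive Arith
  | add
  | sub
  | mul
  | div

/-- Programs that compute with numbers in `K` and return an element of `α`. -/
inductive Prog (K α : Type) : Type
  /-- return a result -/
  | ret (a : α) : Prog K α
  /-- load a constant -/
  | const (m : ℕ) (k : K → Prog K α) : Prog K α
  /-- carry out an arithmetic operation -/
  | arith (o : Arith) (x y : K) (k : K → Prog K α) : Prog K α
  /-- test whether `x < y` -/
  | less (x y : K) (k : Bool → Prog K α) : Prog K α
  /-- one step of bookkeeping: every pass through the body of a loop is charged with it -/
  | tick (k : Prog K α) : Prog K α

namespace Prog

/-- Sequential composition. -/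
def bind {K α β : Type} : Prog K α → (α → Prog K β) → Prog K β
  | ret a, f => f a
  | const m k, f => const m fun z => (k z).bind f
  | arith o x y k, f => arith o x y fun z => (k z).bind f
  | less x y k, f => less x y fun b => (k b).bind f
  | tick k, f => tick (k.bind f)

instance {K : Type} : Monad (Prog K) where
  pure := ret
  bind := bind

/-- The value of an arithmetic operation. (`x / 0 = 0`, as always in Mathlib.) -/
def arithVal {K : Type} [Field K] : Arith → K → K → K
  | .add, x, y => x + y
  | .sub, x, y => x - y
  | .mul, x, y => x * y
  | .div, x, y => x / y

/-- The result of running a program. -/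
def eval {K α : Type} [Field K] [LinearOrder K] : Prog K α → α
  | ret a => a
  | const m k => (k (m : K)).eval
  | arith o x y k => (k (arithVal o x y)).eval
  | less x y k => (k (decide (x < y))).eval
  | tick k => k.eval

/-- The number of operations carried out when a program is run. -/
def cost {K α : Type} [Field K] [LinearOrder K] : Prog K α → ℕ
  | ret _ => 0
  | const m k => (k (m : K)).cost + 1
  | arith o x y k => (k (arithVal o x y)).cost + 1
  | less x y k => (k (decide (x < y))).cost + 1
  | tick k => k.cost + 1

end Prog

section Programs

variable {K α σ : Type} {n : ℕ}

/-! ### Elementary programs -/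

def lit (m : ℕ) : Prog K K := .const m .ret

def step : Prog K Unit := .tick (.ret ())

def add (x y : K) : Prog K K := .arith .add x y .ret

def sub (x y : K) : Prog K K := .arith .sub x y .ret

def mul (x y : K) : Prog K K := .arith .mul x y .ret

def div (x y : K) : Prog K K := .arith .div x y .ret

def lt (x y : K) : Prog K Bool := .less x y .ret

def neg (x : K) : Prog K K := do sub (← lit 0) x

def isPos (x : K) : Prog K Bool := do lt (← lit 0) x

def isNeg (x : K) : Prog K Bool := do lt x (← lit 0)

/-- Compute and store the entries of a vector. -/
def tab : {n : ℕ} → (Fin n → Prog K α) → Prog K (Fin n → α)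
  | 0, _ => pure Fin.elim0
  | _ + 1, f => do
    step
    let a ← f 0
    let v ← tab fun i => f i.succ
    pure (Fin.cons a v)

/-- Compute and store the entries of a square matrix. -/
def tab2 (f : Fin n → Fin n → Prog K α) : Prog K (Fin n → Fin n → α) := tab fun i => tab (f i)

/-- A loop over all indices in increasing order. -/
def loop : {n : ℕ} → σ → (σ → Fin n → Prog K σ) → Prog K σ
  | 0, s, _ => pure s
  | _ + 1, s, f => do
    step
    let s' ← f s 0
    loop s' fun t i => f t i.succ

/-- A loop over the entries of a list. -/
def loopList : List α → σ → (σ → α → Prog K σ) → Prog K σ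
  | [], s, _ => pure s
  | a :: l, s, f => do
    step
    let s' ← f s a
    loopList l s' f

/-- The sum of `f i` over the indices `i` that satisfy `c`. -/
def sumOn (c : Fin n → Bool) (f : Fin n → Prog K K) : Prog K K := do
  loop (← lit 0) fun s i => if c i then do add s (← f i) else pure s

/-- The first index with a given property. -/
def findFirst (f : Fin n → Prog K Bool) : Prog K (Option (Fin n)) :=
  loop none fun s i => match s with
    | some j => pure (some j)
    | none => do if ← f i then pure (some i) else pure none

/-! ### Parametric principal pivoting

The data of a problem of order `n` are `M : Fin n → Fin n → K`, `q : Fin n → K` and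
`u : Fin n → WithTop K`. -/

/-- What an algorithm reports: an optimal solution, that there is none, or nothing (the number of
iterations provided was exceeded). -/
inductive Outcome (K : Type) (n : ℕ)
  | optimal (x : Fin n → K)
  | noSolution
  | failed

/-- The position of a variable: between its bounds (`α`), at its lower bound (`β`) or at its upper
bound (`γ`). -/
inductive Status
  | between
  | lower
  | upper
  deriving DecidableEq

def isBetween (st : Fin n → Status) (i : Fin n) : Bool := decide (st i = .between)

/-- With `B` the inverse of `M_αα`, the vector `r̄` given by `r̄_α = M_αα⁻¹ r_α` and
`r̄_i = r_i - M_iα r̄_α` for `i ∉ α`. -/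
def transform (M : Fin n → Fin n → K) (inα : Fin n → Bool) (B : Fin n → Fin n → K)
    (r : Fin n → K) : Prog K (Fin n → K) := do
  let y ← tab fun i => sumOn inα fun j => mul (B i j) (r j)
  tab fun i => if inα i then pure (y i) else do
    sub (r i) (← sumOn inα fun j => mul (M i j) (y j))

/-- The vector `h = M_αα⁻¹ M_αi` and the Schur complement entry `m_ii - M_iα h`. -/
def schurEntry (M : Fin n → Fin n → K) (inα : Fin n → Bool) (B : Fin n → Fin n → K) (i : Fin n) :
    Prog K ((Fin n → K) × K) := do
  let h ← tab fun k => sumOn inα fun j => mul (B k j) (M j i)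
  let s ← sub (M i i) (← sumOn inα fun j => mul (M i j) (h j))
  pure (h, s)

/-- Update of the inverse when the index `i` joins `α` (bordering). -/
def addIndex (B : Fin n → Fin n → K) (i : Fin n) (h : Fin n → K) (s : K) :
    Prog K (Fin n → Fin n → K) :=
  tab2 fun k l =>
    if k = i then
      if l = i then do div (← lit 1) s else do neg (← div (h l) s)
    else
      if l = i then do neg (← div (h k) s) else do add (B k l) (← div (← mul (h k) (h l)) s)

/-- Update of the inverse when the index `j` leaves `α`. -/
def dropIndex (B : Fin n → Fin n → K) (j : Fin n) : Prog K (Fin n → Fin n → K) :=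
  tab2 fun k l => do sub (B k l) (← div (← mul (B k j) (B j l)) (B j j))

/-- `q + M_·γ u_γ`. -/
def shiftedLinearTerm (M : Fin n → Fin n → K) (q : Fin n → K) (u : Fin n → WithTop K)
    (st : Fin n → Status) : Prog K (Fin n → K) :=
  tab fun i => do
    add (q i) (← sumOn (fun k => decide (st k = .upper)) fun k => match u k with
      | ⊤ => lit 0
      | (c : K) => mul (M i k) c)

/-- Keep the larger of the best ratio so far and a new one; the earlier one wins a tie. -/
def keepMax {τ : Type} (best : Option (K × τ)) (r : K) (t : τ) : Prog K (Option (K × τ)) :=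
  match best with
  | none => pure (some (r, t))
  | some b => do if ← lt b.1 r then pure (some (r, t)) else pure (some b)

/-- Keep the smaller of the best ratio so far and a new one; the earlier one wins a tie. -/
def keepMin {τ : Type} (best : Option (K × τ)) (r : K) (t : τ) : Prog K (Option (K × τ)) :=
  match best with
  | none => pure (some (r, t))
  | some b => do if ← lt r b.1 then pure (some (r, t)) else pure (some b)

/-- The first ratio test: the largest of the ratios `-q̄_i / p̄_i` (`i ∈ β`, `p̄_i > 0`) and
`-(u_i + q̄_i) / p̄_i` (`i ∈ α`, `p̄_i > 0`, `u_i < ∞`), with a maximizing index. -/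
def criticalValue (u : Fin n → WithTop K) (st : Fin n → Status) (qb pb : Fin n → K) :
    Prog K (Option (K × Fin n)) :=
  loop none fun best i => do
    if ← isPos (pb i) then
      match st i, u i with
      | .lower, _ => do keepMax best (← neg (← div (qb i) (pb i))) i
      | .between, (c : K) => do keepMax best (← neg (← div (← add c (qb i)) (pb i))) i
      | .between, ⊤ => pure best
      | .upper, _ => pure best
    else pure best

/-- The second ratio test, at the value `τ` and for an index `i ∈ β` whose Schur complement entry
is zero: the smallest of `(-q̄_j - τ p̄_j) / h_j` (`j ∈ α`, `h_j > 0`),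
`(u_j + q̄_j + τ p̄_j) / (-h_j)` (`j ∈ α`, `h_j < 0`, `u_j < ∞`) and `u_i` (if finite). The index
that attains it is recorded together with the bound that it moves to. -/
def blockingValue (u : Fin n → WithTop K) (st : Fin n → Status) (qb pb h : Fin n → K) (τ : K)
    (i : Fin n) : Prog K (Option (K × Fin n × Status)) := do
  let best ← loop none fun best j =>
    if st j = .between then do
      let v ← add (qb j) (← mul τ (pb j))
      if ← isPos (h j) then keepMin best (← div (← neg v) (h j)) (j, Status.lower)
      else if ← isNeg (h j) then
        match u j with
        | ⊤ => pure best
        | (c : K) => do keepMin best (← div (← add c v) (← neg (h j))) (j, Status.upper)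
      else pure best
    else pure best
  match u i with
  | ⊤ => pure best
  | (c : K) => keepMin best c (i, Status.upper)

/-- The pivoting iterations. The state consists of the partition `(α, β, γ)` of the indices and of
the inverse `B` of `M_αα`; `p` is the parametric vector. The first argument bounds the number of
iterations. -/
def pivotLoop (M : Fin n → Fin n → K) (q : Fin n → K) (u : Fin n → WithTop K) (p : Fin n → K) :
    ℕ → (Fin n → Status) → (Fin n → Fin n → K) → Prog K (Outcome K n)
  | 0, _, _ => pure .failed
  | fuel + 1, st, B => do
    step
    let qb ← transform M (isBetween st) B (← shiftedLinearTerm M q u st)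
    let pb ← transform M (isBetween st) B p
    let crit ← do match ← criticalValue u st qb pb with
      | none => pure none
      | some c => do if ← isPos c.1 then pure (some c) else pure none
    match crit with
    | none => do
      -- the critical value is zero
      let x ← tab fun i => match st i, u i with
        | .between, _ => neg (qb i)
        | .lower, _ => lit 0
        | .upper, (c : K) => pure c
        | .upper, ⊤ => lit 0
      pure (.optimal x)
    | some (τ, i) =>
      if st i = .between then do
        -- a variable between its bounds reaches its upper bound
        pivotLoop M q u p fuel (Function.update st i .upper) (← dropIndex B i)
      else do
        let (h, s) ← schurEntry M (isBetween st) B i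
        if ← isPos s then
          -- a diagonal pivot
          pivotLoop M q u p fuel (Function.update st i .between) (← addIndex B i h s)
        else
          match ← blockingValue u st qb pb h τ i with
          | none => pure .noSolution
          | some (_, j, side) =>
            if j = i then pivotLoop M q u p fuel (Function.update st i .upper) B
            else do
              -- a two-by-two pivot: `j` leaves `α` and `i` enters it
              let st' := Function.update st j side
              let B' ← dropIndex B j
              let (h', s') ← schurEntry M (isBetween st') B' i
              pivotLoop M q u p fuel (Function.update st' i .between) (← addIndex B' i h' s')

/-- The comparison matrix, computed. -/
def comparison (M : Fin n → Fin n → K) : Prog K (Fin n → Fin n → K) :=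
  tab2 fun i j => if i = j then pure (M i i) else do
    if ← isPos (M i j) then neg (M i j) else pure (M i j)

/-- Gaussian elimination and back substitution for a vector `d > 0` with `A d ≥ 0`, where `A` is
symmetric positive semidefinite with nonpositive off-diagonal entries. -/
def dominanceVector : {n : ℕ} → (Fin n → Fin n → K) → Prog K (Fin n → K)
  | 0, _ => pure Fin.elim0
  | _ + 1, A => do
    if ← isPos (A 0 0) then
      let S ← tab2 fun j k => do
        sub (A j.succ k.succ) (← div (← mul (A j.succ 0) (A 0 k.succ)) (A 0 0))
      let d ← dominanceVector S
      let t ← sumOn (fun _ => true) fun k => mul (A 0 k.succ) (d k)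
      let d₀ ← do if ← isNeg t then neg (← div t (A 0 0)) else lit 1
      pure (Fin.cons d₀ d)
    else
      let d ← dominanceVector (← tab2 fun j k => pure (A j.succ k.succ))
      pure (Fin.cons (← lit 1) d)

/-- The parametric vector `p = ½ (M + M̄) d`, where `M̄` is the comparison matrix. -/
def parametricVector (M : Fin n → Fin n → K) (d : Fin n → K) : Prog K (Fin n → K) := do
  let C ← comparison M
  let two ← lit 2
  tab fun i => do
    div (← sumOn (fun _ => true) fun j => do mul (← add (M i j) (C i j)) (d j)) two

/-- Application of the pivoting method to a problem together with a vector `d > 0` such that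
`M̄ d ≥ 0`. A variable with a zero diagonal entry is separated. As long as there is an index `i`
with `p_i = 0` and `q_i < 0`, so that pivoting cannot start with `p`, the problem is reduced: if
`u_i = ∞`, then the variable `x_i` is eliminated, which leaves the Schur complement of `m_ii`; if
`u_i < ∞`, then `x_i` is replaced by `z_i = u_i - x_i` and the upper bound on `z_i` is dropped. The
first argument bounds the number of reductions. -/
def reduceAndPivot : ℕ → {n : ℕ} → (Fin n → Fin n → K) → (Fin n → K) → (Fin n → WithTop K) →
    (Fin n → K) → Prog K (Outcome K n)
  | 0, _, _, _, _, _ => pure .failed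
  | _ + 1, 0, _, _, _, _ => pure (.optimal Fin.elim0)
  | fuel + 1, n + 1, M, q, u, d => do
    step
    let p ← parametricVector M d
    let bad ← findFirst fun i => do
      if ← isPos (M i i) then
        if ← isPos (p i) then pure false else isNeg (q i)
      else pure true
    match bad with
    | none => do
      let zero ← tab2 fun _ _ => lit 0
      pivotLoop M q u p (2 * (n + 1) + 1) (fun _ => .lower) zero
    | some i =>
      if ← isPos (M i i) then
        match u i with
        | ⊤ => do
          let S ← tab2 fun j k => do
            sub (M (i.succAbove j) (i.succAbove k))
              (← div (← mul (M (i.succAbove j) i) (M i (i.succAbove k))) (M i i))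
          let r ← tab fun j => do
            sub (q (i.succAbove j)) (← mul (← div (M (i.succAbove j) i) (M i i)) (q i))
          match ← reduceAndPivot fuel S r (fun j => u (i.succAbove j))
              (fun j => d (i.succAbove j)) with
          | .optimal x => do
            let t ← add (q i) (← sumOn (fun _ => true) fun k => mul (M i (i.succAbove k)) (x k))
            pure (.optimal (i.insertNth (← neg (← div t (M i i))) x))
          | .noSolution => pure .noSolution
          | .failed => pure .failed
        | (c : K) => do
          let M' ← tab2 fun j k =>
            if (j = i ∧ k ≠ i) ∨ (j ≠ i ∧ k = i) then neg (M j k) else pure (M j k)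
          let q' ← tab fun j => do
            let t ← add (q j) (← mul (M j i) c)
            if j = i then neg t else pure t
          match ← reduceAndPivot fuel M' q' (Function.update u i ⊤) d with
          | .optimal z => do
            pure (.optimal (Function.update z i (← sub c (z i))))
          | .noSolution => pure .noSolution
          | .failed => pure .failed
      else do
        -- the `i`-th row and column are zero: the variable `x_i` occurs only in `q_i x_i`
        let fixed ← do
          if ← isNeg (q i) then
            match u i with
            | ⊤ => pure none
            | (c : K) => pure (some c)
          else do pure (some (← lit 0))
        match fixed with
        | none => pure .noSolution
        | some c =>
          match ← reduceAndPivot fuel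
              (fun j k => M (i.succAbove j) (i.succAbove k)) (fun j => q (i.succAbove j))
              (fun j => u (i.succAbove j)) (fun j => d (i.succAbove j)) with
          | .optimal x => pure (.optimal (i.insertNth c x))
          | .noSolution => pure .noSolution
          | .failed => pure .failed

/-- The parametric principal pivoting algorithm for a matrix with a positive semidefinite comparison
matrix. -/
def pppa (M : Fin n → Fin n → K) (q : Fin n → K) (u : Fin n → WithTop K) :
    Prog K (Outcome K n) := do
  let d ← dominanceVector (← comparison M)
  reduceAndPivot (2 * n + 1) M q u d

/-! ### Systems of linear inequalities in two variables -/

/-- A solution `t` of the inequalities `a t + c ≥ 0`, `(a, c)` in the list, if there is one. -/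
def solveOneVar (L : List (K × K)) : Prog K (Option K) := do
  let zero ← lit 0
  let bounds ← loopList L ((none, none) : Option (K × Unit) × Option (K × Unit)) fun b e => do
    if ← isPos e.1 then pure (← keepMax b.1 (← neg (← div e.2 e.1)) (), b.2)
    else if ← isNeg e.1 then pure (b.1, ← keepMin b.2 (← neg (← div e.2 e.1)) ())
    else pure b
  let t := match bounds with
    | (some lo, _) => lo.1
    | (none, some hi) => hi.1
    | (none, none) => zero
  let ok ← loopList L true fun ok e => do
    if ← isNeg (← add (← mul e.1 t) e.2) then pure false else pure ok
  pure (if ok then some t else none)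

/-- Fourier–Motzkin elimination: a solution `(y, z)` of the inequalities `a y + b z + c ≥ 0`,
`(a, b, c)` in the list, if there is one. -/
def solveTwoVar (L : List (K × K × K)) : Prog K (Option (K × K)) := do
  let parts ← loopList L (([], [], []) : List (K × K × K) × List (K × K × K) × List (K × K))
    fun s e => do
      if ← isPos e.2.1 then pure (e :: s.1, s.2.1, s.2.2)
      else if ← isNeg e.2.1 then pure (s.1, e :: s.2.1, s.2.2)
      else pure (s.1, s.2.1, (e.1, e.2.2) :: s.2.2)
  let elim ← loopList parts.1 parts.2.2 fun acc e => loopList parts.2.1 acc fun acc' f => do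
    let a ← sub (← mul e.2.1 f.1) (← mul f.2.1 e.1)
    let c ← sub (← mul e.2.1 f.2.2) (← mul f.2.1 e.2.2)
    pure ((a, c) :: acc')
  match ← solveOneVar elim with
  | none => pure none
  | some y => do
    let rest ← loopList L [] fun acc e => do
      pure ((e.2.1, ← add (← mul e.1 y) e.2.2) :: acc)
    match ← solveOneVar rest with
    | none => pure none
    | some z => pure (some (y, z))

/-! ### The final check -/

/-- Which indices are joined by a chain of nonzero entries of `M`, that is, lie in the same
irreducible diagonal block. -/
def sameBlock (M : Fin n → Fin n → K) : Prog K (Fin n → Fin n → Bool) := do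
  let R ← tab2 fun i j => if i = j then pure true else do
    if ← isPos (M i j) then pure true else isNeg (M i j)
  loop R fun R k => tab2 fun i j => pure (R i j || (R i k && R k j))

/-- Solution of `q + M x = 0`, `0 ≤ x ≤ u` for the variables of one irreducible diagonal block `C`
with first index `b₁`. With `β` the first two indices of the block (the only one if the block has
order one) and `α` the others, the variables `x_α = -M_αα⁻¹ (q_α + M_αβ x_β)` are eliminated and the
remaining system in `x_β` is passed to Fourier–Motzkin elimination. The entries of the result
outside the block are those of `x`. -/
def solveBlock (M : Fin n → Fin n → K) (q : Fin n → K) (u : Fin n → WithTop K)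
    (inC : Fin n → Bool) (b₁ : Fin n) (x : Fin n → K) : Prog K (Option (Fin n → K)) := do
  let zero ← lit 0
  let one ← lit 1
  let b₂ ← findFirst fun j => pure (inC j && decide (j ≠ b₁))
  let inα : Fin n → Bool := fun k => inC k && decide (k ≠ b₁) && decide (some k ≠ b₂)
  let zeroMatrix ← tab2 fun _ _ => pure zero
  let (_, B) ← loop ((fun _ => false, zeroMatrix) : (Fin n → Bool) × (Fin n → Fin n → K))
    fun s k => if inα k then do
        let (h, e) ← schurEntry M s.1 s.2 k
        pure (Function.update s.1 k true, ← addIndex s.2 k h e)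
      else pure s
  -- in the rows of `α` the vector `-(qb + g₁ y + g₂ z)` is `x_α`, in those of `β` it has to vanish
  let qb ← transform M inα B q
  let g₁ ← transform M inα B fun j => M j b₁
  let g₂ ← match b₂ with
    | none => tab fun _ => pure zero
    | some b => transform M inα B fun j => M j b
  let L ← loop ([] : List (K × K × K)) fun L k =>
    if inC k then do
      let a' ← neg (g₁ k)
      let b' ← neg (g₂ k)
      let c' ← neg (qb k)
      if inα k then
        match u k with
        | ⊤ => pure ((a', b', c') :: L)
        | (c : K) => do pure ((a', b', c') :: (g₁ k, g₂ k, ← add (qb k) c) :: L)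
      else do
        let L := (a', b', c') :: (g₁ k, g₂ k, qb k) :: L
        let m ← neg one
        if k = b₁ then
          match u k with
          | ⊤ => pure ((one, zero, zero) :: L)
          | (c : K) => pure ((one, zero, zero) :: (m, zero, c) :: L)
        else
          match u k with
          | ⊤ => pure ((zero, one, zero) :: L)
          | (c : K) => pure ((zero, one, zero) :: (zero, m, c) :: L)
    else pure L
  match ← solveTwoVar L with
  | none => pure none
  | some (y, z) => do
    let x' ← tab fun k =>
      if k = b₁ then pure y
      else if some k = b₂ then pure z
      else if inC k then do
        neg (← add (qb k) (← add (← mul (g₁ k) y) (← mul (g₂ k) z)))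
      else pure (x k)
    pure (some x')

/-- Solution of the system `q + M x = 0`, `0 ≤ x ≤ u`, one irreducible diagonal block at a time. -/
def finalCheck (M : Fin n → Fin n → K) (q : Fin n → K) (u : Fin n → WithTop K) :
    Prog K (Outcome K n) := do
  let R ← sameBlock M
  let x₀ ← tab fun _ => lit 0
  let res ← loop (some x₀) fun s i => match s with
    | none => pure none
    | some x => do
      match ← findFirst fun j => pure (R i j) with
      | some j => if j = i then solveBlock M q u (R i) i x else pure (some x)
      | none => pure (some x)
  match res with
  | some x => pure (.optimal x)
  | none => pure .noSolution

/-! ### The algorithm -/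

/-- The two reduced problems of order `n` for the index `i`: the variable `x_i` is fixed at its
lower bound and, if `u_i < ∞`, at its upper bound. The result is `none` if neither of them settles
the original problem. -/
def tryIndex (M : Fin (n + 1) → Fin (n + 1) → K) (q : Fin (n + 1) → K)
    (u : Fin (n + 1) → WithTop K) (i : Fin (n + 1)) : Prog K (Option (Outcome K (n + 1))) := do
  let M' ← tab2 fun j k => pure (M (i.succAbove j) (i.succAbove k))
  let u' ← tab fun j => pure (u (i.succAbove j))
  let qlb ← tab fun j => pure (q (i.succAbove j))
  match ← pppa M' qlb u' with
  | .failed => pure (some .failed)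
  | .noSolution => pure (some .noSolution)
  | .optimal x => do
    let g ← add (q i) (← sumOn (fun _ => true) fun j => mul (M i (i.succAbove j)) (x j))
    if ← isNeg g then
      match u i with
      | ⊤ => pure none
      | (c : K) => do
        let qub ← tab fun j => do
          add (q (i.succAbove j)) (← mul (M (i.succAbove j) i) c)
        match ← pppa M' qub u' with
        | .failed => pure (some .failed)
        | .noSolution => pure (some .noSolution)
        | .optimal x => do
          let t ← add (q i) (← mul (M i i) c)
          let g ← add t (← sumOn (fun _ => true) fun j => mul (M i (i.succAbove j)) (x j))
          if ← isPos g then pure none else pure (some (.optimal (i.insertNth c x)))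
    else pure (some (.optimal (i.insertNth (← lit 0) x)))

/-- The algorithm for the bounded quadratic program of order `n + 1`: solve the reduced problems of
all the indices by `pppa`, until one of them settles the original problem; if none does, check the
system `q + M x = 0`, `0 ≤ x ≤ u`. -/
def resolveQP (M : Fin (n + 1) → Fin (n + 1) → K) (q : Fin (n + 1) → K)
    (u : Fin (n + 1) → WithTop K) : Prog K (Outcome K (n + 1)) := do
  let res ← loop none fun s i => match s with
    | some o => pure (some o)
    | none => tryIndex M q u i
  match res with
  | some o => pure o
  | none => finalCheck M q u

end Programs

end BoundedQP

/-! The parametric vector `p = ½(M + M̄)d` is what keeps the pivoting short. Off the diagonal `½(M +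
M̄)` has the entries `min(m_ij, 0)`. So `p_i` is the least value of `(My)_i` over `0 ≤ y ≤ d` with
`y_i = d_i`, and because `M̄d ≥ 0` it is at least the largest value over those `y` with `y_i = 0`.
Consequently, for any index set `α`, the optimality conditions of `min ½yᵀMy - pᵀy` over `0 ≤ y_α ≤
d_α`, `y = 0` outside `α`, force `(My)_α = p_α` (`Dominates.exists_mulVec_eq`). If `M_αα` is
invertible, `y_α` is `p̄_α`, and therefore `p̄ ≥ 0` for every partition
(`InvOn.bar_halfSum_nonneg`). The same vector for `α ∪ {i}` shows that `p̄_i` is the Schur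
complement entry of `i` times `y_i`, so `p̄_i > 0` makes this entry positive (`InvOn.schur_pos`). As
`τ` decreases, a variable can thus only move from its lower bound to the interior and from there to
its upper bound. There are at most `2n` pivots, no two-by-two pivot occurs, and degeneracy is
harmless (`pivotLoop_spec`).

If `p_i = 0` and `q_i < 0`, then row `i` has no positive off-diagonal entry. The other variables
then only push `x_i` upwards, and the bound `x_i ≥ 0` holds by itself. This justifies the
elimination and the reflection, both of which keep the vector `d` valid. Nonexistence is always
certified by a ray, which is lifted back through the reductions (`reduceAndPivot_spec`).

For the whole program, any two solutions of the optimality conditions have the same gradient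
(`mulVec_eq_of_kktAt`). If a reduced solution fails the sign test at index `i`, then no optimal
solution has `x_i` at the bound tested. When all tests fail, every optimal solution lies strictly
between the bounds, so it satisfies `q + Mx = 0`; conversely every feasible solution of this system
is optimal (`resolveQP_spec`).

In an irreducible block, deleting two indices leaves a nonsingular matrix
(`eq_zero_of_quad_eq_zero`): a null vector `x` vanishing at two indices gives `M̄|x| = 0`, and its
zeros spread along the nonzero entries of `M`. Hence only two variables survive the elimination, and
Fourier–Motzkin elimination needs `O(n²)` operations.

With an updated inverse a pivot costs `O(n²)`, so one run of PPPA costs `O(n³)` and the at most `2n`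
runs cost `O(n⁴)`. The final check inverts at most `n` blocks at `O(n³)` each. The cost bounds hold
for arbitrary data, because every loop has an explicit limit. -/

namespace BoundedQP

open Finset

/-! ## Evaluation and cost of the elementary programs -/

section Calculus

variable {K α β σ : Type} [Field K] [LinearOrder K] {n : ℕ}

@[simp] theorem eval_bind (p : Prog K α) (f : α → Prog K β) :
    (p >>= f).eval = (f p.eval).eval := by
  change (p.bind f).eval = _
  induction p with
  | ret a => rfl
  | const m k ih => exact ih _
  | arith o x y k ih => exact ih _
  | less x y k ih => exact ih _
  | tick k ih => exact ih

@[simp] theorem cost_bind (p : Prog K α) (f : α → Prog K β) :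
    (p >>= f).cost = p.cost + (f p.eval).cost := by
  change (p.bind f).cost = _
  induction p with
  | ret a => simp [Prog.bind, Prog.cost, Prog.eval]
  | const m k ih => simp only [Prog.bind, Prog.cost, Prog.eval, ih]; omega
  | arith o x y k ih => simp only [Prog.bind, Prog.cost, Prog.eval, ih]; omega
  | less x y k ih => simp only [Prog.bind, Prog.cost, Prog.eval, ih]; omega
  | tick k ih => simp only [Prog.bind, Prog.cost, Prog.eval, ih]; omega

@[simp] theorem eval_pure (a : α) : (pure a : Prog K α).eval = a := rfl

@[simp] theorem cost_pure (a : α) : (pure a : Prog K α).cost = 0 := rfl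

@[simp] theorem eval_ite (c : Prop) [Decidable c] (p r : Prog K α) :
    (if c then p else r).eval = if c then p.eval else r.eval := apply_ite _ _ _ _

@[simp] theorem cost_ite (c : Prop) [Decidable c] (p r : Prog K α) :
    (if c then p else r).cost = if c then p.cost else r.cost := apply_ite _ _ _ _

@[simp] theorem eval_lit (m : ℕ) : (lit m : Prog K K).eval = m := rfl
@[simp] theorem cost_lit (m : ℕ) : (lit m : Prog K K).cost = 1 := rfl
@[simp] theorem eval_step : (step : Prog K Unit).eval = () := rfl
@[simp] theorem cost_step : (step : Prog K Unit).cost = 1 := rfl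
@[simp] theorem eval_add (x y : K) : (add x y).eval = x + y := rfl
@[simp] theorem cost_add (x y : K) : (add x y).cost = 1 := rfl
@[simp] theorem eval_sub (x y : K) : (sub x y).eval = x - y := rfl
@[simp] theorem cost_sub (x y : K) : (sub x y).cost = 1 := rfl
@[simp] theorem eval_mul (x y : K) : (mul x y).eval = x * y := rfl
@[simp] theorem cost_mul (x y : K) : (mul x y).cost = 1 := rfl
@[simp] theorem eval_div (x y : K) : (div x y).eval = x / y := rfl
@[simp] theorem cost_div (x y : K) : (div x y).cost = 1 := rfl
@[simp] theorem eval_lt (x y : K) : (lt x y).eval = decide (x < y) := rfl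
@[simp] theorem cost_lt (x y : K) : (lt x y).cost = 1 := rfl
@[simp] theorem eval_neg (x : K) : (neg x).eval = -x := by simp [neg]
@[simp] theorem cost_neg (x : K) : (neg x).cost = 2 := by simp [neg]
@[simp] theorem eval_isPos (x : K) : (isPos x).eval = decide (0 < x) := by simp [isPos]
@[simp] theorem cost_isPos (x : K) : (isPos x).cost = 2 := by simp [isPos]
@[simp] theorem eval_isNeg (x : K) : (isNeg x).eval = decide (x < 0) := by simp [isNeg]
@[simp] theorem cost_isNeg (x : K) : (isNeg x).cost = 2 := by simp [isNeg]

@[simp] theorem eval_tab : ∀ {n : ℕ} (f : Fin n → Prog K α), (tab f).eval = fun i => (f i).eval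
  | 0, f => by funext i; exact i.elim0
  | n + 1, f => by
    funext i
    simp only [tab, eval_bind, eval_pure, eval_tab]
    refine Fin.cases ?_ (fun j => ?_) i <;> simp

theorem cost_tab_le {c : ℕ} : ∀ {n : ℕ} {f : Fin n → Prog K α}, (∀ i, (f i).cost ≤ c) →
    (tab f).cost ≤ n * (c + 1)
  | 0, f, _ => by simp [tab]
  | n + 1, f, h => by
    have h₀ := h 0
    have h₁ := cost_tab_le (f := fun i : Fin n => f i.succ) fun i => h i.succ
    simp only [tab, cost_bind, cost_step, cost_pure, Nat.succ_mul]
    omega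

@[simp] theorem eval_tab2 (f : Fin n → Fin n → Prog K α) :
    (tab2 f).eval = fun i j => (f i j).eval := by simp [tab2]

theorem cost_tab2_le {c : ℕ} {f : Fin n → Fin n → Prog K α} (h : ∀ i j, (f i j).cost ≤ c) :
    (tab2 f).cost ≤ n * (n * (c + 1) + 1) :=
  cost_tab_le fun i => cost_tab_le (h i)

/-- A property that holds initially and is preserved by every pass holds after a loop. -/
theorem loop_induction : ∀ {n : ℕ} {s : σ} {f : σ → Fin n → Prog K σ} (P : ℕ → σ → Prop),
    P 0 s → (∀ (i : Fin n) t, P i t → P (i + 1) (f t i).eval) → P n (loop s f).eval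
  | 0, s, f, P, h₀, _ => h₀
  | n + 1, s, f, P, h₀, h => by
    simp only [loop, eval_bind]
    refine loop_induction (fun m => P (m + 1)) ?_ fun i t ht => ?_
    · simpa using h 0 s (by simpa using h₀)
    · simpa using h i.succ t (by simpa using ht)

theorem cost_loop_le {c : ℕ} : ∀ {n : ℕ} {s : σ} {f : σ → Fin n → Prog K σ},
    (∀ t i, (f t i).cost ≤ c) → (loop s f).cost ≤ n * (c + 1)
  | 0, s, f, _ => by simp [loop]
  | n + 1, s, f, h => by
    have h₀ := h s 0
    have h₁ := cost_loop_le (s := (f s 0).eval) (f := fun t (i : Fin n) => f t i.succ)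
      fun t i => h t i.succ
    simp only [loop, cost_bind, cost_step, Nat.succ_mul]
    omega

theorem cost_loopList_le {c : ℕ} {f : σ → α → Prog K σ} (h : ∀ t a, (f t a).cost ≤ c) :
    ∀ (l : List α) (s : σ), (loopList l s f).cost ≤ l.length * (c + 1)
  | [], s => by simp [loopList]
  | a :: l, s => by
    have h₀ := h s a
    have h₁ := cost_loopList_le h l (f s a).eval
    simp only [loopList, cost_bind, cost_step, List.length_cons, Nat.succ_mul]
    omega

@[simp] theorem eval_sumOn (c : Fin n → Bool) (f : Fin n → Prog K K) :
    (sumOn c f).eval = ∑ i with c i, (f i).eval := by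
  have key : ∀ {m : ℕ} (c : Fin m → Bool) (f : Fin m → Prog K K) (s : K),
      (loop s fun s i => if c i then do add s (← f i) else pure s).eval =
        s + ∑ i with c i, (f i).eval := by
    intro m
    induction m with
    | zero => intro c f s; simp [loop]
    | succ m ih =>
      intro c f s
      simp only [loop, eval_bind, ih, Finset.sum_filter, Fin.sum_univ_succ]
      by_cases h : c 0 <;> simp [h, add_assoc]
  simp [sumOn, key]

theorem cost_sumOn_le {b : ℕ} {c : Fin n → Bool} {f : Fin n → Prog K K}
    (h : ∀ i, (f i).cost ≤ b) : (sumOn c f).cost ≤ n * (b + 2) + 1 := by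
  have := cost_loop_le (n := n) (s := (0 : K)) (c := b + 1)
    (f := fun s i => if c i then do add s (← f i) else pure s) fun t i => by
      have := h i
      simp only [cost_ite, cost_bind, cost_add, cost_pure]
      split_ifs <;> omega
  simp only [sumOn, cost_bind, cost_lit, eval_lit, Nat.cast_zero]
  exact (add_comm _ _).trans_le (Nat.add_le_add_right this 1)

theorem findFirst_spec (f : Fin n → Prog K Bool) :
    (∀ i, (findFirst f).eval = some i → (f i).eval = true ∧ ∀ j < i, (f j).eval = false) ∧
      ((findFirst f).eval = none → ∀ j, (f j).eval = false) := by
  have := loop_induction (n := n) (s := (none : Option (Fin n)))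
    (f := fun s i => match s with
      | some j => pure (some j)
      | none => do if ← f i then pure (some i) else pure none)
    (fun m s => (∀ i, s = some i → (f i).eval = true ∧ ∀ j < i, (f j).eval = false) ∧
      (s = none → ∀ j : Fin n, j.1 < m → (f j).eval = false)) (by simp) (by
      rintro i (_ | k) ⟨h₁, h₂⟩
      · simp only [eval_bind, eval_ite, eval_pure]
        have h₂ := h₂ rfl
        by_cases h : (f i).eval = true
        · simp only [h, if_true, Option.some.injEq, reduceCtorEq, false_imp_iff, and_true]
          rintro _ rfl
          exact ⟨h, fun j hj => h₂ j hj⟩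
        · simp only [h, if_false, Bool.false_eq_true, reduceCtorEq, false_imp_iff, true_imp_iff,
            implies_true, true_and]
          intro j hj
          rcases Nat.lt_succ_iff_lt_or_eq.1 hj with hj | hj
          · exact h₂ j hj
          · rw [Fin.ext hj]; simpa using h
      · exact ⟨h₁, by simp⟩)
  exact ⟨this.1, fun h j => this.2 h j j.2⟩

theorem cost_findFirst_le {c : ℕ} {f : Fin n → Prog K Bool} (h : ∀ i, (f i).cost ≤ c) :
    (findFirst f).cost ≤ n * (c + 1) := by
  refine cost_loop_le fun t i => ?_
  have := h i
  rcases t with _ | j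
  · simp only [cost_bind, cost_ite, cost_pure]
    split_ifs <;> omega
  · simp

end Calculus

/-! ## Convex quadratic programs -/

section Convex

variable {ι : Type*} [Fintype ι] {n : ℕ}

/-- The quadratic form `xᵀMx`. -/
def quad (M : ι → ι → ℝ) (x : ι → ℝ) : ℝ := ∑ i, x i * ∑ j, M i j * x j

/-- Positive semidefiniteness in terms of sums. -/
def IsPSD (M : ι → ι → ℝ) : Prop := (∀ i j, M i j = M j i) ∧ ∀ x, 0 ≤ quad M x

theorem isPSD_of_posSemidef {M : Matrix ι ι ℝ} (h : M.PosSemidef) : IsPSD M := by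
  refine ⟨fun i j => by simpa using (h.1.apply i j).symm, fun x => ?_⟩
  simpa [quad, dotProduct, Matrix.mulVec] using h.dotProduct_mulVec_nonneg x

theorem sum_mul_sum_comm {M : ι → ι → ℝ} (hM : ∀ i j, M i j = M j i) (x y : ι → ℝ) :
    ∑ i, x i * ∑ j, M i j * y j = ∑ i, y i * ∑ j, M i j * x j := by
  simp only [Finset.mul_sum]
  rw [Finset.sum_comm]
  exact Finset.sum_congr rfl fun i _ => Finset.sum_congr rfl fun j _ => by rw [hM i j]; ring

theorem quad_add_smul {M : ι → ι → ℝ} (hM : ∀ i j, M i j = M j i) (x v : ι → ℝ) (t : ℝ) :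
    quad M (fun i => x i + t * v i) =
      quad M x + 2 * t * (∑ i, v i * ∑ j, M i j * x j) + t ^ 2 * quad M v := by
  have h := sum_mul_sum_comm hM x v
  have : quad M (fun i => x i + t * v i) = quad M x + t * (∑ i, x i * ∑ j, M i j * v j) +
      t * (∑ i, v i * ∑ j, M i j * x j) + t ^ 2 * quad M v := by
    simp only [quad, Finset.mul_sum, ← Finset.sum_add_distrib]
    exact Finset.sum_congr rfl fun i _ => Finset.sum_congr rfl fun j _ => by ring
  rw [this, h]; ring

/-- A zero of a nonnegative form is a minimum, so the derivative in every coordinate direction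
vanishes. -/
theorem IsPSD.mulVec_eq_zero [DecidableEq ι] {M : ι → ι → ℝ} (hM : IsPSD M) {x : ι → ℝ}
    (hx : quad M x = 0) (i : ι) : ∑ j, M i j * x j = 0 := by
  have key : ∀ t : ℝ, 0 ≤ 2 * t * (∑ j, M i j * x j) + t ^ 2 * M i i := by
    intro t
    have := hM.2 fun k => x k + t * (if k = i then 1 else 0)
    rw [quad_add_smul hM.1, hx] at this
    simpa [quad] using this
  set a := ∑ j, M i j * x j
  have hm : 0 < |M i i| + 1 := by positivity
  -- A step against the slope, short enough for the linear term to win; adding `1` avoids division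
  -- by zero when `M i i = 0`.
  have := key (-a / (|M i i| + 1))
  have e : 2 * (-a / (|M i i| + 1)) * a + (-a / (|M i i| + 1)) ^ 2 * M i i =
      -(a ^ 2 * (2 * (|M i i| + 1) - M i i)) / (|M i i| + 1) ^ 2 := by field_simp; ring
  rw [e, div_nonneg_iff] at this
  have hb := le_abs_self (M i i)
  have hc := abs_nonneg (M i i)
  have hd : 0 < 2 * (|M i i| + 1) - M i i := by linarith
  rcases this with ⟨h, -⟩ | ⟨-, h⟩
  · have : a ^ 2 * (2 * (|M i i| + 1) - M i i) = 0 :=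
      le_antisymm (by linarith) (by positivity)
    rcases mul_eq_zero.1 this with h | h
    · exact pow_eq_zero_iff two_ne_zero |>.1 h
    · linarith
  · nlinarith [sq_nonneg (|M i i| + 1), pow_pos hm 2]

theorem IsPSD.diag_nonneg [DecidableEq ι] {M : ι → ι → ℝ} (hM : IsPSD M) (i : ι) :
    0 ≤ M i i := by
  simpa [quad] using hM.2 fun k => if k = i then 1 else 0

theorem IsPSD.row_eq_zero [DecidableEq ι] {M : ι → ι → ℝ} (hM : IsPSD M) {i : ι}
    (hi : M i i = 0) (j : ι) : M i j = 0 := by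
  have := hM.mulVec_eq_zero (x := fun k => if k = i then 1 else 0) (by simp [quad, hi]) j
  rw [hM.1]
  simpa using this

theorem IsPSD.submatrix_succAbove {M : Fin (n + 1) → Fin (n + 1) → ℝ} (hM : IsPSD M)
    (i : Fin (n + 1)) : IsPSD fun j k => M (i.succAbove j) (i.succAbove k) := by
  refine ⟨fun j k => hM.1 _ _, fun x => ?_⟩
  simpa [quad, Fin.sum_univ_succAbove _ i] using hM.2 (i.insertNth 0 x)

/-- The Schur complement of a positive diagonal entry is positive semidefinite. -/
theorem IsPSD.schur {M : Fin (n + 1) → Fin (n + 1) → ℝ} (hM : IsPSD M) {i : Fin (n + 1)}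
    (hi : 0 < M i i) :
    IsPSD fun j k => M (i.succAbove j) (i.succAbove k) -
      M (i.succAbove j) i * M i (i.succAbove k) / M i i := by
  refine ⟨fun j k => ?_, fun x => ?_⟩
  · dsimp only
    rw [hM.1 (i.succAbove j) (i.succAbove k), hM.1 i (i.succAbove k), hM.1 i (i.succAbove j)]
    ring
  · set a := ∑ k, M i (i.succAbove k) * x k with ha
    -- This value of the `i`-th coordinate annihilates row `i` of the product, and what remains of
    -- the form is that of the Schur complement.
    have h := hM.2 (i.insertNth (-a / M i i) x)
    have e : quad M (i.insertNth (-a / M i i) x) =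
        quad (fun j k => M (i.succAbove j) (i.succAbove k) -
      M (i.succAbove j) i * M i (i.succAbove k) / M i i) x := by
      simp only [quad, Fin.sum_univ_succAbove _ i, Fin.insertNth_apply_same,
        Fin.insertNth_apply_succAbove, ← ha]
      have h0 : M i i * (-a / M i i) + a = 0 := by field_simp; ring
      rw [h0, mul_zero, zero_add]
      refine Finset.sum_congr rfl fun j _ => ?_
      congr 1
      simp only [sub_mul, Finset.sum_sub_distrib]
      have : ∑ k, M (i.succAbove j) i * M i (i.succAbove k) / M i i * x k =
          M (i.succAbove j) i * a / M i i := by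
        rw [ha, Finset.mul_sum, Finset.sum_div]
        exact Finset.sum_congr rfl fun k _ => by ring
      rw [this]; ring
    rwa [e] at h

/-! ### Optimality conditions and rays -/

theorem objective_eq (M : Fin n → Fin n → ℝ) (q x : Fin n → ℝ) :
    objective M q x = ∑ i, q i * x i + 1 / 2 * quad M x := by
  simp [objective, quad, dotProduct, Matrix.mulVec]

theorem objective_add_smul {M : Fin n → Fin n → ℝ} (hM : ∀ i j, M i j = M j i)
    (q x v : Fin n → ℝ) (t : ℝ) :
    objective M q (fun i => x i + t * v i) = objective M q x +
      t * (∑ i, (q i + ∑ j, M i j * x j) * v i) + t ^ 2 / 2 * quad M v := by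
  rw [objective_eq, objective_eq, quad_add_smul hM]
  have e₁ : ∑ i, q i * (x i + t * v i) = ∑ i, q i * x i + t * ∑ i, q i * v i := by
    rw [Finset.mul_sum, ← Finset.sum_add_distrib]
    exact Finset.sum_congr rfl fun i _ => by ring
  have e₂ : ∑ i, (q i + ∑ j, M i j * x j) * v i =
      ∑ i, q i * v i + ∑ i, v i * ∑ j, M i j * x j := by
    rw [← Finset.sum_add_distrib]
    exact Finset.sum_congr rfl fun i _ => by ring
  rw [e₁, e₂]; ring

/-- The optimality conditions for the variable `x i`. -/
structure KKTAt (M : Fin n → Fin n → ℝ) (q : Fin n → ℝ) (u : Fin n → WithTop ℝ)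
    (x : Fin n → ℝ) (i : Fin n) : Prop where
  nonneg : 0 ≤ x i
  le : (x i : WithTop ℝ) ≤ u i
  grad_nonpos : 0 < x i → q i + ∑ j, M i j * x j ≤ 0
  grad_nonneg : (x i : WithTop ℝ) < u i → 0 ≤ q i + ∑ j, M i j * x j

/-- The optimality conditions. -/
def KKT (M : Fin n → Fin n → ℝ) (q : Fin n → ℝ) (u : Fin n → WithTop ℝ)
    (x : Fin n → ℝ) : Prop := ∀ i, KKTAt M q u x i

theorem KKTAt.mul_sub_nonneg {M : Fin n → Fin n → ℝ} {q x : Fin n → ℝ} {u : Fin n → WithTop ℝ}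
    {i : Fin n} (h : KKTAt M q u x i) {t : ℝ} (ht : 0 ≤ t) (htu : (t : WithTop ℝ) ≤ u i) :
    0 ≤ (q i + ∑ j, M i j * x j) * (t - x i) := by
  rcases lt_trichotomy t (x i) with hlt | heq | hlt
  · exact mul_nonneg_of_nonpos_of_nonpos (h.grad_nonpos (ht.trans_lt hlt)) (by linarith)
  · simp [heq]
  · exact mul_nonneg (h.grad_nonneg ((WithTop.coe_lt_coe.2 hlt).trans_le htu)) (by linarith)

/-- In the expansion around `x` the linear term is nonnegative by the optimality conditions, the
quadratic one by semidefiniteness. -/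
theorem KKT.isOptimal {M : Fin n → Fin n → ℝ} (hM : IsPSD M) {q x : Fin n → ℝ}
    {u : Fin n → WithTop ℝ} (h : KKT M q u x) : IsOptimal M q u x := by
  refine ⟨fun i => ⟨(h i).nonneg, (h i).le⟩, fun y hy => ?_⟩
  have e := objective_add_smul hM.1 q x (fun i => y i - x i) 1
  have : (fun i => x i + 1 * (y i - x i)) = y := by funext i; ring
  rw [this] at e
  have h₁ : 0 ≤ ∑ i, (q i + ∑ j, M i j * x j) * (y i - x i) :=
    Finset.sum_nonneg fun i _ => (h i).mul_sub_nonneg (hy i).1 (hy i).2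
  have h₂ := hM.2 fun i => y i - x i
  rw [e]; linarith

/-- A negative slope outweighs the curvature for short steps. This supplies the descent step within
a given distance from the bounds in `IsOptimal.kkt`. -/
theorem exists_pos_linear_add_sq_neg {a b c : ℝ} (ha : a < 0) (hc : 0 < c) :
    ∃ t, 0 < t ∧ t ≤ c ∧ t * a + t ^ 2 / 2 * b < 0 := by
  have hb : 0 < |b| + 1 := by positivity
  refine ⟨min c (-a / (|b| + 1)), lt_min hc (div_pos (by linarith) hb), min_le_left _ _, ?_⟩
  set t := min c (-a / (|b| + 1))
  have ht : 0 < t := lt_min hc (div_pos (by linarith) hb)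
  have h₁ : t * (|b| + 1) ≤ -a := by
    rw [← le_div_iff₀ hb]; exact min_le_right _ _
  have h₂ : t * b ≤ t * |b| := mul_le_mul_of_nonneg_left (le_abs_self b) ht.le
  have h₃ : a + t / 2 * b < 0 := by nlinarith [abs_nonneg b]
  nlinarith

/-- Since the constraints bound single variables, it suffices to move one coordinate at a time. -/
theorem IsOptimal.kkt {M : Fin n → Fin n → ℝ} (hM : IsPSD M) {q x : Fin n → ℝ}
    {u : Fin n → WithTop ℝ} (h : IsOptimal M q u x) : KKT M q u x := by
  have key : ∀ (i : Fin n) (t : ℝ), 0 ≤ x i + t → ((x i + t : ℝ) : WithTop ℝ) ≤ u i →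
      0 ≤ t * (q i + ∑ j, M i j * x j) + t ^ 2 / 2 * M i i := by
    intro i t h₀ hu
    have := h.2 (fun k => x k + t * (if k = i then 1 else 0)) fun k => by
      by_cases hk : k = i
      · subst hk; simpa using ⟨h₀, hu⟩
      · simpa [hk] using h.1 k
    rw [objective_add_smul hM.1] at this
    simp only [quad, mul_ite, mul_one, mul_zero, Finset.sum_ite_eq', Finset.mem_univ, if_true,
      ite_mul, one_mul, zero_mul] at this
    linarith
  intro i
  refine ⟨(h.1 i).1, (h.1 i).2, fun hx => ?_, fun hx => ?_⟩
  · by_contra! hg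
    obtain ⟨t, ht, htc, hneg⟩ := exists_pos_linear_add_sq_neg (b := M i i) (neg_neg_of_pos hg) hx
    have := key i (-t) (by linarith) (le_trans (WithTop.coe_le_coe.2 (by linarith)) (h.1 i).2)
    nlinarith
  · by_contra! hg
    obtain ⟨c, hc, hcu⟩ : ∃ c : ℝ, 0 < c ∧ ((x i + c : ℝ) : WithTop ℝ) ≤ u i := by
      rcases hu : u i with _ | b
      · exact ⟨1, one_pos, le_top⟩
      · have hx' : (x i : WithTop ℝ) < (b : WithTop ℝ) := by rw [hu] at hx; exact hx
        have := WithTop.coe_lt_coe.1 hx'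
        exact ⟨b - x i, by linarith, WithTop.coe_le_coe.2 (by linarith)⟩
    obtain ⟨t, ht, htc, hneg⟩ := exists_pos_linear_add_sq_neg (b := M i i) hg hc
    have h0 := (h.1 i).1
    have := key i t (by linarith) (le_trans (WithTop.coe_le_coe.2 (by linarith)) hcu)
    linarith

/-- A feasible direction along which the objective function is unbounded from below. -/
structure IsRay (M : Fin n → Fin n → ℝ) (q : Fin n → ℝ) (u : Fin n → WithTop ℝ)
    (v : Fin n → ℝ) : Prop where
  nonneg : ∀ i, 0 ≤ v i
  eq_zero : ∀ i, u i ≠ ⊤ → v i = 0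
  mulVec : ∀ i, ∑ j, M i j * v j = 0
  neg : ∑ i, q i * v i < 0

/-- Because `Mv = 0` and `M` is symmetric, the step `v` changes the objective by exactly `qᵀv < 0`.
-/
theorem IsRay.not_exists_isOptimal {M : Fin n → Fin n → ℝ} (hM : IsPSD M) {q v : Fin n → ℝ}
    {u : Fin n → WithTop ℝ} (h : IsRay M q u v) : ¬ ∃ x, IsOptimal M q u x := by
  rintro ⟨x, hx⟩
  have := hx.2 (fun i => x i + 1 * v i) fun i => by
    have h₁ := h.nonneg i
    refine ⟨by linarith [(hx.1 i).1], ?_⟩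
    by_cases hu : u i = ⊤
    · simp [hu]
    · simpa [h.eq_zero i hu] using (hx.1 i).2
  rw [objective_add_smul hM.1] at this
  have e₁ : quad M v = 0 := by simp [quad, h.mulVec]
  have e₂ : ∑ i, (q i + ∑ j, M i j * x j) * v i = ∑ i, q i * v i := by
    have := sum_mul_sum_comm hM.1 v x
    simp only [h.mulVec, mul_zero, Finset.sum_const_zero] at this
    simp only [add_mul, Finset.sum_add_distrib]
    rw [add_eq_left, ← this]
    exact Finset.sum_congr rfl fun i _ => mul_comm _ _
  rw [e₁, e₂] at this
  linarith [h.neg]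

/-- Two vectors that differ only in variables for which both satisfy the optimality conditions have
the same gradient. -/
theorem mulVec_eq_of_kktAt {M : Fin n → Fin n → ℝ} (hM : IsPSD M) {q x y : Fin n → ℝ}
    {u : Fin n → WithTop ℝ} (h : ∀ j, x j = y j ∨ KKTAt M q u x j ∧ KKTAt M q u y j) (i : Fin n) :
    ∑ j, M i j * x j = ∑ j, M i j * y j := by
  have e : ∀ i, ∑ j, M i j * (x j - y j) = ∑ j, M i j * x j - ∑ j, M i j * y j := fun i => by
    simp [mul_sub, Finset.sum_sub_distrib]
  -- Each summand `(x_j - y_j)(M(x - y))_j` is nonpositive: add the two variational inequalities in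
  -- coordinate `j`, where `q` cancels.
  have h0 : quad M (fun j => x j - y j) = 0 := by
    refine le_antisymm (Finset.sum_nonpos fun j _ => ?_) (hM.2 _)
    rw [e]
    rcases h j with h | ⟨hx, hy⟩
    · simp [h]
    · have h₁ := hx.mul_sub_nonneg hy.nonneg hy.le
      have h₂ := hy.mul_sub_nonneg hx.nonneg hx.le
      nlinarith
  have := hM.mulVec_eq_zero h0 i
  rw [e] at this
  linarith

/-- Existence by compactness. It serves only to produce the vectors `y` of
`Dominates.exists_mulVec_eq`. -/
theorem exists_kkt_of_box {M : Fin n → Fin n → ℝ} (hM : IsPSD M) (q : Fin n → ℝ)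
    {b : Fin n → ℝ} (hb : ∀ i, 0 ≤ b i) : ∃ x, KKT M q (fun i => (b i : WithTop ℝ)) x := by
  have hc : Continuous fun x : Fin n → ℝ => objective M q x := by
    have : (fun x : Fin n → ℝ => objective M q x) =
        fun x => ∑ i, q i * x i + 1 / 2 * quad M x := funext fun x => objective_eq M q x
    rw [this]
    unfold quad
    fun_prop
  obtain ⟨x, hx, hmin⟩ := (isCompact_Icc (a := (0 : Fin n → ℝ)) (b := b)).exists_isMinOn
    ⟨0, le_rfl, hb⟩ hc.continuousOn
  refine ⟨x, IsOptimal.kkt hM ⟨fun i => ⟨hx.1 i, WithTop.coe_le_coe.2 (hx.2 i)⟩, fun y hy => ?_⟩⟩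
  exact hmin ⟨fun i => (hy i).1, fun i => WithTop.coe_le_coe.1 (hy i).2⟩

end Convex

/-! ## Dominance and the parametric vector -/

section Dominance

variable {n : ℕ}

/-- `d > 0` and `M̄ d ≥ 0` for the comparison matrix `M̄`. -/
structure Dominates (M : Fin n → Fin n → ℝ) (d : Fin n → ℝ) : Prop where
  pos : ∀ i, 0 < d i
  nonneg : ∀ i, 0 ≤ ∑ j, comparisonMatrix M i j * d j

/-- The vector `½ (M + M̄) d`. -/
noncomputable def halfSum (M : Fin n → Fin n → ℝ) (d : Fin n → ℝ) (i : Fin n) : ℝ :=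
  (∑ j, (M i j + comparisonMatrix M i j) * d j) / 2

theorem comparisonMatrix_self (M : Fin n → Fin n → ℝ) (i : Fin n) :
    comparisonMatrix M i i = M i i := by simp [comparisonMatrix]

theorem comparisonMatrix_of_ne (M : Fin n → Fin n → ℝ) {i j : Fin n} (h : i ≠ j) :
    comparisonMatrix M i j = -|M i j| := by simp [comparisonMatrix, h]

/-- The left side is at most the sum of `max(m_ij, 0) d_j` over `j ≠ i`, and `p_i` exceeds this sum
by `(M̄d)_i ≥ 0`. -/
theorem Dominates.mulVec_le_halfSum {M : Fin n → Fin n → ℝ} {d : Fin n → ℝ}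
    (h : Dominates M d) {y : Fin n → ℝ} (hy : ∀ j, 0 ≤ y j ∧ y j ≤ d j) {i : Fin n}
    (hi : y i = 0) : ∑ j, M i j * y j ≤ halfSum M d i := by
  have h₀ := h.nonneg i
  rw [halfSum, le_div_iff₀ two_pos, ← sub_nonneg, Finset.sum_mul, ← Finset.sum_sub_distrib]
  refine le_trans (b := 2 * ∑ j, comparisonMatrix M i j * d j) (by linarith) ?_
  rw [Finset.mul_sum]
  refine Finset.sum_le_sum fun j _ => ?_
  have hd := h.pos j
  by_cases hij : i = j
  · subst hij
    rw [comparisonMatrix_self, hi]; nlinarith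
  · rw [comparisonMatrix_of_ne M hij]
    obtain ⟨h₁, h₂⟩ := hy j
    rcases abs_cases (M i j) with ⟨e, hs⟩ | ⟨e, hs⟩ <;> rw [e] <;> nlinarith

/-- Off the diagonal the coefficients of `halfSum` are `min(m_ij, 0)`, and `min(m_ij, 0) d_j ≤ m_ij
y_j`. -/
theorem Dominates.halfSum_le_mulVec {M : Fin n → Fin n → ℝ} {d : Fin n → ℝ}
    {y : Fin n → ℝ} (hy : ∀ j, 0 ≤ y j ∧ y j ≤ d j) {i : Fin n}
    (hi : y i = d i) : halfSum M d i ≤ ∑ j, M i j * y j := by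
  rw [halfSum, div_le_iff₀ two_pos, Finset.sum_mul]
  refine Finset.sum_le_sum fun j _ => ?_
  by_cases hij : i = j
  · subst hij
    rw [comparisonMatrix_self, hi]; nlinarith
  · rw [comparisonMatrix_of_ne M hij]
    obtain ⟨h₁, h₂⟩ := hy j
    rcases abs_cases (M i j) with ⟨e, hs⟩ | ⟨e, hs⟩ <;> rw [e] <;> nlinarith

theorem Dominates.halfSum_nonneg {M : Fin n → Fin n → ℝ} {d : Fin n → ℝ}
    (h : Dominates M d) (i : Fin n) : 0 ≤ halfSum M d i := by
  simpa using h.mulVec_le_halfSum (y := fun _ => 0) (i := i) (fun j => ⟨le_rfl, (h.pos j).le⟩) rfl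

/-- The test vector `d_j e_j` gives `m_ij d_j ≤ p_i = 0`. This sign condition is what makes the
reductions legitimate. -/
theorem Dominates.nonpos_of_halfSum_eq_zero {M : Fin n → Fin n → ℝ} {d : Fin n → ℝ}
    (h : Dominates M d) {i j : Fin n} (hi : halfSum M d i = 0) (hij : i ≠ j) : M i j ≤ 0 := by
  have := h.mulVec_le_halfSum (y := fun k => if k = j then d k else 0) (i := i)
    (fun k => by have := h.pos k; split_ifs <;> constructor <;> linarith) (by simp [hij])
  simp only [mul_ite, mul_zero, Finset.sum_ite_eq', Finset.mem_univ, if_true, hi] at this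
  have hd := h.pos j
  by_contra! hc
  nlinarith

/-- On every set of indices the parametric vector is the image of a vector between `0` and `d`. -/
theorem Dominates.exists_mulVec_eq {M : Fin n → Fin n → ℝ} (hM : IsPSD M) {d : Fin n → ℝ}
    (h : Dominates M d) (s : Finset (Fin n)) : ∃ y : Fin n → ℝ, (∀ j, 0 ≤ y j ∧ y j ≤ d j) ∧
      (∀ j ∉ s, y j = 0) ∧ ∀ i ∈ s, ∑ j, M i j * y j = halfSum M d i := by
  -- Minimize `½yᵀMy - pᵀy` over the box with sides `[0, d_i]` for `i ∈ s` and `{0}` for the others.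
  obtain ⟨y, hy⟩ := exists_kkt_of_box hM (fun i => -halfSum M d i)
    (b := fun i => if i ∈ s then d i else 0) fun i => by
      have := h.pos i; split_ifs <;> linarith
  have hle : ∀ j, y j ≤ if j ∈ s then d j else 0 := fun j => WithTop.coe_le_coe.1 (hy j).le
  have hbox : ∀ j, 0 ≤ y j ∧ y j ≤ d j := fun j => by
    have h₁ := hle j
    have := h.pos j
    refine ⟨(hy j).nonneg, ?_⟩
    split_ifs at h₁ <;> linarith
  refine ⟨y, hbox, fun j hj => ?_, fun i hi => ?_⟩
  · have := hle j
    rw [if_neg hj] at this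
    exact le_antisymm this (hy j).nonneg
  · have h₁ := (hy i).grad_nonpos
    have h₂ := (hy i).grad_nonneg
    simp only [hi, if_true, WithTop.coe_lt_coe] at h₂
    have hd := h.pos i
    -- At an active bound the optimality condition gives one inequality between `(My)_i` and `p_i`,
    -- and the row bound for `y_i = 0` or `y_i = d_i` gives the opposite one.
    rcases (hbox i).1.eq_or_lt with h0 | h0
    · have := h.mulVec_le_halfSum hbox h0.symm
      have := h₂ (by linarith)
      linarith
    · have h₁ := h₁ h0
      rcases (hbox i).2.eq_or_lt with h3 | h3
      · have := Dominates.halfSum_le_mulVec (M := M) hbox h3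
        linarith
      · have := h₂ h3
        linarith

end Dominance

/-! ## The inverse of a principal submatrix -/

section Inverse

variable {n : ℕ}

/-- The rows and columns of `B` in `s` form the inverse of the principal submatrix of the symmetric
matrix `M` with rows and columns in `s`. -/
structure InvOn (M : Fin n → Fin n → ℝ) (s : Finset (Fin n)) (B : Fin n → Fin n → ℝ) : Prop where
  symm : ∀ i ∈ s, ∀ j ∈ s, B i j = B j i
  mul : ∀ i ∈ s, ∀ j ∈ s, ∑ k ∈ s, M i k * B k j = if i = j then 1 else 0

/-- The vector `r̄` given by `r̄_s = M_ss⁻¹ r_s` and `r̄_i = r_i - M_is r̄_s` for `i ∉ s`. -/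
def bar (M : Fin n → Fin n → ℝ) (s : Finset (Fin n)) (B : Fin n → Fin n → ℝ) (r : Fin n → ℝ)
    (i : Fin n) : ℝ :=
  if i ∈ s then ∑ j ∈ s, B i j * r j else r i - ∑ j ∈ s, M i j * ∑ k ∈ s, B j k * r k

theorem eval_transform (M : Fin n → Fin n → ℝ) (a : Fin n → Bool) (B : Fin n → Fin n → ℝ)
    (r : Fin n → ℝ) : (transform M a B r).eval = bar M {i | a i} B r := by
  funext i
  simp [transform, bar]

theorem eval_schurEntry (M : Fin n → Fin n → ℝ) (a : Fin n → Bool) (B : Fin n → Fin n → ℝ)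
    (i : Fin n) : (schurEntry M a B i).eval = (fun k => ∑ j with a j, B k j * M j i,
      M i i - ∑ j with a j, M i j * ∑ k with a k, B j k * M k i) := by
  simp [schurEntry]

variable {M : Fin n → Fin n → ℝ} {s : Finset (Fin n)} {B : Fin n → Fin n → ℝ}

theorem invOn_empty : InvOn M ∅ B := ⟨by simp, by simp⟩

theorem InvOn.mulVec (h : InvOn M s B) (r : Fin n → ℝ) {i : Fin n} (hi : i ∈ s) :
    ∑ k ∈ s, M i k * ∑ j ∈ s, B k j * r j = r i := by
  simp only [Finset.mul_sum, ← mul_assoc]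
  rw [Finset.sum_comm]
  simp only [← Finset.sum_mul]
  rw [Finset.sum_congr rfl fun j hj => by rw [h.mul i hi j hj]]
  simp [hi]

/-- `InvOn` records only the right inverse; the symmetry of `M` and `B` turns it into a left
inverse, which gives uniqueness. -/
theorem InvOn.unique (hM : ∀ i j, M i j = M j i) (h : InvOn M s B) {r y : Fin n → ℝ}
    (hy : ∀ i ∈ s, ∑ k ∈ s, M i k * y k = r i) {i : Fin n} (hi : i ∈ s) :
    y i = ∑ j ∈ s, B i j * r j := by
  rw [Finset.sum_congr rfl fun j hj => by rw [← hy j hj]]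
  simp only [Finset.mul_sum, ← mul_assoc]
  rw [Finset.sum_comm]
  simp only [← Finset.sum_mul]
  have : ∀ k ∈ s, (∑ j ∈ s, B i j * M j k) * y k = if k = i then y k else 0 := by
    intro k hk
    have e : ∑ j ∈ s, B i j * M j k = ∑ j ∈ s, M k j * B j i :=
      Finset.sum_congr rfl fun j hj => by rw [h.symm i hi j hj, hM j k]; ring
    rw [e, h.mul k hk i hi]
    split_ifs <;> simp
  rw [Finset.sum_congr rfl this]
  simp [hi]

theorem bar_of_mem {r : Fin n → ℝ} {i : Fin n} (hi : i ∈ s) :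
    bar M s B r i = ∑ j ∈ s, B i j * r j := if_pos hi

theorem bar_of_notMem {r : Fin n → ℝ} {i : Fin n} (hi : i ∉ s) :
    bar M s B r i = r i - ∑ j ∈ s, M i j * bar M s B r j := by
  rw [bar, if_neg hi]
  congr 1
  exact Finset.sum_congr rfl fun j hj => by rw [bar_of_mem hj]

theorem InvOn.sum_mul_bar (h : InvOn M s B) (r : Fin n → ℝ) {i : Fin n} (hi : i ∈ s) :
    ∑ j ∈ s, M i j * bar M s B r j = r i := by
  rw [← h.mulVec r hi]
  exact Finset.sum_congr rfl fun j hj => by rw [bar_of_mem hj]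

theorem bar_add_smul (r r' : Fin n → ℝ) (t : ℝ) (i : Fin n) :
    bar M s B (fun j => r j + t * r' j) i = bar M s B r i + t * bar M s B r' i := by
  have e : ∀ i, ∑ j ∈ s, B i j * (r j + t * r' j) =
      ∑ j ∈ s, B i j * r j + t * ∑ j ∈ s, B i j * r' j := fun i => by
    rw [Finset.mul_sum, ← Finset.sum_add_distrib]
    exact Finset.sum_congr rfl fun j _ => by ring
  by_cases hi : i ∈ s
  · simp only [bar_of_mem hi, e]
  · simp only [bar, if_neg hi, e]
    have : ∑ j ∈ s, M i j * (∑ j_1 ∈ s, B j j_1 * r j_1 + t * ∑ j_1 ∈ s, B j j_1 * r' j_1) =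
        ∑ j ∈ s, M i j * (∑ k ∈ s, B j k * r k) + t * ∑ j ∈ s, M i j * ∑ k ∈ s, B j k * r' k := by
      rw [Finset.mul_sum, ← Finset.sum_add_distrib]
      exact Finset.sum_congr rfl fun j _ => by ring
    rw [this]; ring

/-- The bordering formula. Only symmetry and a nonzero Schur entry are required, so that it applies
to the pivots and to the inversion of a block alike. -/
theorem InvOn.addIndex (hM : ∀ i j, M i j = M j i) (hB : InvOn M s B) {i : Fin n} (hi : i ∉ s)
    {h : Fin n → ℝ} (hh : ∀ k ∈ s, h k = ∑ j ∈ s, B k j * M j i) {e : ℝ}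
    (he : e = M i i - ∑ j ∈ s, M i j * h j) (he0 : e ≠ 0) :
    InvOn M (insert i s) (addIndex B i h e).eval := by
  have hne : ∀ k ∈ s, k ≠ i := fun k hk => by rintro rfl; exact hi hk
  have ev : ∀ k l, (BoundedQP.addIndex B i h e).eval k l = if k = i then
      if l = i then 1 / e else -(h l / e) else
      if l = i then -(h k / e) else B k l + h k * h l / e := fun k l => by
    simp only [BoundedQP.addIndex, eval_tab2, eval_ite, eval_bind, eval_lit, eval_div, eval_neg,
      eval_mul, eval_add, Nat.cast_one]
  -- the defining property of `h`
  have hMh : ∀ k ∈ s, ∑ m ∈ s, M k m * h m = M k i := fun k hk => by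
    rw [← hB.mulVec (fun j => M j i) hk]
    exact Finset.sum_congr rfl fun m hm => by rw [hh m hm]
  have hMB : ∀ l ∈ s, ∑ m ∈ s, M i m * B m l = h l := fun l hl => by
    rw [hh l hl]
    exact Finset.sum_congr rfl fun m hm => by rw [hM i m, hB.symm m hm l hl]; ring
  have col : ∀ k, ∑ m ∈ s, M k m * -(h m / e) = -(∑ m ∈ s, M k m * h m) / e := fun k => by
    rw [← Finset.sum_neg_distrib, Finset.sum_div]
    exact Finset.sum_congr rfl fun m _ => by ring
  have blk : ∀ k l, ∑ m ∈ s, M k m * (B m l + h m * h l / e) =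
      ∑ m ∈ s, M k m * B m l + (∑ m ∈ s, M k m * h m) * h l / e := fun k l => by
    rw [Finset.sum_mul, Finset.sum_div, ← Finset.sum_add_distrib]
    exact Finset.sum_congr rfl fun m _ => by ring
  refine ⟨fun k hk l hl => ?_, fun k hk l hl => ?_⟩
  · rw [ev, ev]
    rw [Finset.mem_insert] at hk hl
    rcases hk with rfl | hk <;> rcases hl with rfl | hl
    · rfl
    · simp [hne l hl]
    · simp [hne k hk]
    · simp only [hne k hk, hne l hl, if_false, hB.symm k hk l hl]; ring
  · rw [Finset.sum_insert hi]
    rw [Finset.mem_insert] at hl hk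
    rcases hl with rfl | hl
    · have : ∑ m ∈ s, M k m * (BoundedQP.addIndex B l h e).eval m l = ∑ m ∈ s, M k m * -(h m / e) :=
        Finset.sum_congr rfl fun m hm => by rw [ev]; simp [hne m hm]
      rw [this, col, ev, if_pos rfl, if_pos rfl]
      rcases hk with rfl | hk
      · rw [if_pos rfl]
        have : ∑ j ∈ s, M k j * h j = M k k - e := by rw [he]; ring
        rw [this]; field_simp; ring
      · rw [hMh k hk, if_neg (hne k hk)]; field_simp; ring
    · have : ∑ m ∈ s, M k m * (BoundedQP.addIndex B i h e).eval m l =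
          ∑ m ∈ s, M k m * (B m l + h m * h l / e) :=
        Finset.sum_congr rfl fun m hm => by rw [ev]; simp [hne m hm, hne l hl]
      rw [this, blk, ev, if_pos rfl, if_neg (hne l hl)]
      rcases hk with rfl | hk
      · rw [hMB l hl, if_neg (hne l hl).symm]
        have : ∑ j ∈ s, M k j * h j = M k k - e := by rw [he]; ring
        rw [this]; field_simp; ring
      · rw [hMh k hk, hB.mul k hk l hl]; ring

/-- Column `j` of `B`, extended by zero, has the form value `B j j`. If this were zero, `M` would
annihilate the column, although the entry `j` of the product is `1`. -/
theorem InvOn.diag_ne_zero (hM : IsPSD M) (hB : InvOn M s B) {j : Fin n} (hj : j ∈ s) :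
    B j j ≠ 0 := by
  intro h0
  set y : Fin n → ℝ := fun k => if k ∈ s then B k j else 0
  have hy : ∀ i, ∑ k, M i k * y k = ∑ k ∈ s, M i k * B k j := fun i => by
    simp [y, mul_ite]
  have hq : quad M y = 0 := by
    simp only [quad, hy]
    have : ∀ i ∈ univ, y i * ∑ k ∈ s, M i k * B k j = if i = j then B j j else 0 := by
      intro i _
      by_cases hi : i ∈ s
      · rw [hB.mul i hi j hj]
        by_cases hij : i = j
        · subst hij; simp [y, hj]
        · simp [hij]
      · have : i ≠ j := by rintro rfl; exact hi hj
        simp [y, hi, this]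
    rw [Finset.sum_congr rfl this]
    simp [h0]
  have := hM.mulVec_eq_zero hq j
  rw [hy, hB.mul j hj j hj] at this
  simp at this

theorem InvOn.dropIndex (hM : IsPSD M) (hB : InvOn M s B) {j : Fin n} (hj : j ∈ s) :
    InvOn M (s.erase j) (dropIndex B j).eval := by
  have hb := hB.diag_ne_zero hM hj
  have ev : ∀ k l, (BoundedQP.dropIndex B j).eval k l = B k l - B k j * B j l / B j j :=
    fun k l => by simp [BoundedQP.dropIndex]
  refine ⟨fun k hk l hl => ?_, fun k hk l hl => ?_⟩ <;> rw [Finset.mem_erase] at hk hl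
  · rw [ev, ev, hB.symm k hk.2 l hl.2, hB.symm k hk.2 j hj, hB.symm j hj l hl.2]; ring
  -- The update clears row `j`, so the sum over `s.erase j` may be computed over `s`.
  · have e : M k j * (BoundedQP.dropIndex B j).eval j l = 0 := by rw [ev]; field_simp; ring
    have e' := Finset.add_sum_erase s (fun m => M k m * (BoundedQP.dropIndex B j).eval m l) hj
    rw [e, zero_add] at e'
    have : ∑ m ∈ s, M k m * (BoundedQP.dropIndex B j).eval m l =
        ∑ m ∈ s, M k m * B m l - (∑ m ∈ s, M k m * B m j) * B j l / B j j := by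
      rw [Finset.sum_mul, Finset.sum_div, ← Finset.sum_sub_distrib]
      exact Finset.sum_congr rfl fun m _ => by rw [ev]; ring
    rw [e', this, hB.mul k hk.2 l hl.2, hB.mul k hk.2 j hj, if_neg hk.1]; ring

/-! ### Signs of the parametric vector under principal pivoting -/

/-- The vector of the transformed parametric values is nonnegative. -/
theorem InvOn.bar_halfSum_nonneg (hM : IsPSD M) (hB : InvOn M s B) {d : Fin n → ℝ}
    (hd : Dominates M d) (i : Fin n) : 0 ≤ bar M s B (halfSum M d) i := by
  obtain ⟨y, hy, hys, hMy⟩ := hd.exists_mulVec_eq hM s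
  have hsum : ∀ i, ∑ k ∈ s, M i k * y k = ∑ k, M i k * y k := fun i =>
    Finset.sum_subset (Finset.subset_univ _) fun k _ hk => by rw [hys k hk, mul_zero]
  -- On `s` the transformed vector is `y` itself; outside `s` it is `p_i - (My)_i` with `y_i = 0`.
  have hbar : ∀ k ∈ s, bar M s B (halfSum M d) k = y k := fun k hk => by
    rw [bar_of_mem hk]
    exact (hB.unique hM.1 (fun i hi => by rw [hsum, hMy i hi]) hk).symm
  by_cases hi : i ∈ s
  · rw [hbar i hi]; exact (hy i).1
  · rw [bar_of_notMem hi, Finset.sum_congr rfl fun k hk => by rw [hbar k hk], hsum]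
    exact sub_nonneg.2 (hd.mulVec_le_halfSum hy (hys i hi))

/-- An index with a positive parametric value has a positive Schur complement entry. -/
theorem InvOn.schur_pos (hM : IsPSD M) (hB : InvOn M s B) {d : Fin n → ℝ}
    (hd : Dominates M d) {i : Fin n} (hi : i ∉ s) (hp : 0 < bar M s B (halfSum M d) i) :
    0 < M i i - ∑ j ∈ s, M i j * ∑ k ∈ s, B j k * M k i := by
  -- Taken for the enlarged set, so that `y` solves row `i` as well.
  obtain ⟨y, hy, hys, hMy⟩ := hd.exists_mulVec_eq hM (insert i s)
  have hsum : ∀ k, M k i * y i + ∑ j ∈ s, M k j * y j = ∑ j, M k j * y j := fun k => by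
    rw [← Finset.sum_insert hi (f := fun j => M k j * y j)]
    exact Finset.sum_subset (Finset.subset_univ _) fun j _ hj => by rw [hys j hj, mul_zero]
  -- on `s` the parametric vector is transformed into `y + y_i h`
  have hbar : ∀ j ∈ s, bar M s B (halfSum M d) j = y j + y i * ∑ k ∈ s, B j k * M k i := by
    intro j hj
    rw [bar_of_mem hj]
    refine (hB.unique hM.1 (y := fun j => y j + y i * ∑ k ∈ s, B j k * M k i) (fun k hk => ?_)
      hj).symm
    have e := hB.mulVec (fun k => M k i) hk
    rw [← hMy k (Finset.mem_insert_of_mem hk), ← hsum, ← e, Finset.sum_mul,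
      ← Finset.sum_add_distrib]
    exact Finset.sum_congr rfl fun m _ => by ring
  rw [bar_of_notMem hi, Finset.sum_congr rfl fun j hj => by rw [hbar j hj],
    ← hMy i (Finset.mem_insert_self _ _), ← hsum] at hp
  -- The transformed value at `i` is the Schur entry times `y i ≥ 0`, so its positivity passes to
  -- the entry.
  have e : M i i * y i + ∑ j ∈ s, M i j * y j -
      ∑ j ∈ s, M i j * (y j + y i * ∑ k ∈ s, B j k * M k i) =
      (M i i - ∑ j ∈ s, M i j * ∑ k ∈ s, B j k * M k i) * y i := by
    have : ∑ j ∈ s, M i j * (y j + y i * ∑ k ∈ s, B j k * M k i) =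
        ∑ j ∈ s, M i j * y j + (∑ j ∈ s, M i j * ∑ k ∈ s, B j k * M k i) * y i := by
      rw [Finset.sum_mul, ← Finset.sum_add_distrib]
      exact Finset.sum_congr rfl fun j _ => by ring
    rw [this]; ring
  rw [e] at hp
  exact pos_of_mul_pos_left hp (hy i).1

end Inverse

/-! ## The pivoting iterations -/

section Pivot

variable {n : ℕ} {M : Fin n → Fin n → ℝ} {q p : Fin n → ℝ} {u : Fin n → WithTop ℝ}
  {st : Fin n → Status} {B : Fin n → Fin n → ℝ}

/-- The vector `x` solves the problem with linear term `q + τ p`, and the variables have the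
positions given by `st`. -/
structure SolvesAt (M : Fin n → Fin n → ℝ) (q p : Fin n → ℝ) (u : Fin n → WithTop ℝ)
    (st : Fin n → Status) (τ : ℝ) (x : Fin n → ℝ) : Prop where
  nonneg : ∀ i, 0 ≤ x i
  le : ∀ i, (x i : WithTop ℝ) ≤ u i
  lower : ∀ i, st i = .lower → x i = 0 ∧ 0 ≤ q i + τ * p i + ∑ j, M i j * x j
  between : ∀ i, st i = .between → q i + τ * p i + ∑ j, M i j * x j = 0
  upper : ∀ i, st i = .upper → x i = u i ∧ q i + τ * p i + ∑ j, M i j * x j ≤ 0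

theorem SolvesAt.kkt {x : Fin n → ℝ} (h : SolvesAt M q p u st 0 x) : KKT M q u x := by
  intro i
  rcases hi : st i
  · have := h.between i hi
    rw [zero_mul, add_zero] at this
    exact ⟨h.nonneg i, h.le i, fun _ => this.le, fun _ => this.ge⟩
  · have := h.lower i hi
    rw [zero_mul, add_zero] at this
    exact ⟨h.nonneg i, h.le i, fun h0 => absurd this.1 h0.ne', fun _ => this.2⟩
  · have := h.upper i hi
    rw [zero_mul, add_zero] at this
    exact ⟨h.nonneg i, h.le i, fun _ => this.2, fun h0 => absurd this.1 h0.ne⟩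

/-- The indices of the variables between their bounds. -/
def betweenSet (st : Fin n → Status) : Finset (Fin n) := {i | isBetween st i}

theorem mem_betweenSet {i : Fin n} : i ∈ betweenSet st ↔ st i = .between := by
  simp [betweenSet, isBetween]

theorem betweenSet_update_of_ne {i : Fin n} {a : Status} (ha : a ≠ .between) :
    betweenSet (Function.update st i a) = (betweenSet st).erase i := by
  ext j
  by_cases h : j = i
  · subst h; simp [mem_betweenSet, ha]
  · simp [mem_betweenSet, h]

theorem betweenSet_update_between {i : Fin n} :
    betweenSet (Function.update st i .between) = insert i (betweenSet st) := by
  ext j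
  by_cases h : j = i
  · subst h; simp [mem_betweenSet]
  · simp [mem_betweenSet, h]

/-- The linear term after the variables at their upper bounds have been fixed. -/
noncomputable def shifted (M : Fin n → Fin n → ℝ) (q : Fin n → ℝ) (u : Fin n → WithTop ℝ)
    (st : Fin n → Status) (i : Fin n) : ℝ :=
  q i + ∑ k with st k = .upper, M i k * (u k).untopD 0

theorem eval_shiftedLinearTerm :
    (shiftedLinearTerm M q u st).eval = shifted M q u st := by
  funext i
  simp only [shiftedLinearTerm, eval_tab, eval_bind, eval_add, eval_sumOn, shifted,
    decide_eq_true_eq]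
  congr 1
  refine Finset.sum_congr rfl fun k _ => ?_
  rcases u k with _ | c
  · exact (Nat.cast_zero (R := ℝ)).trans (mul_zero (M i k)).symm
  · rfl

/-- The point given by a partition of the variables, at the value `τ` of the parameter. -/
noncomputable def pathPoint (u : Fin n → WithTop ℝ) (st : Fin n → Status) (qb pb : Fin n → ℝ)
    (τ : ℝ) (i : Fin n) : ℝ :=
  match st i with
  | .between => -(qb i + τ * pb i)
  | .lower => 0
  | .upper => (u i).untopD 0

theorem mulVec_eq_of_positions {x : Fin n → ℝ} (hl : ∀ i, st i = .lower → x i = 0)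
    (hu : ∀ i, st i = .upper → x i = (u i).untopD 0) (i : Fin n) :
    q i + ∑ j, M i j * x j = shifted M q u st i + ∑ j ∈ betweenSet st, M i j * x j := by
  have : ∀ j, M i j * x j = (if st j = .upper then M i j * (u j).untopD 0 else 0) +
      (if j ∈ betweenSet st then M i j * x j else 0) := by
    intro j
    simp only [mem_betweenSet]
    rcases hj : st j
    · simp
    · simp [hl j hj]
    · simp [hu j hj]
  rw [Finset.sum_congr rfl fun j _ => this j, Finset.sum_add_distrib, shifted,
    Finset.sum_filter, ← Finset.sum_filter (p := fun j => j ∈ betweenSet st)]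
  simp [add_assoc]

/-- Purely algebraic, without any feasibility: the two parts of `q̄ + τ p̄` are values of variables
on `α` and components of the gradient elsewhere. -/
theorem gradient_pathPoint (hB : InvOn M (betweenSet st) B) (τ : ℝ) (i : Fin n) :
    q i + τ * p i + ∑ j, M i j * pathPoint u st (bar M (betweenSet st) B (shifted M q u st))
      (bar M (betweenSet st) B p) τ j = if st i = .between then 0 else
        bar M (betweenSet st) B (shifted M q u st) i + τ * bar M (betweenSet st) B p i := by
  set qb := bar M (betweenSet st) B (shifted M q u st)
  set pb := bar M (betweenSet st) B p
  have e := mulVec_eq_of_positions (M := M) (q := q) (u := u) (st := st)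
    (x := pathPoint u st qb pb τ) (fun i hi => by simp [pathPoint, hi])
    (fun i hi => by simp [pathPoint, hi]) i
  have e' : ∑ j ∈ betweenSet st, M i j * pathPoint u st qb pb τ j =
      -(∑ j ∈ betweenSet st, M i j * qb j) - τ * ∑ j ∈ betweenSet st, M i j * pb j := by
    rw [Finset.mul_sum, ← Finset.sum_neg_distrib, ← Finset.sum_sub_distrib]
    refine Finset.sum_congr rfl fun j hj => ?_
    rw [pathPoint, mem_betweenSet.1 hj]; ring
  have e'' : q i + τ * p i + ∑ j, M i j * pathPoint u st qb pb τ j =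
      shifted M q u st i - ∑ j ∈ betweenSet st, M i j * qb j +
        τ * (p i - ∑ j ∈ betweenSet st, M i j * pb j) := by linarith
  rw [e'']
  by_cases hi : st i = .between
  · have hi' := mem_betweenSet.2 hi
    rw [if_pos hi, hB.sum_mul_bar _ hi', hB.sum_mul_bar _ hi']; ring
  · have hi' := mt mem_betweenSet.1 hi
    rw [if_neg hi, ← bar_of_notMem hi', ← bar_of_notMem hi']

/-- Since `M_αα` is invertible, the partition determines the point. The conditions at the current
parameter thereby become inequalities for `q̄` and `p̄`. -/
theorem SolvesAt.eq_pathPoint (hM : IsPSD M) (hB : InvOn M (betweenSet st) B) {τ : ℝ}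
    {x : Fin n → ℝ} (h : SolvesAt M q p u st τ x) :
    x = pathPoint u st (bar M (betweenSet st) B (shifted M q u st))
      (bar M (betweenSet st) B p) τ := by
  have hu : ∀ i, st i = .upper → x i = (u i).untopD 0 := fun i hi => by
    rw [← (h.upper i hi).1]; rfl
  funext i
  rw [pathPoint]
  rcases hi : st i
  · have := hB.unique hM.1 (y := x) (r := fun j => -1 * (shifted M q u st j + τ * p j))
      (fun j hj => by
        have e := mulVec_eq_of_positions (M := M) (q := q) (u := u) (st := st)
          (fun i hi => (h.lower i hi).1) hu j
        have := h.between j (mem_betweenSet.1 hj)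
        linarith) (mem_betweenSet.2 hi)
    have e := bar_add_smul (M := M) (s := betweenSet st) (B := B) (shifted M q u st) p τ i
    rw [bar_of_mem (mem_betweenSet.2 hi)] at e
    rw [this]
    change _ = -(_ + _)
    rw [← e, ← Finset.sum_neg_distrib]
    exact Finset.sum_congr rfl fun j _ => by ring
  · exact (h.lower i hi).1
  · exact hu i hi

/-! ### The ratio test and the path -/

/-- The candidate of the index `i` in the first ratio test. -/
noncomputable def ratio (u : Fin n → WithTop ℝ) (st : Fin n → Status) (qb pb : Fin n → ℝ)
    (i : Fin n) : Option ℝ :=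
  if 0 < pb i then
    match st i, u i with
    | .lower, _ => some (-(qb i / pb i))
    | .between, (c : ℝ) => some (-((c + qb i) / pb i))
    | .between, ⊤ => none
    | .upper, _ => none
  else none

theorem criticalValue_spec (u : Fin n → WithTop ℝ) (st : Fin n → Status) (qb pb : Fin n → ℝ) :
    (∀ j r, ratio u st qb pb j = some r →
      ∃ b, (criticalValue u st qb pb).eval = some b ∧ r ≤ b.1) ∧
    ∀ b, (criticalValue u st qb pb).eval = some b → ratio u st qb pb b.2 = some b.1 := by
  have keep : ∀ (best : Option (ℝ × Fin n)) r i, ∃ b, (keepMax best r i).eval = some b ∧ r ≤ b.1 ∧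
      (∀ b', best = some b' → b'.1 ≤ b.1) ∧ (b = (r, i) ∨ best = some b) := by
    rintro (_ | b) r i
    · exact ⟨(r, i), rfl, le_rfl, by simp, Or.inl rfl⟩
    · by_cases h : b.1 < r
      · exact ⟨(r, i), by simp [keepMax, h], le_rfl, by rintro _ ⟨⟩; exact h.le, Or.inl rfl⟩
      · exact ⟨b, by simp [keepMax, h], not_lt.1 h, by rintro _ ⟨⟩; exact le_rfl, Or.inr rfl⟩
  let P (m : ℕ) (best : Option (ℝ × Fin n)) : Prop :=
    (∀ j : Fin n, j.1 < m → ∀ r, ratio u st qb pb j = some r → ∃ b, best = some b ∧ r ≤ b.1) ∧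
      ∀ b, best = some b → ratio u st qb pb b.2 = some b.1
  have : P n (criticalValue u st qb pb).eval := by
    unfold criticalValue
    refine loop_induction P ⟨fun j hj => absurd hj (Nat.not_lt_zero _), fun b hb => ?_⟩ ?_
    · cases hb
    rintro i best ⟨h₁, h₂⟩
    -- A pass of the loop either skips the index or applies `keepMax` to its `ratio`.
    suffices H : ∀ z, z = (match ratio u st qb pb i with
        | none => best
        | some r => (keepMax best r i).eval) →
        P (i + 1) z by
      refine H _ ?_
      simp only [eval_bind, eval_isPos, eval_ite, decide_eq_true_eq, ratio, eval_pure]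
      by_cases h : 0 < pb i
      · simp only [h, if_true]
        rcases st i <;> rcases u i with _ | c <;> first | rfl | simp
      · simp only [h, if_false]
    rintro z rfl
    rcases hr : ratio u st qb pb i with _ | r
    · refine ⟨fun j hj r hjr => ?_, h₂⟩
      rcases Nat.lt_succ_iff_lt_or_eq.1 hj with hj | hj
      · exact h₁ j hj r hjr
      · rw [Fin.ext hj, hr] at hjr; cases hjr
    · obtain ⟨b, hb, hrb, hle, hor⟩ := keep best r i
      simp only [hb]
      refine ⟨fun j hj r' hjr => ⟨b, rfl, ?_⟩, ?_⟩
      · rcases Nat.lt_succ_iff_lt_or_eq.1 hj with hj | hj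
        · obtain ⟨b', hb', hr'⟩ := h₁ j hj r' hjr
          exact hr'.trans (hle b' hb')
        · rw [Fin.ext hj, hr] at hjr; cases hjr; exact hrb
      · rintro _ ⟨⟩
        rcases hor with rfl | hor
        · exact hr
        · exact h₂ b hor
  exact ⟨fun j => this.1 j j.2, this.2⟩

/-- The path can be followed down to the critical value. -/
theorem SolvesAt.of_ratio_le (hM : IsPSD M) (hB : InvOn M (betweenSet st) B) {T τ : ℝ}
    {x : Fin n → ℝ} (h : SolvesAt M q p u st T x) (hτ : τ ≤ T)
    (hp : ∀ i, 0 ≤ bar M (betweenSet st) B p i)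
    (hr : ∀ j r, ratio u st (bar M (betweenSet st) B (shifted M q u st))
      (bar M (betweenSet st) B p) j = some r → r ≤ τ) :
    SolvesAt M q p u st τ (pathPoint u st (bar M (betweenSet st) B (shifted M q u st))
      (bar M (betweenSet st) B p) τ) := by
  have hx := h.eq_pathPoint hM hB
  have hg := gradient_pathPoint (q := q) (p := p) (u := u) hB
  set qb := bar M (betweenSet st) B (shifted M q u st)
  set pb := bar M (betweenSet st) B p
  have hT : ∀ i, st i = .between → x i = -(qb i + T * pb i) := fun i hi => by
    rw [hx, pathPoint, hi]
  -- Since `p̄ ≥ 0`, interior variables rise and gradients off `α` fall as the parameter decreases.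
  -- Only an upper bound of an interior variable or the gradient of a variable at zero can block,
  -- and these are exactly the ratios.
  have hmono : ∀ i, τ * pb i ≤ T * pb i := fun i => mul_le_mul_of_nonneg_right hτ (hp i)
  have hup : ∀ i, st i = .upper → pathPoint u st qb pb τ i = x i := fun i hi => by
    rw [hx, pathPoint, pathPoint, hi]
  have hgT : ∀ i, st i ≠ .between → q i + T * p i + ∑ j, M i j * x j = qb i + T * pb i :=
    fun i hi => by
      have := hg T i
      rw [if_neg hi] at this
      rw [← this, hx]
  refine ⟨fun i => ?_, fun i => ?_, fun i hi => ⟨?_, ?_⟩, fun i hi => ?_, fun i hi => ⟨?_, ?_⟩⟩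
  · rcases hi : st i
    · have h₁ := h.nonneg i
      rw [hT i hi] at h₁
      rw [pathPoint, hi]
      change 0 ≤ -(_ + _)
      linarith [hmono i]
    · simp [pathPoint, hi]
    · rw [hup i hi]; exact h.nonneg i
  · rcases hi : st i
    · rw [pathPoint, hi]
      change ((-(qb i + τ * pb i) : ℝ) : WithTop ℝ) ≤ _
      rcases hu : u i with _ | c
      · exact le_top
      · refine WithTop.coe_le_coe.2 ?_
        -- With `p̄_i = 0` there is no ratio, but then `x_i` does not depend on the parameter.
        rcases (hp i).eq_or_lt with h0 | h0
        · have h₁ := h.le i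
          rw [hT i hi, hu] at h₁
          have h₁ := WithTop.coe_le_coe.1 h₁
          rw [← h0] at h₁ ⊢
          simpa using h₁
        · have := hr i (-((c + qb i) / pb i)) (by rw [ratio, if_pos h0, hi, hu])
          rw [neg_le, le_div_iff₀ h0] at this
          linarith
    · rw [pathPoint, hi]
      change ((0 : ℝ) : WithTop ℝ) ≤ _
      exact le_trans (WithTop.coe_le_coe.2 (h.nonneg i)) (h.le i)
    · rw [hup i hi]; exact h.le i
  · simp [pathPoint, hi]
  · rw [hg, if_neg (by simp [hi])]
    rcases (hp i).eq_or_lt with h0 | h0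
    · have h₁ := (h.lower i hi).2
      rw [hgT i (by simp [hi])] at h₁
      rw [← h0] at h₁ ⊢
      simpa using h₁
    · have := hr i (-(qb i / pb i)) (by rw [ratio, if_pos h0, hi])
      rw [neg_le, le_div_iff₀ h0] at this
      linarith
  · rw [hg, if_pos hi]
  · rw [hup i hi]; exact (h.upper i hi).1
  · rw [hg, if_neg (by simp [hi])]
    have h₁ := (h.upper i hi).2
    rw [hgT i (by simp [hi])] at h₁
    linarith [hmono i]

/-- The program does not store the current parameter `T`; this bound shows that the critical value
computed afresh does not exceed it. -/
theorem SolvesAt.ratio_le (hM : IsPSD M) (hB : InvOn M (betweenSet st) B) {T : ℝ}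
    {x : Fin n → ℝ} (h : SolvesAt M q p u st T x) {i : Fin n} {r : ℝ}
    (hr : ratio u st (bar M (betweenSet st) B (shifted M q u st))
      (bar M (betweenSet st) B p) i = some r) : r ≤ T := by
  have hx := h.eq_pathPoint hM hB
  have hg := gradient_pathPoint (q := q) (p := p) (u := u) hB T i
  rw [← hx] at hg
  set qb := bar M (betweenSet st) B (shifted M q u st)
  set pb := bar M (betweenSet st) B p
  rw [ratio] at hr
  split_ifs at hr with h0
  rcases hi : st i
  · rcases hu : u i with _ | c
    · rw [hi, hu] at hr; cases hr
    · rw [hi, hu] at hr; cases hr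
      have h₁ := h.le i
      rw [hx, pathPoint, hi, hu] at h₁
      have h₁ := WithTop.coe_le_coe.1 h₁
      rw [neg_le, le_div_iff₀ h0]
      linarith
  · rw [hi] at hr; cases hr
    have h₁ := (h.lower i hi).2
    rw [hg, if_neg (by simp [hi])] at h₁
    rw [neg_le, le_div_iff₀ h0]
    linarith
  · rw [hi] at hr; cases hr

/-! ### Termination and correctness of the pivoting loop -/

/-- The number of pivots that a variable may still take part in. -/
def Status.weight : Status → ℕ
  | .lower => 2
  | .between => 1
  | .upper => 0

/-- A bound on the number of pivots that are still possible. -/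
def pivotsLeft (st : Fin n → Status) : ℕ := ∑ i, (st i).weight

theorem pivotsLeft_update (st : Fin n → Status) (i : Fin n) (a : Status)
    (h : (st i).weight = a.weight + 1) :
    pivotsLeft (Function.update st i a) + 1 = pivotsLeft st := by
  rw [pivotsLeft, pivotsLeft, ← Finset.add_sum_erase _ _ (Finset.mem_univ i),
    ← Finset.add_sum_erase univ (fun i => (st i).weight) (Finset.mem_univ i)]
  have : ∀ j ∈ univ.erase i, (Function.update st i a j).weight = (st j).weight := fun j hj => by
    rw [Function.update_of_ne (Finset.ne_of_mem_erase hj)]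
  rw [Finset.sum_congr rfl this, h, Function.update_self]
  omega

/-- The invariant is a solution with the current partition at some parameter `T ≥ 0`. Positions only
advance from lower to between to upper, so `pivotsLeft` drops with each pivot even when `T` does not
change, and no rule against cycling is needed. -/
theorem pivotLoop_spec (hM : IsPSD M) {d : Fin n → ℝ} (hd : Dominates M d) :
    ∀ (fuel : ℕ) (st : Fin n → Status) (B : Fin n → Fin n → ℝ) (T : ℝ) (x : Fin n → ℝ),
      InvOn M (betweenSet st) B → 0 ≤ T → SolvesAt M q (halfSum M d) u st T x →
      pivotsLeft st + 1 ≤ fuel →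
      ∃ x, (pivotLoop M q u (halfSum M d) fuel st B).eval = .optimal x ∧ KKT M q u x
  | 0, st, B, T, x, _, _, _, hf => by omega
  | fuel + 1, st, B, T, x, hB, hT, h, hf => by
    have hp := hB.bar_halfSum_nonneg hM hd
    have hle := fun i r => h.ratio_le hM hB (i := i) (r := r)
    have hpath := fun τ hτ => h.of_ratio_le hM hB (τ := τ) hτ hp
    have hg := gradient_pathPoint (q := q) (p := halfSum M d) (u := u) hB
    have hschur := fun i => hB.schur_pos hM hd (i := i)
    have htr : ∀ r, (transform M (isBetween st) B r).eval = bar M (betweenSet st) B r :=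
      eval_transform M (isBetween st) B
    simp only [pivotLoop, eval_bind, htr, eval_shiftedLinearTerm]
    clear htr
    set qb := bar M (betweenSet st) B (shifted M q u st)
    set pb := bar M (betweenSet st) B (halfSum M d)
    obtain ⟨hmax, hatt⟩ := criticalValue_spec u st qb pb
    -- the last iteration
    have hlast : (∀ j r, ratio u st qb pb j = some r → r ≤ 0) →
        ∀ x, x = pathPoint u st qb pb 0 →
          ∃ y, Outcome.optimal x = Outcome.optimal y ∧ KKT M q u y := by
      rintro hr _ rfl
      exact ⟨_, rfl, (hpath 0 hT hr).kkt⟩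
    rcases hc : (criticalValue u st qb pb).eval with _ | ⟨τ, i⟩
    · simp only [eval_bind, eval_pure, eval_tab]
      refine hlast (fun j r hj => ?_) _ ?_
      · obtain ⟨b, hb, -⟩ := hmax j r hj
        rw [hc] at hb; cases hb
      · funext i
        rw [pathPoint]
        rcases st i <;> rcases u i with _ | c <;> simp <;> rfl
    have hrτ : ∀ j r, ratio u st qb pb j = some r → r ≤ τ := fun j r hj => by
      obtain ⟨b, hb, hrb⟩ := hmax j r hj
      rw [hc] at hb; cases hb; exact hrb
    simp only [eval_bind, eval_pure, eval_tab, eval_ite, eval_isPos, decide_eq_true_eq]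
    by_cases hτ : 0 < τ
    swap
    · simp only [hτ, if_false]
      refine hlast (fun j r hj => (hrτ j r hj).trans (not_lt.1 hτ)) _ ?_
      funext i
      rw [pathPoint]
      rcases st i <;> rcases u i with _ | c <;> simp <;> rfl
    simp only [hτ, if_true]
    have hri := hatt _ hc
    have hsol := hpath τ (hle i τ hri) hrτ
    rw [ratio] at hri
    split_ifs at hri with hpi
    by_cases hi : st i = .between
    · -- a variable reaches its upper bound
      simp only [hi, if_true]
      -- As `τ` is the ratio of `i`, the variable meets its upper bound exactly here, and the same
      -- point fits the new partition.
      have hx : (pathPoint u st qb pb τ i : WithTop ℝ) = u i := by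
        rw [pathPoint, hi]
        rw [hi] at hri
        rcases hu : u i with _ | c
        · rw [hu] at hri; cases hri
        · rw [hu] at hri
          have hri : -((c + qb i) / pb i) = τ := Option.some.inj hri
          refine congrArg WithTop.some ?_
          change -(_ + _) = _
          rw [← hri]
          field_simp
          ring
      refine pivotLoop_spec hM hd fuel _ _ τ (pathPoint u st qb pb τ) ?_ hτ.le ?_ ?_
      · rw [betweenSet_update_of_ne (by decide)]
        exact hB.dropIndex hM (mem_betweenSet.2 hi)
      · refine ⟨hsol.nonneg, hsol.le, fun j hj => ?_, fun j hj => ?_, fun j hj => ?_⟩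
        · by_cases hji : j = i
          · subst hji; simp at hj
          · rw [Function.update_of_ne hji] at hj; exact hsol.lower j hj
        · by_cases hji : j = i
          · subst hji; simp at hj
          · rw [Function.update_of_ne hji] at hj; exact hsol.between j hj
        · by_cases hji : j = i
          · subst hji; exact ⟨hx, (hsol.between j hi).le⟩
          · rw [Function.update_of_ne hji] at hj; exact hsol.upper j hj
      · have := pivotsLeft_update st i .upper (by rw [hi]; rfl)
        omega
    · -- a variable leaves its lower bound
      have hi' := mt mem_betweenSet.1 hi
      -- This rules out the second ratio test, and with it the two-by-two pivot and the report that
      -- there is no solution.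
      have hs := hschur i hi' hpi
      have hlow : st i = .lower := by
        rcases hst : st i
        · exact absurd hst hi
        · rfl
        · rw [hst] at hri; cases hri
      rw [hlow] at hri
      have hri : -(qb i / pb i) = τ := Option.some.inj hri
      simp only [hi, if_false, eval_schurEntry]
      have hbs : (univ.filter fun j => isBetween st j = true) = betweenSet st := rfl
      simp only [hbs, hs, if_true]
      refine pivotLoop_spec hM hd fuel _ _ _ (pathPoint u st qb pb τ) ?_ hτ.le ?_ ?_
      · rw [betweenSet_update_between]
        exact hB.addIndex hM.1 hi' (fun k _ => rfl) rfl hs.ne'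
      · refine ⟨hsol.nonneg, hsol.le, fun j hj => ?_, fun j hj => ?_, fun j hj => ?_⟩
        · by_cases hji : j = i
          · subst hji; simp at hj
          · rw [Function.update_of_ne hji] at hj; exact hsol.lower j hj
        · by_cases hji : j = i
          · subst hji
            -- The gradient of `i` is `q̄_i + τ p̄_i`, which is zero at the ratio of `i`.
            rw [hg, if_neg hi, ← hri]
            field_simp
            ring
          · rw [Function.update_of_ne hji] at hj; exact hsol.between j hj
        · by_cases hji : j = i
          · subst hji; simp at hj
          · rw [Function.update_of_ne hji] at hj; exact hsol.upper j hj
      · have := pivotsLeft_update st i .between (by rw [hlow]; rfl)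
        omega

end Pivot

/-! ## The vector `d` -/

section DominanceVector

variable {n : ℕ}

theorem eval_comparison (M : Fin n → Fin n → ℝ) :
    (comparison M).eval = comparisonMatrix M := by
  funext i j
  simp only [comparison, eval_tab2, eval_ite, eval_pure, eval_bind, eval_isPos, decide_eq_true_eq,
    eval_neg]
  split_ifs with h h'
  · subst h; rw [comparisonMatrix_self]
  · rw [comparisonMatrix_of_ne M h, abs_of_pos h']
  · rw [comparisonMatrix_of_ne M h, abs_of_nonpos (not_lt.1 h'), neg_neg]

theorem eval_parametricVector (M : Fin n → Fin n → ℝ) (d : Fin n → ℝ) :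
    (parametricVector M d).eval = halfSum M d := by
  funext i
  simp [parametricVector, eval_comparison, halfSum]

/-- The Schur complement of a positive diagonal entry is again semidefinite with nonpositive
off-diagonal entries. Given `d` for it, the first coordinate `-t / a₀₀` makes row `0` vanish and
reproduces the reduced rows; here `t ≤ 0` always. -/
theorem dominanceVector_spec : ∀ {n : ℕ} (A : Fin n → Fin n → ℝ), IsPSD A →
    (∀ i j, i ≠ j → A i j ≤ 0) → (∀ i, 0 < (dominanceVector A).eval i) ∧
      ∀ i, 0 ≤ ∑ j, A i j * (dominanceVector A).eval j
  | 0, A, _, _ => ⟨fun i => i.elim0, fun i => i.elim0⟩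
  | n + 1, A, hA, hneg => by
    have h0 : ∀ k : Fin n, A 0 k.succ ≤ 0 := fun k => hneg _ _ (Fin.succ_ne_zero k).symm
    have h0' : ∀ k : Fin n, A k.succ 0 ≤ 0 := fun k => hneg _ _ (Fin.succ_ne_zero k)
    simp only [dominanceVector, eval_bind, eval_isPos, eval_ite, decide_eq_true_eq, eval_tab2,
      eval_sub, eval_mul, eval_div, eval_sumOn, Finset.filter_true, eval_isNeg, eval_neg, eval_lit,
      eval_pure, Nat.cast_one]
    by_cases hp : 0 < A 0 0
    · simp only [hp, if_true]
      set S : Fin n → Fin n → ℝ := fun j k =>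
        A j.succ k.succ - A j.succ 0 * A 0 k.succ / A 0 0 with hS
      have hSpsd : IsPSD S := by simpa using hA.schur hp
      obtain ⟨hd, hSd⟩ := dominanceVector_spec S hSpsd fun i j hij => by
        have h₁ := hneg i.succ j.succ (fun h => hij (Fin.succ_injective _ h))
        have : 0 ≤ A i.succ 0 * A 0 j.succ / A 0 0 :=
          div_nonneg (mul_nonneg_of_nonpos_of_nonpos (h0' i) (h0 j)) hp.le
        simp only [hS]; linarith
      generalize (dominanceVector S).eval = d at *
      set t := ∑ k, A 0 k.succ * d k with ht
      have hrow : ∀ j : Fin n, ∑ k, S j k * d k =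
          ∑ k, A j.succ k.succ * d k - A j.succ 0 * t / A 0 0 := fun j => by
        rw [ht, Finset.mul_sum, Finset.sum_div, ← Finset.sum_sub_distrib]
        exact Finset.sum_congr rfl fun k _ => by simp only [hS]; ring
      by_cases htneg : t < 0
      · simp only [htneg, if_true]
        refine ⟨fun i => ?_, fun i => ?_⟩
        · refine Fin.cases ?_ (fun j => ?_) i
          · simpa using div_neg_of_neg_of_pos htneg hp
          · simpa using hd j
        · rw [Fin.sum_univ_succ]
          refine Fin.cases ?_ (fun j => ?_) i
          · simp only [Fin.cons_zero, Fin.cons_succ, ← ht]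
            exact le_of_eq (by field_simp; ring)
          · simp only [Fin.cons_zero, Fin.cons_succ]
            have := hSd j
            rw [hrow] at this
            have e : A j.succ 0 * -(t / A 0 0) = -(A j.succ 0 * t / A 0 0) := by ring
            linarith
      · simp only [htneg, if_false]
        -- If `t` is not negative, it is a zero sum of nonpositive terms. As `d > 0`, the first row
        -- is diagonal, and the first coordinate can be chosen as `1`.
        have hzero : ∀ k ∈ univ, A 0 k.succ * d k = 0 := by
          refine (Finset.sum_eq_zero_iff_of_nonpos fun k _ =>
            mul_nonpos_of_nonpos_of_nonneg (h0 k) (hd k).le).1 (le_antisymm ?_ (not_lt.1 htneg))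
          exact Finset.sum_nonpos fun k _ => mul_nonpos_of_nonpos_of_nonneg (h0 k) (hd k).le
        have ht0 : t = 0 := Finset.sum_eq_zero hzero
        have hA0 : ∀ k : Fin n, A k.succ 0 = 0 := fun k => by
          rw [hA.1]
          exact (mul_eq_zero.1 (hzero k (Finset.mem_univ k))).resolve_right (hd k).ne'
        refine ⟨fun i => ?_, fun i => ?_⟩
        · refine Fin.cases ?_ (fun j => ?_) i
          · simp
          · simpa using hd j
        · rw [Fin.sum_univ_succ]
          refine Fin.cases ?_ (fun j => ?_) i
          · simp only [Fin.cons_zero, Fin.cons_succ, ← ht, ht0]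
            linarith
          · simp only [Fin.cons_zero, Fin.cons_succ, hA0]
            have := hSd j
            rw [hrow, ht0] at this
            simpa using this
    · simp only [hp, if_false]
      have hz : A 0 0 = 0 := le_antisymm (not_lt.1 hp) (hA.diag_nonneg 0)
      have hr := hA.row_eq_zero hz
      have hc : ∀ k, A k 0 = 0 := fun k => by rw [hA.1]; exact hr k
      have hsub : IsPSD fun j k : Fin n => A j.succ k.succ := by
        simpa using hA.submatrix_succAbove 0
      obtain ⟨hd, hSd⟩ := dominanceVector_spec _ hsub fun i j hij =>
        hneg i.succ j.succ fun h => hij (Fin.succ_injective _ h)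
      refine ⟨fun i => ?_, fun i => ?_⟩
      · refine Fin.cases ?_ (fun j => ?_) i
        · simp
        · simpa using hd j
      · rw [Fin.sum_univ_succ]
        refine Fin.cases ?_ (fun j => ?_) i
        · simp [hr]
        · simpa [hc] using hSd j

theorem dominates_dominanceVector {M : Fin n → Fin n → ℝ} (h : IsPSD (comparisonMatrix M)) :
    Dominates M (dominanceVector (comparisonMatrix M)).eval := by
  obtain ⟨h₁, h₂⟩ := dominanceVector_spec (comparisonMatrix M) h fun i j hij => by
    rw [comparisonMatrix_of_ne M hij]; simp
  exact ⟨h₁, h₂⟩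

end DominanceVector

/-! ## Reductions -/

section Reductions

variable {n : ℕ} {M : Fin (n + 1) → Fin (n + 1) → ℝ} {q : Fin (n + 1) → ℝ}
  {u : Fin (n + 1) → WithTop ℝ} {d : Fin (n + 1) → ℝ} {i : Fin (n + 1)}

/-- The deleted column contributes `-|m_ji| d_i ≤ 0` to a row sum, so the row sums do not decrease.
-/
theorem Dominates.submatrix_succAbove (h : Dominates M d) (i : Fin (n + 1)) :
    Dominates (fun j k => M (i.succAbove j) (i.succAbove k)) fun j => d (i.succAbove j) := by
  refine ⟨fun j => h.pos _, fun j => ?_⟩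
  have h₁ := h.nonneg (i.succAbove j)
  rw [Fin.sum_univ_succAbove _ i, comparisonMatrix_of_ne M (Fin.succAbove_ne i j)] at h₁
  have h₂ := mul_nonneg (abs_nonneg (M (i.succAbove j) i)) (h.pos i).le
  have : ∀ k, comparisonMatrix (fun j k => M (i.succAbove j) (i.succAbove k)) j k =
      comparisonMatrix M (i.succAbove j) (i.succAbove k) := fun k => by
    simp [comparisonMatrix]
  simp only [this]
  linarith

/-- Add `|m_ji| / m_ii` times row `i` of `M̄` to row `j`: the `d_i` terms cancel, and by the
triangle inequality the other entries are at most those of the comparison matrix of the Schur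
complement. -/
theorem Dominates.schur (hM : IsPSD M) (h : Dominates M d) (hi : 0 < M i i) :
    Dominates (fun j k => M (i.succAbove j) (i.succAbove k) -
      M (i.succAbove j) i * M i (i.succAbove k) / M i i) fun j => d (i.succAbove j) := by
  refine ⟨fun j => h.pos _, fun j => ?_⟩
  have h₁ := h.nonneg (i.succAbove j)
  have h₂ := h.nonneg i
  rw [Fin.sum_univ_succAbove _ i, comparisonMatrix_of_ne M (Fin.succAbove_ne i j)] at h₁
  rw [Fin.sum_univ_succAbove _ i, comparisonMatrix_self] at h₂
  set a := |M (i.succAbove j) i| with ha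
  have hterm : ∀ k, comparisonMatrix M (i.succAbove j) (i.succAbove k) * d (i.succAbove k) +
      a / M i i * (comparisonMatrix M i (i.succAbove k) * d (i.succAbove k)) ≤
      comparisonMatrix (fun j k => M (i.succAbove j) (i.succAbove k) -
        M (i.succAbove j) i * M i (i.succAbove k) / M i i) j k * d (i.succAbove k) := by
    intro k
    rw [← mul_assoc, ← add_mul]
    refine mul_le_mul_of_nonneg_right ?_ (h.pos _).le
    rw [comparisonMatrix_of_ne M (Fin.succAbove_ne i k).symm]
    by_cases hjk : j = k
    · subst hjk
      rw [comparisonMatrix_self, comparisonMatrix_self, ha, hM.1 i (i.succAbove j)]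
      have : |M (i.succAbove j) i| / M i i * -|M (i.succAbove j) i| =
          -(M (i.succAbove j) i * M (i.succAbove j) i / M i i) := by
        rw [← abs_mul_abs_self (M (i.succAbove j) i)]; ring
      linarith
    · rw [comparisonMatrix_of_ne _ hjk, comparisonMatrix_of_ne M
        (fun e => hjk (Fin.succAbove_right_injective e))]
      have h3 := abs_sub (M (i.succAbove j) (i.succAbove k))
        (M (i.succAbove j) i * M i (i.succAbove k) / M i i)
      rw [abs_div, abs_mul, abs_of_pos hi] at h3
      have : a / M i i * -|M i (i.succAbove k)| = -(a * |M i (i.succAbove k)| / M i i) := by ring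
      rw [this]
      linarith
  refine le_trans ?_ (Finset.sum_le_sum fun k _ => hterm k)
  rw [Finset.sum_add_distrib, ← Finset.mul_sum]
  have h4 : a / M i i * (M i i * d i + ∑ k, comparisonMatrix M i (i.succAbove k) *
      d (i.succAbove k)) = a * d i + a / M i i * ∑ k, comparisonMatrix M i (i.succAbove k) *
      d (i.succAbove k) := by field_simp
  have h5 : 0 ≤ a / M i i * (M i i * d i + ∑ k, comparisonMatrix M i (i.succAbove k) *
      d (i.succAbove k)) := mul_nonneg (div_nonneg (abs_nonneg _) hi.le) h₂
  linarith

theorem KKTAt.congr {n m : ℕ} {M : Fin n → Fin n → ℝ} {q : Fin n → ℝ} {u : Fin n → WithTop ℝ}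
    {x : Fin n → ℝ} {i : Fin n} {M' : Fin m → Fin m → ℝ} {q' : Fin m → ℝ}
    {u' : Fin m → WithTop ℝ} {x' : Fin m → ℝ} {i' : Fin m} (h : KKTAt M q u x i)
    (hx : x' i' = x i) (hu : u' i' = u i)
    (hg : q' i' + ∑ j, M' i' j * x' j = q i + ∑ j, M i j * x j) : KKTAt M' q' u' x' i' := by
  obtain ⟨h₁, h₂, h₃, h₄⟩ := h
  constructor <;> rw [hx]
  · exact h₁
  · rw [hu]; exact h₂
  · rw [hg]; exact h₃
  · rw [hg, hu]; exact h₄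

/-! ### Elimination of a variable without an upper bound -/

theorem mulVec_schur (c : ℝ) (x : Fin n → ℝ) (j : Fin n) :
    ∑ k, M (i.succAbove j) k * (i.insertNth (-((c + ∑ k, M i (i.succAbove k) * x k) / M i i)) x :
      Fin (n + 1) → ℝ) k =
      -(M (i.succAbove j) i / M i i * c) + ∑ k, (M (i.succAbove j) (i.succAbove k) -
        M (i.succAbove j) i * M i (i.succAbove k) / M i i) * x k := by
  simp only [Fin.sum_univ_succAbove _ i, Fin.insertNth_apply_same, Fin.insertNth_apply_succAbove,
    sub_mul, Finset.sum_sub_distrib]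
  have : ∑ k, M (i.succAbove j) i * M i (i.succAbove k) / M i i * x k =
      M (i.succAbove j) i / M i i * ∑ k, M i (i.succAbove k) * x k := by
    rw [Finset.mul_sum]
    exact Finset.sum_congr rfl fun k _ => by ring
  rw [this]; ring

theorem mulVec_schur_self (hi : 0 < M i i) (c : ℝ) (x : Fin n → ℝ) :
    ∑ k, M i k * (i.insertNth (-((c + ∑ k, M i (i.succAbove k) * x k) / M i i)) x :
      Fin (n + 1) → ℝ) k = -c := by
  simp only [Fin.sum_univ_succAbove _ i, Fin.insertNth_apply_same, Fin.insertNth_apply_succAbove]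
  field_simp
  ring

/-- The value of `x_i` from its own equation is automatically nonnegative, because `q_i` and the
off-diagonal entries of row `i` are nonpositive. -/
theorem kkt_insertNth_of_schur (hi : 0 < M i i) (hrow : ∀ j, i ≠ j → M i j ≤ 0) (hq : q i < 0)
    (hu : u i = ⊤) {x : Fin n → ℝ}
    (h : KKT (fun j k => M (i.succAbove j) (i.succAbove k) -
      M (i.succAbove j) i * M i (i.succAbove k) / M i i)
      (fun j => q (i.succAbove j) - M (i.succAbove j) i / M i i * q i)
      (fun j => u (i.succAbove j)) x) :
    KKT M q u (i.insertNth (-((q i + ∑ k, M i (i.succAbove k) * x k) / M i i)) x) := by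
  intro j
  refine Fin.succAboveCases i ?_ (fun k => ?_) j
  · have hs : ∑ k, M i (i.succAbove k) * x k ≤ 0 := Finset.sum_nonpos fun k _ =>
      mul_nonpos_of_nonpos_of_nonneg (hrow _ (Fin.succAbove_ne i k).symm) (h k).nonneg
    have hg := mulVec_schur_self hi (q i) x
    refine ⟨?_, by rw [hu]; exact le_top, fun _ => ?_, fun _ => ?_⟩
    · rw [Fin.insertNth_apply_same, ← neg_div]
      exact div_nonneg (by linarith) hi.le
    · rw [hg]; linarith
    · rw [hg]; linarith
  · refine (h k).congr (by simp) rfl ?_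
    rw [mulVec_schur]; ring

/-- The lift solves the homogeneous equation of row `i`, hence `0` in place of `q i`. -/
theorem isRay_insertNth_of_schur (hi : 0 < M i i) (hrow : ∀ j, i ≠ j → M i j ≤ 0)
    (hM : IsPSD M) (hu : u i = ⊤) {v : Fin n → ℝ}
    (h : IsRay (fun j k => M (i.succAbove j) (i.succAbove k) -
      M (i.succAbove j) i * M i (i.succAbove k) / M i i)
      (fun j => q (i.succAbove j) - M (i.succAbove j) i / M i i * q i)
      (fun j => u (i.succAbove j)) v) :
    IsRay M q u (i.insertNth (-((0 + ∑ k, M i (i.succAbove k) * v k) / M i i)) v) := by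
  have hs : ∑ k, M i (i.succAbove k) * v k ≤ 0 := Finset.sum_nonpos fun k _ =>
    mul_nonpos_of_nonpos_of_nonneg (hrow _ (Fin.succAbove_ne i k).symm) (h.nonneg k)
  refine ⟨fun j => ?_, fun j => ?_, fun j => ?_, ?_⟩
  · refine Fin.succAboveCases i ?_ (fun k => ?_) j
    · rw [Fin.insertNth_apply_same, ← neg_div]
      exact div_nonneg (by linarith) hi.le
    · simpa using h.nonneg k
  · refine Fin.succAboveCases i ?_ (fun k => ?_) j
    · exact fun h' => absurd hu h'
    · simpa using h.eq_zero k
  · refine Fin.succAboveCases i ?_ (fun k => ?_) j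
    · rw [mulVec_schur_self hi]; simp
    · rw [mulVec_schur, h.mulVec k]; simp
  · have := h.neg
    simp only [Fin.sum_univ_succAbove _ i, Fin.insertNth_apply_same,
      Fin.insertNth_apply_succAbove]
    simp only [sub_mul, Finset.sum_sub_distrib] at this
    have e : ∑ k, M (i.succAbove k) i / M i i * q i * v k =
        q i * (∑ k, M i (i.succAbove k) * v k) / M i i := by
      rw [Finset.mul_sum, Finset.sum_div]
      exact Finset.sum_congr rfl fun k _ => by rw [hM.1 i (i.succAbove k)]; ring
    rw [e] at this
    have e' : q i * -((0 + ∑ k, M i (i.succAbove k) * v k) / M i i) =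
      -(q i * (∑ k, M i (i.succAbove k) * v k) / M i i) := by ring
    rw [e']
    linarith

/-! ### Reflection of a variable with an upper bound -/

/-- The sign of a variable after the reflection of the variable `x i`. -/
def reflSign (i j : Fin n) : ℝ := if j = i then -1 else 1

theorem reflSign_mul_self (i j : Fin n) : reflSign i j * reflSign i j = 1 := by
  unfold reflSign; split_ifs <;> norm_num

/-- Dropping the upper bound on `z_i` means dropping `x_i ≥ 0`; the signs in row `i` restore this
bound. -/
theorem kkt_of_reflection {n : ℕ} {M : Fin n → Fin n → ℝ} {q : Fin n → ℝ}
    {u : Fin n → WithTop ℝ} {i : Fin n} (hi : 0 < M i i) (hrow : ∀ j, i ≠ j → M i j ≤ 0)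
    (hq : q i < 0) {c : ℝ} (hc : 0 < c) (hu : u i = c) {z : Fin n → ℝ}
    (h : KKT (fun j k => reflSign i j * reflSign i k * M j k)
      (fun j => reflSign i j * (q j + M j i * c)) (Function.update u i ⊤) z) :
    KKT M q u (Function.update z i (c - z i)) := by
  have hX : ∀ k, Function.update z i (c - z i) k =
      (if k = i then c else 0) + reflSign i k * z k := by
    intro k
    by_cases hk : k = i
    · subst hk; simp [reflSign, sub_eq_add_neg]
    · simp [reflSign, hk]
  have hg : ∀ j, q j + ∑ k, M j k * Function.update z i (c - z i) k = reflSign i j *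
      (reflSign i j * (q j + M j i * c) + ∑ k, reflSign i j * reflSign i k * M j k * z k) := by
    intro j
    have e : ∑ k, reflSign i j * reflSign i k * M j k * z k =
        reflSign i j * ∑ k, M j k * (reflSign i k * z k) := by
      rw [Finset.mul_sum]
      exact Finset.sum_congr rfl fun k _ => by ring
    rw [e, ← mul_add, ← mul_assoc, reflSign_mul_self]
    simp [hX, mul_add, Finset.sum_add_distrib]
    ring
  intro j
  by_cases hj : j = i
  swap
  · refine (h j).congr (by simp [hj]) (by simp [hj]) ?_
    rw [hg]; simp [reflSign, hj]
  subst hj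
  have hgj := hg j
  have h₁ := (h j).nonneg
  have h₂ := (h j).grad_nonpos
  have h₃ := (h j).grad_nonneg (by simp)
  have hs : reflSign j j = -1 := by simp [reflSign]
  set g := reflSign j j * (q j + M j j * c) + ∑ k, reflSign j j * reflSign j k * M j k * z k
  rw [hs] at hgj
  refine ⟨?_, ?_, fun _ => ?_, fun hlt => ?_⟩
  · rw [Function.update_self]
    rcases h₁.eq_or_lt with h0 | h0
    · rw [← h0]; linarith
    · have hg0 := h₂ h0
      rw [← Finset.add_sum_erase _ _ (Finset.mem_univ j), Function.update_self] at hgj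
      have : ∑ k ∈ univ.erase j, M j k * Function.update z j (c - z j) k ≤ 0 :=
        Finset.sum_nonpos fun k hk => by
          have hk := Finset.ne_of_mem_erase hk
          rw [Function.update_of_ne hk]
          exact mul_nonpos_of_nonpos_of_nonneg (hrow k hk.symm) (h k).nonneg
      -- If `x_i = c - z_i` were negative, every part of the gradient in row `i` would be
      -- nonpositive and `q_i` negative, whereas `z_i > 0` makes the gradient nonnegative.
      by_contra! hneg
      nlinarith
  · rw [Function.update_self, hu]
    exact WithTop.coe_le_coe.2 (by linarith)
  · rw [hgj]; linarith
  · rw [Function.update_self, hu, WithTop.coe_lt_coe] at hlt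
    have := h₂ (by linarith)
    rw [hgj]; linarith

/-- In row `i` of the reflected matrix all entries are nonnegative, so the ray has `z_i = 0`. It is
therefore not affected by the reflection or by the bound that was dropped. -/
theorem isRay_of_reflection {n : ℕ} {M : Fin n → Fin n → ℝ} {q : Fin n → ℝ}
    {u : Fin n → WithTop ℝ} {i : Fin n} (hM : IsPSD M) (hi : 0 < M i i)
    (hrow : ∀ j, i ≠ j → M i j ≤ 0) {c : ℝ} {z : Fin n → ℝ}
    (h : IsRay (fun j k => reflSign i j * reflSign i k * M j k)
      (fun j => reflSign i j * (q j + M j i * c)) (Function.update u i ⊤) z) : IsRay M q u z := by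
  have hzi : z i = 0 := by
    have := h.mulVec i
    rw [← Finset.add_sum_erase _ _ (Finset.mem_univ i)] at this
    have h₂ : 0 ≤ ∑ k ∈ univ.erase i, reflSign i i * reflSign i k * M i k * z k :=
      Finset.sum_nonneg fun k hk => by
        have hk := Finset.ne_of_mem_erase hk
        have := mul_nonneg (neg_nonneg.2 (hrow k hk.symm)) (h.nonneg k)
        simpa [reflSign, hk] using this
    rw [reflSign_mul_self, one_mul] at this
    have h₁ := h.nonneg i
    by_contra hne
    have := mul_pos hi (lt_of_le_of_ne h₁ (Ne.symm hne))
    linarith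
  have hsz : ∀ k, reflSign i k * z k = z k := fun k => by
    by_cases hk : k = i
    · subst hk; simp [hzi]
    · simp [reflSign, hk]
  have hMz : ∀ j, ∑ k, M j k * z k = 0 := fun j => by
    have := h.mulVec j
    have e : ∑ k, reflSign i j * reflSign i k * M j k * z k = reflSign i j * ∑ k, M j k * z k := by
      rw [Finset.mul_sum]
      refine Finset.sum_congr rfl fun k _ => ?_
      linear_combination reflSign i j * M j k * hsz k
    rw [e] at this
    rcases mul_eq_zero.1 this with h0 | h0
    · have := reflSign_mul_self i j
      rw [h0] at this; norm_num at this
    · exact h0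
  refine ⟨h.nonneg, fun j hj => ?_, hMz, ?_⟩
  · by_cases hji : j = i
    · rw [hji]; exact hzi
    · exact h.eq_zero j (by simpa [hji] using hj)
  · have := h.neg
    have e : ∑ j, reflSign i j * (q j + M j i * c) * z j =
        ∑ j, q j * z j + c * ∑ k, M i k * z k := by
      rw [Finset.mul_sum, ← Finset.sum_add_distrib]
      refine Finset.sum_congr rfl fun k _ => ?_
      rw [hM.1 i k]
      linear_combination (q k + M k i * c) * hsz k
    rw [e, hMz] at this
    linarith

theorem IsPSD.reflection {n : ℕ} {M : Fin n → Fin n → ℝ} (hM : IsPSD M) (i : Fin n) :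
    IsPSD fun j k => reflSign i j * reflSign i k * M j k := by
  refine ⟨fun j k => ?_, fun x => ?_⟩
  · dsimp only
    rw [hM.1 j k]; ring
  · have := hM.2 fun j => reflSign i j * x j
    convert this using 1
    simp only [quad, Finset.mul_sum]
    exact Finset.sum_congr rfl fun j _ => Finset.sum_congr rfl fun k _ => by ring

theorem Dominates.reflection {n : ℕ} {M : Fin n → Fin n → ℝ} {d : Fin n → ℝ} (h : Dominates M d)
    (i : Fin n) : Dominates (fun j k => reflSign i j * reflSign i k * M j k) d := by
  refine ⟨h.pos, fun j => ?_⟩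
  have : ∀ k, comparisonMatrix (fun j k => reflSign i j * reflSign i k * M j k) j k =
      comparisonMatrix M j k := fun k => by
    by_cases hjk : j = k
    · subst hjk
      rw [comparisonMatrix_self, comparisonMatrix_self, reflSign_mul_self, one_mul]
    · rw [comparisonMatrix_of_ne _ hjk, comparisonMatrix_of_ne _ hjk, abs_mul, abs_mul]
      have : ∀ l : Fin n, |reflSign i l| = 1 := fun l => by
        unfold reflSign; split_ifs <;> simp
      rw [this, this]; ring
  simpa only [this] using h.nonneg j

/-! ### Separation of a variable with a zero row -/

theorem kkt_insertNth_of_row_eq_zero (hM : IsPSD M) (hrow : ∀ j, M i j = 0) {c : ℝ} (hc : 0 ≤ c)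
    (hcu : (c : WithTop ℝ) ≤ u i) (h₁ : 0 < c → q i ≤ 0) (h₂ : (c : WithTop ℝ) < u i → 0 ≤ q i)
    {x : Fin n → ℝ} (h : KKT (fun j k => M (i.succAbove j) (i.succAbove k))
      (fun j => q (i.succAbove j)) (fun j => u (i.succAbove j)) x) :
    KKT M q u (i.insertNth c x) := by
  intro j
  refine Fin.succAboveCases i ?_ (fun k => ?_) j
  · constructor <;> simpa [hrow]
  · refine (h k).congr (by simp) rfl ?_
    simp [Fin.sum_univ_succAbove _ i, hM.1 _ i, hrow]

/-- The row that was removed is also annihilated: the extended vector is a zero of the form, and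
semidefiniteness gives `Mv = 0` in every row. -/
theorem isRay_insertNth_zero {v : Fin n → ℝ} (hM : IsPSD M)
    (h : IsRay (fun j k => M (i.succAbove j) (i.succAbove k))
      (fun j => q (i.succAbove j)) (fun j => u (i.succAbove j)) v) :
    IsRay M q u (i.insertNth 0 v) := by
  have h0 : quad M (i.insertNth 0 v) = 0 := by
    simp [quad, Fin.sum_univ_succAbove _ i, h.mulVec]
  refine ⟨fun j => ?_, fun j => ?_, hM.mulVec_eq_zero h0, ?_⟩
  · refine Fin.succAboveCases i ?_ (fun k => ?_) j
    · simp
    · simpa using h.nonneg k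
  · refine Fin.succAboveCases i ?_ (fun k => ?_) j
    · simp
    · simpa using h.eq_zero k
  · simpa [Fin.sum_univ_succAbove _ i] using h.neg

end Reductions

/-! ## Correctness of the parametric principal pivoting algorithm -/

section PPPA

variable {n : ℕ}

/-- The outcome is a solution of the optimality conditions, or it is reported correctly that the
objective function is unbounded from below. -/
def Resolves (M : Fin n → Fin n → ℝ) (q : Fin n → ℝ) (u : Fin n → WithTop ℝ)
    (o : Outcome ℝ n) : Prop :=
  (∃ x, o = .optimal x ∧ KKT M q u x) ∨ (o = .noSolution ∧ ∃ v, IsRay M q u v)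

/-- The number of finite upper bounds. -/
noncomputable def finiteBounds (u : Fin n → WithTop ℝ) : ℕ := by
  classical exact #{i | u i ≠ ⊤}

theorem finiteBounds_succAbove_le (u : Fin (n + 1) → WithTop ℝ) (i : Fin (n + 1)) :
    finiteBounds (fun j => u (i.succAbove j)) ≤ finiteBounds u := by
  classical
  refine Finset.card_le_card_of_injOn i.succAbove (fun j hj => ?_)
    (Fin.succAbove_right_injective.injOn)
  simpa using hj

theorem finiteBounds_update_top {u : Fin n → WithTop ℝ} {i : Fin n} (h : u i ≠ ⊤) :
    finiteBounds (Function.update u i ⊤) < finiteBounds u := by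
  classical
  refine Finset.card_lt_card (Finset.ssubset_iff_of_subset (fun j hj => ?_) |>.2 ⟨i, ?_, ?_⟩)
  · by_cases hji : j = i
    · subst hji; simp at hj
    · simpa [hji] using hj
  · simpa using h
  · simp

theorem exists_start {M : Fin n → Fin n → ℝ} {q p : Fin n → ℝ} {u : Fin n → WithTop ℝ}
    (hp : ∀ i, 0 ≤ p i) (hq : ∀ i, 0 < p i ∨ 0 ≤ q i) (hu : ∀ i, 0 < u i) :
    ∃ T, 0 ≤ T ∧ SolvesAt M q p u (fun _ => .lower) T fun _ => 0 := by
  have h0 : ∀ i, 0 ≤ |q i| / p i := fun i => div_nonneg (abs_nonneg _) (hp i)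
  -- The sum bounds all the ratios `-q_i / p_i`; an index with `p_i = 0` contributes zero and needs
  -- only `q_i ≥ 0`.
  refine ⟨∑ i, |q i| / p i, Finset.sum_nonneg fun i _ => h0 i, fun _ => le_rfl,
    fun i => (hu i).le, fun i _ => ⟨rfl, ?_⟩, by simp, by simp⟩
  have h₁ : |q i| / p i ≤ ∑ i, |q i| / p i :=
    Finset.single_le_sum (fun i _ => h0 i) (Finset.mem_univ i)
  simp only [mul_zero, Finset.sum_const_zero, add_zero]
  rcases hq i with h | h
  · rw [div_le_iff₀ h] at h₁
    linarith [neg_abs_le (q i)]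
  · have := mul_nonneg (Finset.sum_nonneg fun i (_ : i ∈ univ) => h0 i) (hp i)
    linarith

/-- Elimination and separation lower the order, a reflection removes a finite bound. Hence `n +
finiteBounds u` drops with every reduction, and it is at most twice the original order. -/
theorem reduceAndPivot_spec : ∀ (fuel : ℕ) {n : ℕ} (M : Fin n → Fin n → ℝ) (q : Fin n → ℝ)
    (u : Fin n → WithTop ℝ) (d : Fin n → ℝ), IsPSD M → Dominates M d → (∀ i, 0 < u i) →
    n + finiteBounds u + 1 ≤ fuel → Resolves M q u (reduceAndPivot fuel M q u d).eval
  | 0, _, _, _, _, _, _, _, _, hf => by omega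
  | fuel + 1, 0, _, _, _, _, _, _, _, _ => Or.inl ⟨_, rfl, fun i => i.elim0⟩
  | fuel + 1, n + 1, M, q, u, d, hM, hd, hu, hf => by
    simp only [reduceAndPivot, eval_bind, eval_parametricVector]
    have hbad := findFirst_spec fun i => (do
      if ← isPos (M i i) then
        if ← isPos (halfSum M d i) then pure false else isNeg (q i)
      else pure true : Prog ℝ Bool)
    generalize (findFirst fun i => (do
      if ← isPos (M i i) then
        if ← isPos (halfSum M d i) then pure false else isNeg (q i)
      else pure true : Prog ℝ Bool)).eval = bad at hbad ⊢
    simp only [eval_bind, eval_isPos, eval_ite, decide_eq_true_eq, eval_pure, eval_isNeg] at hbad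
    rcases bad with _ | i
    · have hok : ∀ i, 0 < halfSum M d i ∨ 0 ≤ q i := fun i => by
        have := hbad.2 rfl i
        split_ifs at this with h₁ h₂
        · exact Or.inl h₂
        · exact Or.inr (by simpa using this)
      obtain ⟨T, hT, hs⟩ := exists_start (M := M) hd.halfSum_nonneg hok hu
      simp only [eval_bind, eval_tab2]
      refine Or.inl (pivotLoop_spec hM hd _ _ _ T _ ?_ hT hs ?_)
      · have : betweenSet (fun _ : Fin (n + 1) => Status.lower) = ∅ := by
          ext i; simp [mem_betweenSet]
        rw [this]; exact invOn_empty
      · simp [pivotsLeft, Status.weight, mul_comm]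
    have hval := (hbad.1 i rfl).1
    simp only [eval_bind, eval_isPos, eval_ite, decide_eq_true_eq]
    have hfin := finiteBounds_succAbove_le u i
    by_cases hii : 0 < M i i
    · simp only [hii, if_true] at hval ⊢
      have hp0 : halfSum M d i = 0 := by
        split_ifs at hval with h₁
        exact le_antisymm (not_lt.1 h₁) (hd.halfSum_nonneg i)
      have hq : q i < 0 := by
        split_ifs at hval with h₁
        simpa using hval
      have hrow : ∀ j, i ≠ j → M i j ≤ 0 := fun j => hd.nonpos_of_halfSum_eq_zero hp0
      rcases hui : u i with _ | c
      · simp only [eval_bind, eval_tab2, eval_tab, eval_sub, eval_div, eval_mul]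
        rcases reduceAndPivot_spec fuel _
          (fun j => q (i.succAbove j) - M (i.succAbove j) i / M i i * q i)
          (fun j => u (i.succAbove j)) _ (hM.schur hii) (hd.schur hM hii) (fun j => hu _)
          (by omega) with ⟨x, hx, hk⟩ | ⟨hx, v, hv⟩
        · simp only [hx, eval_bind, eval_add, eval_sumOn, eval_mul, eval_div, eval_neg, eval_pure,
            Finset.filter_true]
          exact Or.inl ⟨_, rfl, kkt_insertNth_of_schur hii hrow hq hui hk⟩
        · simp only [hx, eval_pure]
          exact Or.inr ⟨rfl, _, isRay_insertNth_of_schur hii hrow hM hui hv⟩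
      · have hc : 0 < c := by
          have := hu i
          rw [hui] at this
          exact WithTop.coe_lt_coe.1 this
        have hlt := finiteBounds_update_top (u := u) (i := i)
          (by rw [hui]; exact WithTop.coe_ne_top)
        have eM : (fun j k => if (j = i ∧ k ≠ i) ∨ (j ≠ i ∧ k = i) then -M j k else M j k) =
            fun j k => reflSign i j * reflSign i k * M j k := by
          funext j k
          by_cases hj : j = i <;> by_cases hk : k = i <;> simp [reflSign, hj, hk]
        have eq : (fun j => if j = i then -(q j + M j i * c) else q j + M j i * c) =
            fun j => reflSign i j * (q j + M j i * c) := by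
          funext j
          by_cases hj : j = i <;> simp [reflSign, hj]
        simp only [eval_bind, eval_tab2, eval_tab, eval_ite, eval_neg, eval_pure, eval_add,
          eval_mul, eM, eq]
        rcases reduceAndPivot_spec fuel _ (fun j => reflSign i j * (q j + M j i * c))
          (Function.update u i ⊤) d (hM.reflection i) (hd.reflection i) (fun j => by
            by_cases hj : j = i
            · subst hj; simp
            · simpa [hj] using hu j) (by omega) with ⟨x, hx, hk⟩ | ⟨hx, v, hv⟩
        · simp only [hx, eval_bind, eval_sub, eval_pure]
          exact Or.inl ⟨_, rfl, kkt_of_reflection hii hrow hq hc hui hk⟩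
        · simp only [hx, eval_pure]
          exact Or.inr ⟨rfl, _, isRay_of_reflection hM hii hrow hv⟩
    · simp only [hii, if_false]
      have hz := hM.row_eq_zero (le_antisymm (not_lt.1 hii) (hM.diag_nonneg i))
      have hrec := reduceAndPivot_spec fuel _ (fun j => q (i.succAbove j))
        (fun j => u (i.succAbove j)) _ (hM.submatrix_succAbove i) (hd.submatrix_succAbove i)
        (fun j => hu _) (by omega)
      -- the remaining variables, once the variable `x i` has been fixed at `c`
      have hfix : ∀ c : ℝ, 0 ≤ c → (c : WithTop ℝ) ≤ u i → (0 < c → q i ≤ 0) →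
          ((c : WithTop ℝ) < u i → 0 ≤ q i) → ∀ o, o = (match (reduceAndPivot fuel
            (fun j k => M (i.succAbove j) (i.succAbove k)) (fun j => q (i.succAbove j))
            (fun j => u (i.succAbove j)) fun j => d (i.succAbove j)).eval with
          | .optimal x => .optimal (i.insertNth c x)
          | .noSolution => .noSolution
          | .failed => .failed) → Resolves M q u o := by
        rintro c h₁ h₂ h₃ h₄ _ rfl
        rcases hrec with ⟨x, hx, hk⟩ | ⟨hx, v, hv⟩
        · simp only [hx]
          exact Or.inl ⟨_, rfl, kkt_insertNth_of_row_eq_zero hM hz h₁ h₂ h₃ h₄ hk⟩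
        · simp only [hx]
          exact Or.inr ⟨rfl, _, isRay_insertNth_zero hM hv⟩
      by_cases hq : q i < 0
      · simp only [eval_isNeg, hq, decide_true, if_true]
        rcases hui : u i with _ | c
        · refine Or.inr ⟨rfl, fun j => if j = i then 1 else 0, ?_, ?_, ?_, ?_⟩
          · intro j; split_ifs <;> norm_num
          · intro j hj
            have : j ≠ i := by rintro rfl; exact hj hui
            simp [this]
          · intro j; simp [hM.1 j i, hz]
          · simpa using hq
        · have hc : 0 < c := by
            have := hu i
            rw [hui] at this
            exact WithTop.coe_lt_coe.1 this
          refine hfix c hc.le hui.ge (fun _ => hq.le)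
            (fun h => absurd h (by rw [hui]; exact lt_irrefl _)) _ ?_
          simp only [eval_bind, eval_pure]
          rcases (reduceAndPivot fuel _ _ _ _).eval <;> rfl
      · simp only [eval_isNeg, hq, decide_false, if_false, Bool.false_eq_true, eval_lit,
          Nat.cast_zero]
        refine hfix 0 le_rfl (hu i).le (fun h => absurd h (lt_irrefl _)) (fun _ => not_lt.1 hq) _ ?_
        simp only [eval_bind, eval_pure]
        rcases (reduceAndPivot fuel _ _ _ _).eval <;> rfl

theorem pppa_spec {M : Fin n → Fin n → ℝ} (q : Fin n → ℝ) {u : Fin n → WithTop ℝ}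
    (hM : IsPSD M) (hC : IsPSD (comparisonMatrix M)) (hu : ∀ i, 0 < u i) :
    Resolves M q u (pppa M q u).eval := by
  classical
  simp only [pppa, eval_bind, eval_comparison]
  refine reduceAndPivot_spec _ M q u _ hM (dominates_dominanceVector hC) hu ?_
  have : finiteBounds u ≤ n := (Finset.card_le_univ _).trans_eq (Fintype.card_fin n)
  omega

end PPPA

/-! ## Systems of linear inequalities in two variables -/

section FourierMotzkin

theorem loopList_induction {K α σ : Type} [Field K] [LinearOrder K] {f : σ → α → Prog K σ}
    (P : List α → σ → Prop) {s : σ} (h₀ : P [] s)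
    (h : ∀ l a t, P l t → P (l ++ [a]) (f t a).eval) (L : List α) :
    P L (loopList L s f).eval := by
  have key : ∀ (L l : List α) (t : σ), P l t → P (l ++ L) (loopList L t f).eval := by
    intro L
    induction L with
    | nil => intro l t ht; simpa [loopList] using ht
    | cons a L ih =>
      intro l t ht
      simp only [loopList, eval_bind]
      simpa using ih (l ++ [a]) _ (h l a t ht)
  simpa using key L [] s h₀

theorem keepMax_unit_spec (best : Option (ℝ × Unit)) (r : ℝ) :
    ∃ b, (keepMax best r ()).eval = some b ∧ r ≤ b.1 ∧
      (∀ b', best = some b' → b'.1 ≤ b.1) ∧ (b.1 = r ∨ best = some b) := by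
  rcases best with _ | b
  · exact ⟨(r, ()), rfl, le_rfl, by simp, Or.inl rfl⟩
  · by_cases h : b.1 < r
    · exact ⟨(r, ()), by simp [keepMax, h], le_rfl, by rintro _ ⟨⟩; exact h.le, Or.inl rfl⟩
    · exact ⟨b, by simp [keepMax, h], not_lt.1 h, by rintro _ ⟨⟩; exact le_rfl, Or.inr rfl⟩

theorem keepMin_unit_spec (best : Option (ℝ × Unit)) (r : ℝ) :
    ∃ b, (keepMin best r ()).eval = some b ∧ b.1 ≤ r ∧
      (∀ b', best = some b' → b.1 ≤ b'.1) ∧ (b.1 = r ∨ best = some b) := by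
  rcases best with _ | b
  · exact ⟨(r, ()), rfl, le_rfl, by simp, Or.inl rfl⟩
  · by_cases h : r < b.1
    · exact ⟨(r, ()), by simp [keepMin, h], le_rfl, by rintro _ ⟨⟩; exact h.le, Or.inl rfl⟩
    · exact ⟨b, by simp [keepMin, h], not_lt.1 h, by rintro _ ⟨⟩; exact le_rfl, Or.inr rfl⟩

/-- The best lower and upper bounds on `t` given by the inequalities `a t + c ≥ 0`. -/
structure IsBounds (l : List (ℝ × ℝ)) (s : Option (ℝ × Unit) × Option (ℝ × Unit)) : Prop where
  lower_le : ∀ e ∈ l, 0 < e.1 → ∃ b, s.1 = some b ∧ -(e.2 / e.1) ≤ b.1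
  lower_mem : ∀ b, s.1 = some b → ∃ e ∈ l, 0 < e.1 ∧ b.1 = -(e.2 / e.1)
  le_upper : ∀ e ∈ l, e.1 < 0 → ∃ b, s.2 = some b ∧ b.1 ≤ -(e.2 / e.1)
  upper_mem : ∀ b, s.2 = some b → ∃ e ∈ l, e.1 < 0 ∧ b.1 = -(e.2 / e.1)

theorem IsBounds.solves {L : List (ℝ × ℝ)} {s : Option (ℝ × Unit) × Option (ℝ × Unit)}
    (h : IsBounds L s) {t₀ : ℝ} (ht₀ : ∀ e ∈ L, 0 ≤ e.1 * t₀ + e.2) {t : ℝ}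
    (hlo : ∀ lo, s.1 = some lo → t = lo.1)
    (hhi : s.1 = none → ∀ hi, s.2 = some hi → t = hi.1) : ∀ e ∈ L, 0 ≤ e.1 * t + e.2 := by
  obtain ⟨h₁, h₂, h₃, h₄⟩ := h
  have pos : ∀ e ∈ L, 0 < e.1 → -(e.2 / e.1) ≤ t → 0 ≤ e.1 * t + e.2 := fun e _ h0 h => by
    rw [neg_le, le_div_iff₀ h0] at h; linarith
  have neg : ∀ e ∈ L, e.1 < 0 → t ≤ -(e.2 / e.1) → 0 ≤ e.1 * t + e.2 := fun e _ h0 h => by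
    rw [le_neg, div_le_iff_of_neg h0] at h; linarith
  have pos₀ : ∀ e ∈ L, 0 < e.1 → -(e.2 / e.1) ≤ t₀ := fun e he h0 => by
    rw [neg_le, le_div_iff₀ h0]; linarith [ht₀ e he]
  have neg₀ : ∀ e ∈ L, e.1 < 0 → t₀ ≤ -(e.2 / e.1) := fun e he h0 => by
    rw [le_neg, div_le_iff_of_neg h0]; linarith [ht₀ e he]
  intro e he
  rcases lt_trichotomy e.1 0 with h0 | h0 | h0
  · refine neg e he h0 ?_
    obtain ⟨b, hb, hbe⟩ := h₃ e he h0
    rcases hs : s.1 with _ | lo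
    · rw [hhi hs b hb]; exact hbe
    · obtain ⟨f, hf, hf0, hfe⟩ := h₂ lo hs
      rw [hlo lo hs, hfe]
      exact (pos₀ f hf hf0).trans (neg₀ e he h0)
  · have := ht₀ e he
    rw [h0] at this ⊢
    simpa using this
  · refine pos e he h0 ?_
    obtain ⟨b, hb, hbe⟩ := h₁ e he h0
    rw [hlo b hb]; exact hbe

/-- The best lower bound, or without lower bounds the best upper one, is a solution if any exists.
Soundness comes from the final pass, which also tests the inequalities with coefficient zero. -/
theorem solveOneVar_spec (L : List (ℝ × ℝ)) :
    (∀ t, (solveOneVar L).eval = some t → ∀ e ∈ L, 0 ≤ e.1 * t + e.2) ∧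
      ((∃ t, ∀ e ∈ L, 0 ≤ e.1 * t + e.2) → ∃ t, (solveOneVar L).eval = some t) := by
  simp only [solveOneVar, eval_bind, eval_lit, Nat.cast_zero, eval_pure]
  generalize hbounds : (loopList (K := ℝ) L
    ((none, none) : Option (ℝ × Unit) × Option (ℝ × Unit)) _).eval
    = bounds
  have hb : IsBounds L bounds := by
    rw [← hbounds]
    refine loopList_induction IsBounds ⟨by simp, by simp, by simp, by simp⟩ ?_ L
    rintro l a ⟨lo, hi⟩ ⟨h₁, h₂, h₃, h₄⟩
    simp only [eval_bind, eval_isPos, eval_isNeg, eval_ite, decide_eq_true_eq, eval_pure, eval_div,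
      eval_neg]
    simp only at h₁ h₂ h₃ h₄
    by_cases hpos : 0 < a.1
    · simp only [hpos, if_true]
      obtain ⟨b, hb, hrb, hle, hor⟩ := keepMax_unit_spec lo (-(a.2 / a.1))
      simp only [hb]
      refine ⟨fun e he h0 => ⟨b, rfl, ?_⟩, ?_, fun e he h0 => ?_, fun b' hb' => ?_⟩
      · rcases List.mem_append.1 he with he | he
        · obtain ⟨b', hb', h'⟩ := h₁ e he h0
          exact h'.trans (hle b' hb')
        · rw [List.mem_singleton.1 he]; exact hrb
      · rintro _ ⟨⟩
        rcases hor with hor | hor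
        · exact ⟨a, by simp, hpos, hor⟩
        · obtain ⟨e, he, h'⟩ := h₂ b hor
          exact ⟨e, by simp [he], h'⟩
      · rcases List.mem_append.1 he with he | he
        · exact h₃ e he h0
        · rw [List.mem_singleton.1 he] at h0; linarith
      · obtain ⟨e, he, h'⟩ := h₄ b' hb'
        exact ⟨e, by simp [he], h'⟩
    · simp only [hpos, if_false]
      by_cases hneg : a.1 < 0
      · simp only [hneg, if_true]
        obtain ⟨b, hb, hrb, hle, hor⟩ := keepMin_unit_spec hi (-(a.2 / a.1))
        simp only [hb]
        refine ⟨fun e he h0 => ?_, fun b' hb' => ?_, fun e he h0 => ⟨b, rfl, ?_⟩, ?_⟩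
        · rcases List.mem_append.1 he with he | he
          · exact h₁ e he h0
          · rw [List.mem_singleton.1 he] at h0; linarith
        · obtain ⟨e, he, h'⟩ := h₂ b' hb'
          exact ⟨e, by simp [he], h'⟩
        · rcases List.mem_append.1 he with he | he
          · obtain ⟨b', hb', h'⟩ := h₃ e he h0
            exact (hle b' hb').trans h'
          · rw [List.mem_singleton.1 he]; exact hrb
        · rintro _ ⟨⟩
          rcases hor with hor | hor
          · exact ⟨a, by simp, hneg, hor⟩
          · obtain ⟨e, he, h'⟩ := h₄ b hor
            exact ⟨e, by simp [he], h'⟩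
      · simp only [hneg, if_false]
        refine ⟨fun e he h0 => ?_, fun b' hb' => ?_, fun e he h0 => ?_, fun b' hb' => ?_⟩
        · rcases List.mem_append.1 he with he | he
          · exact h₁ e he h0
          · rw [List.mem_singleton.1 he] at h0; exact absurd h0 hpos
        · obtain ⟨e, he, h'⟩ := h₂ b' hb'
          exact ⟨e, by simp [he], h'⟩
        · rcases List.mem_append.1 he with he | he
          · exact h₃ e he h0
          · rw [List.mem_singleton.1 he] at h0; exact absurd h0 hneg
        · obtain ⟨e, he, h'⟩ := h₄ b' hb'
          exact ⟨e, by simp [he], h'⟩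
  have core : ∀ t : ℝ, (∀ lo, bounds.1 = some lo → t = lo.1) →
      (bounds.1 = none → ∀ hi, bounds.2 = some hi → t = hi.1) →
      (∀ t', (if (loopList (K := ℝ) L true fun ok e => do
        if ← isNeg (← add (← mul e.1 t) e.2) then pure false else pure ok).eval = true
        then some t else none) = some t' → ∀ e ∈ L, 0 ≤ e.1 * t' + e.2) ∧
      ((∃ t, ∀ e ∈ L, 0 ≤ e.1 * t + e.2) → ∃ t', (if (loopList (K := ℝ) L true fun ok e => do
        if ← isNeg (← add (← mul e.1 t) e.2) then pure false else pure ok).eval = true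
        then some t else none) = some t') := by
    intro t hlo hhi
    generalize hok : (loopList (K := ℝ) L true _).eval = ok
    have hok' : ok = true ↔ ∀ e ∈ L, 0 ≤ e.1 * t + e.2 := by
      rw [← hok]
      refine loopList_induction (K := ℝ) (s := true)
        (fun l (ok : Bool) => ok = true ↔ ∀ e ∈ l, 0 ≤ e.1 * t + e.2) (by simp) ?_ L
      rintro l a ok h
      simp only [eval_bind, eval_isNeg, eval_ite, decide_eq_true_eq, eval_pure, eval_add, eval_mul,
        List.forall_mem_append, List.forall_mem_singleton, ← h]
      split_ifs with h'
      · simp [h']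
      · simpa using fun _ => not_lt.1 h'
    refine ⟨fun t' ht' => ?_, fun ⟨t₀, ht₀⟩ => ⟨t, ?_⟩⟩
    · split_ifs at ht' with h
      cases ht'
      exact hok'.1 h
    · rw [if_pos (hok'.2 (hb.solves ht₀ hlo hhi))]
  rcases bounds with ⟨_ | lo, _ | hi⟩
  · exact core 0 (by simp) (by simp)
  · exact core hi.1 (by simp) (by simp)
  · exact core lo.1 (by simp) (by simp)
  · exact core lo.1 (by simp) (by simp)

theorem exists_between_lists (P N : List ℝ) (h : ∀ a ∈ P, ∀ b ∈ N, a ≤ b) :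
    ∃ z, (∀ a ∈ P, a ≤ z) ∧ ∀ b ∈ N, z ≤ b := by
  rcases P with _ | ⟨a, P⟩
  · obtain ⟨z, hz⟩ := N.toFinset.bddBelow
    exact ⟨z, by simp, fun b hb => hz (by simpa using hb)⟩
  rcases N with _ | ⟨b, N⟩
  · obtain ⟨z, hz⟩ := (a :: P).toFinset.bddAbove
    exact ⟨z, fun b hb => hz (by simpa using hb), by simp⟩
  obtain ⟨z, hz₁, hz₂⟩ := exists_between_of_forall_le (s := {x | x ∈ a :: P})
    (t := {x | x ∈ b :: N}) ⟨a, by simp⟩ ⟨b, by simp⟩ h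
  exact ⟨z, fun a ha => hz₁ ha, fun b hb => hz₂ hb⟩

/-- The separation of the inequalities by the sign of the coefficient of the second variable. -/
structure IsPartition (l : List (ℝ × ℝ × ℝ))
    (s : List (ℝ × ℝ × ℝ) × List (ℝ × ℝ × ℝ) × List (ℝ × ℝ)) : Prop where
  pos : ∀ e, e ∈ s.1 ↔ e ∈ l ∧ 0 < e.2.1
  neg : ∀ e, e ∈ s.2.1 ↔ e ∈ l ∧ e.2.1 < 0
  zero : ∀ g, g ∈ s.2.2 ↔ ∃ e ∈ l, e.2.1 = 0 ∧ g = (e.1, e.2.2)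

/-- A value `y` extends to a solution exactly when every lower bound on `z` is at most every upper
bound; the eliminated system expresses this pair by pair. -/
theorem solveTwoVar_spec (L : List (ℝ × ℝ × ℝ)) :
    (∀ y z, (solveTwoVar L).eval = some (y, z) → ∀ e ∈ L, 0 ≤ e.1 * y + e.2.1 * z + e.2.2) ∧
      ((∃ y z, ∀ e ∈ L, 0 ≤ e.1 * y + e.2.1 * z + e.2.2) →
        ∃ y z, (solveTwoVar L).eval = some (y, z)) := by
  simp only [solveTwoVar, eval_bind]
  generalize hparts : (loopList (K := ℝ) L
    (([], [], []) : List (ℝ × ℝ × ℝ) × List (ℝ × ℝ × ℝ) × List (ℝ × ℝ)) _).eval = parts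
  have hp : IsPartition L parts := by
    rw [← hparts]
    refine loopList_induction IsPartition ⟨by simp, by simp, by simp⟩ ?_ L
    rintro l a ⟨s₁, s₂, s₃⟩ ⟨h₁, h₂, h₃⟩
    simp only [eval_bind, eval_isPos, eval_isNeg, eval_ite, decide_eq_true_eq, eval_pure]
    simp only at h₁ h₂ h₃
    constructor <;> intro e <;> split_ifs with hpos hneg <;>
      simp only [List.mem_cons, h₁, h₂, h₃, List.mem_append, List.not_mem_nil, or_false,
        or_and_right, exists_or, exists_eq_left]
    · constructor
      · rintro (rfl | h)
        · exact Or.inr ⟨rfl, hpos⟩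
        · exact Or.inl h
      · rintro (h | ⟨rfl, -⟩)
        · exact Or.inr h
        · exact Or.inl rfl
    · constructor
      · exact Or.inl
      · rintro (h | ⟨rfl, h⟩)
        · exact h
        · exact absurd h hpos
    · constructor
      · exact Or.inl
      · rintro (h | ⟨rfl, h⟩)
        · exact h
        · exact absurd h hpos
    · constructor
      · exact Or.inl
      · rintro (h | ⟨rfl, h⟩)
        · exact h
        · linarith
    · constructor
      · rintro (rfl | h)
        · exact Or.inr ⟨rfl, hneg⟩
        · exact Or.inl h
      · rintro (h | ⟨rfl, -⟩)
        · exact Or.inr h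
        · exact Or.inl rfl
    · constructor
      · exact Or.inl
      · rintro (h | ⟨rfl, h⟩)
        · exact h
        · exact absurd h hneg
    · constructor
      · exact Or.inl
      · rintro (h | ⟨h, -⟩)
        · exact h
        · exact absurd h hpos.ne'
    · constructor
      · exact Or.inl
      · rintro (h | ⟨h, -⟩)
        · exact h
        · exact absurd h hneg.ne
    · have h0 : a.2.1 = 0 := le_antisymm (not_lt.1 hpos) (not_lt.1 hneg)
      constructor
      · rintro (rfl | h)
        · exact Or.inr ⟨h0, rfl⟩
        · exact Or.inl h
      · rintro (h | ⟨-, rfl⟩)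
        · exact Or.inr h
        · exact Or.inl rfl
  obtain ⟨Pos, Neg, Zero⟩ := parts
  obtain ⟨h₁, h₂, h₃⟩ := hp
  simp only at h₁ h₂ h₃
  generalize helim : (loopList (K := ℝ) Pos Zero _).eval = elim
  have he : ∀ g, g ∈ elim ↔ g ∈ Zero ∨ ∃ e ∈ Pos, ∃ f ∈ Neg,
      g = (e.2.1 * f.1 - f.2.1 * e.1, e.2.1 * f.2.2 - f.2.1 * e.2.2) := by
    rw [← helim]
    refine loopList_induction (K := ℝ) (s := Zero) (fun l (acc : List (ℝ × ℝ)) =>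
      ∀ g, g ∈ acc ↔ g ∈ Zero ∨
      ∃ e ∈ l, ∃ f ∈ Neg, g = (e.2.1 * f.1 - f.2.1 * e.1, e.2.1 * f.2.2 - f.2.1 * e.2.2))
      (by simp) ?_ Pos
    intro l e acc hacc
    have := loopList_induction (fun l' (acc' : List (ℝ × ℝ)) => ∀ g, g ∈ acc' ↔ g ∈ acc ∨
      ∃ f ∈ l', g = (e.2.1 * f.1 - f.2.1 * e.1, e.2.1 * f.2.2 - f.2.1 * e.2.2))
      (s := acc) (f := fun acc' (f : ℝ × ℝ × ℝ) => do
        let a ← sub (← mul e.2.1 f.1) (← mul f.2.1 e.1)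
        let c ← sub (← mul e.2.1 f.2.2) (← mul f.2.1 e.2.2)
        pure ((a, c) :: acc')) (by simp) (by
          intro l' f acc' h g
          simp only [eval_bind, eval_sub, eval_mul, eval_pure, List.mem_cons, h, List.mem_append,
            or_and_right, exists_or, exists_eq_left, List.not_mem_nil, or_false]
          rw [or_comm, or_assoc]) Neg
    intro g
    rw [this, hacc]
    simp only [List.mem_append, List.mem_singleton, or_and_right, exists_or, exists_eq_left,
      or_assoc]
  -- Each eliminated inequality is a nonnegative combination of two given ones in which `z` cancels.
  have hcons : ∀ y z, (∀ e ∈ L, 0 ≤ e.1 * y + e.2.1 * z + e.2.2) →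
      ∀ g ∈ elim, 0 ≤ g.1 * y + g.2 := by
    intro y z hyz g hg
    rcases (he g).1 hg with hg | ⟨e, he, f, hf, rfl⟩
    · obtain ⟨e, he, h0, rfl⟩ := (h₃ g).1 hg
      have := hyz e he
      rw [h0] at this
      simpa using this
    · obtain ⟨he, he0⟩ := (h₁ e).1 he
      obtain ⟨hf, hf0⟩ := (h₂ f).1 hf
      have := mul_nonneg he0.le (hyz f hf)
      have := mul_nonneg (neg_nonneg.2 hf0.le) (hyz e he)
      dsimp only
      linarith
  -- Therefore the second call of `solveOneVar` cannot fail, whichever `y` the first one returns.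
  have hback : ∀ y, (∀ g ∈ elim, 0 ≤ g.1 * y + g.2) →
      ∃ z, ∀ e ∈ L, 0 ≤ e.2.1 * z + (e.1 * y + e.2.2) := by
    intro y hy
    obtain ⟨z, hz₁, hz₂⟩ := exists_between_lists
      (Pos.map fun e => -((e.1 * y + e.2.2) / e.2.1))
      (Neg.map fun f => -((f.1 * y + f.2.2) / f.2.1))
      (by
        intro a ha b hb
        obtain ⟨e, hePos, rfl⟩ := List.mem_map.1 ha
        obtain ⟨f, hfNeg, rfl⟩ := List.mem_map.1 hb
        have := hy _ ((he _).2 (Or.inr ⟨e, hePos, f, hfNeg, rfl⟩))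
        have he0 := ((h₁ e).1 hePos).2
        have hf0 := ((h₂ f).1 hfNeg).2
        rw [neg_le_neg_iff, le_div_iff₀ he0, div_mul_eq_mul_div, div_le_iff_of_neg hf0]
        dsimp only at this
        linarith)
    refine ⟨z, fun e heL => ?_⟩
    rcases lt_trichotomy e.2.1 0 with h0 | h0 | h0
    · have := hz₂ _ (List.mem_map.2 ⟨e, (h₂ e).2 ⟨heL, h0⟩, rfl⟩)
      rw [le_neg, div_le_iff_of_neg h0] at this
      linarith
    · have := hy _ ((he _).2 (Or.inl ((h₃ _).2 ⟨e, heL, h0, rfl⟩)))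
      rw [h0]
      simpa using this
    · have := hz₁ _ (List.mem_map.2 ⟨e, (h₁ e).2 ⟨heL, h0⟩, rfl⟩)
      rw [neg_le, le_div_iff₀ h0] at this
      linarith
  obtain ⟨hs₁, hc₁⟩ := solveOneVar_spec elim
  rcases hy : (solveOneVar elim).eval with _ | y
  · simp only [eval_pure]
    refine ⟨fun y z h => by simp at h, ?_⟩
    rintro ⟨y, z, hyz⟩
    obtain ⟨t, ht⟩ := hc₁ ⟨y, hcons y z hyz⟩
    rw [hy] at ht; cases ht
  simp only [eval_bind]
  generalize hrest : (loopList (K := ℝ) L ([] : List (ℝ × ℝ)) _).eval = rest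
  have hr : ∀ g, g ∈ rest ↔ ∃ e ∈ L, g = (e.2.1, e.1 * y + e.2.2) := by
    rw [← hrest]
    refine loopList_induction (K := ℝ) (s := []) (fun l (acc : List (ℝ × ℝ)) => ∀ g, g ∈ acc ↔
      ∃ e ∈ l, g = (e.2.1, e.1 * y + e.2.2)) (by simp) ?_ L
    intro l e acc h g
    simp only [eval_bind, eval_add, eval_mul, eval_pure, List.mem_cons, h, List.mem_append,
      or_and_right, exists_or, exists_eq_left, List.not_mem_nil, or_false]
    exact or_comm
  obtain ⟨hs₂, hc₂⟩ := solveOneVar_spec rest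
  have hsome : ∃ z, (solveOneVar rest).eval = some z := by
    obtain ⟨z, hz⟩ := hback y (hs₁ y hy)
    refine hc₂ ⟨z, fun g hg => ?_⟩
    obtain ⟨e, heL, rfl⟩ := (hr g).1 hg
    exact hz e heL
  obtain ⟨z, hz⟩ := hsome
  simp only [hz, eval_pure]
  refine ⟨?_, fun _ => ⟨y, z, rfl⟩⟩
  rintro _ _ ⟨⟩ e heL
  have := hs₂ z hz _ ((hr _).2 ⟨e, heL, rfl⟩)
  dsimp only at this
  linarith

end FourierMotzkin

/-! ## The final check -/

/-! ### The parts of the solution of a block -/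

section Parts

variable {K : Type} {n : ℕ}

/-- The inverse of the principal submatrix of `M` with the indices in `inα`. -/
def blockInverse (M : Fin n → Fin n → K) (inα : Fin n → Bool)
    (zeroMatrix : Fin n → Fin n → K) : Prog K ((Fin n → Bool) × (Fin n → Fin n → K)) :=
  loop ((fun _ => false, zeroMatrix) : (Fin n → Bool) × (Fin n → Fin n → K))
    fun s k => if inα k then do
        let (h, e) ← schurEntry M s.1 s.2 k
        pure (Function.update s.1 k true, ← addIndex s.2 k h e)
      else pure s

/-- The inequalities for the variables `y` and `z` of a block that are contributed by the index
`k`. -/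
def blockRow (u : Fin n → WithTop K) (inC inα : Fin n → Bool) (b₁ : Fin n) (g₁ g₂ qb : Fin n → K)
    (zero one : K) (L : List (K × K × K)) (k : Fin n) : Prog K (List (K × K × K)) :=
    if inC k then do
      let a' ← neg (g₁ k)
      let b' ← neg (g₂ k)
      let c' ← neg (qb k)
      if inα k then
        match u k with
        | ⊤ => pure ((a', b', c') :: L)
        | (c : K) => do pure ((a', b', c') :: (g₁ k, g₂ k, ← add (qb k) c) :: L)
      else do
        let L := (a', b', c') :: (g₁ k, g₂ k, qb k) :: L
        let m ← neg one
        if k = b₁ then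
          match u k with
          | ⊤ => pure ((one, zero, zero) :: L)
          | (c : K) => pure ((one, zero, zero) :: (m, zero, c) :: L)
        else
          match u k with
          | ⊤ => pure ((zero, one, zero) :: L)
          | (c : K) => pure ((zero, one, zero) :: (zero, m, c) :: L)
    else pure L

/-- The solution of a block from the reduced system. -/
def blockSolution (u : Fin n → WithTop K) (inC inα : Fin n → Bool) (b₁ : Fin n)
    (b₂ : Option (Fin n)) (x : Fin n → K) (g₁ g₂ qb : Fin n → K) (zero one : K) :
    Prog K (Option (Fin n → K)) := do
  let L ← loop ([] : List (K × K × K)) (blockRow u inC inα b₁ g₁ g₂ qb zero one)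
  match ← solveTwoVar L with
  | none => pure none
  | some (y, z) => do
    let x' ← tab fun k =>
      if k = b₁ then pure y
      else if some k = b₂ then pure z
      else if inC k then do
        neg (← add (qb k) (← add (← mul (g₁ k) y) (← mul (g₂ k) z)))
      else pure (x k)
    pure (some x')

theorem solveBlock_eq (M : Fin n → Fin n → K) (q : Fin n → K) (u : Fin n → WithTop K)
    (inC : Fin n → Bool) (b₁ : Fin n) (x : Fin n → K) :
    solveBlock M q u inC b₁ x = (do
      let zero ← lit 0
      let one ← lit 1
      let b₂ ← findFirst fun j => pure (inC j && decide (j ≠ b₁))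
      let inα : Fin n → Bool := fun k => inC k && decide (k ≠ b₁) && decide (some k ≠ b₂)
      let zeroMatrix ← tab2 fun _ _ => pure zero
      let (_, B) ← blockInverse M inα zeroMatrix
      let qb ← transform M inα B q
      let g₁ ← transform M inα B fun j => M j b₁
      let g₂ ← match b₂ with
        | none => tab fun _ => pure zero
        | some b => transform M inα B fun j => M j b
      blockSolution u inC inα b₁ b₂ x g₁ g₂ qb zero one) := by
  rfl

end Parts

section Blocks

variable {n : ℕ}

/-! ### Irreducible blocks and nonsingularity -/

/-- `R` is the partition of the indices into the irreducible diagonal blocks of `M`. -/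
structure IsBlockRelation (M : Fin n → Fin n → ℝ) (R : Fin n → Fin n → Bool) : Prop where
  refl : ∀ i, R i i = true
  symm : ∀ i j, R i j = true → R j i = true
  trans : ∀ i j k, R i j = true → R j k = true → R i k = true
  edge : ∀ i j, M i j ≠ 0 → R i j = true
  connected : ∀ Z : Fin n → Prop, (∀ i j, M i j ≠ 0 → Z i → Z j) →
    ∀ i j, R i j = true → Z i → Z j

/-- Warshall's transitive closure: after `m` passes, chains may be joined at every index below `m`.
Minimality of the relation is carried along as invariance of all edge-closed properties. -/
theorem sameBlock_spec {M : Fin n → Fin n → ℝ} (hM : ∀ i j, M i j = M j i) :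
    IsBlockRelation M (sameBlock M).eval := by
  let P (m : ℕ) (R : Fin n → Fin n → Bool) : Prop :=
    (∀ i, R i i = true) ∧ (∀ i j, R i j = true → R j i = true) ∧
    (∀ i j, M i j ≠ 0 → R i j = true) ∧
    (∀ Z : Fin n → Prop, (∀ i j, M i j ≠ 0 → Z i → Z j) → ∀ i j, R i j = true → Z i → Z j) ∧
    ∀ k : Fin n, k.1 < m → ∀ i j, R i k = true → R k j = true → R i j = true
  have : P n (sameBlock M).eval := by
    simp only [sameBlock, eval_bind]
    refine loop_induction P ?_ ?_
    · have ev : ∀ i j : Fin n, (if i = j then true else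
          if 0 < M i j then true else decide (M i j < 0)) = true ↔ i = j ∨ M i j ≠ 0 := by
        intro i j
        by_cases h : i = j
        · simp [h]
        · by_cases h' : 0 < M i j
          · simp [h, h', h'.ne']
          · simp only [h, h', if_false, decide_eq_true_eq, false_or, ne_eq]
            exact ⟨fun h => h.ne, fun h => lt_of_le_of_ne (not_lt.1 h') h⟩
      simp only [P, eval_tab2, eval_ite, eval_pure, eval_bind, eval_isPos, eval_isNeg,
        decide_eq_true_eq, ev]
      refine ⟨fun i => by simp, fun i j h => ?_, fun i j h => Or.inr h, fun Z hZ i j h hi => ?_,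
        fun k hk => absurd hk (Nat.not_lt_zero _)⟩
      · rcases h with h | h
        · exact Or.inl h.symm
        · exact Or.inr (by rwa [hM])
      · rcases h with rfl | h
        · exact hi
        · exact hZ i j h hi
    · rintro k R ⟨h₁, h₂, h₃, h₄, h₅⟩
      simp only [P, eval_tab2, eval_pure, Bool.or_eq_true, Bool.and_eq_true]
      refine ⟨fun i => Or.inl (h₁ i), fun i j h => ?_, fun i j h => Or.inl (h₃ i j h),
        fun Z hZ i j h hi => ?_, fun l hl i j h h' => ?_⟩
      · rcases h with h | h
        · exact Or.inl (h₂ i j h)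
        · exact Or.inr ⟨h₂ _ _ h.2, h₂ _ _ h.1⟩
      · rcases h with h | h
        · exact h₄ Z hZ i j h hi
        · exact h₄ Z hZ k j h.2 (h₄ Z hZ i k h.1 hi)
      · rcases Nat.lt_succ_iff_lt_or_eq.1 hl with hl | hl
        · rcases h with h | h <;> rcases h' with h' | h'
          · exact Or.inl (h₅ l hl i j h h')
          · exact Or.inr ⟨h₅ l hl i k h h'.1, h'.2⟩
          · exact Or.inr ⟨h.1, h₅ l hl k j h.2 h'⟩
          · exact Or.inr ⟨h.1, h'.2⟩
        · obtain rfl : l = k := Fin.ext hl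
          have e₁ : R i l = true := by rcases h with h | h; exacts [h, h.1]
          have e₂ : R l j = true := by rcases h' with h' | h'; exacts [h', h'.2]
          exact Or.inr ⟨e₁, e₂⟩
  obtain ⟨h₁, h₂, h₃, h₄, h₅⟩ := this
  exact ⟨h₁, h₂, fun i j k => h₅ j j.2 i k, h₃, h₄⟩

/-- The quadratic form of the comparison matrix at `|x|` is at most that of the matrix at `x`. -/
theorem quad_comparisonMatrix_abs_le (M : Fin n → Fin n → ℝ) (x : Fin n → ℝ) :
    quad (comparisonMatrix M) (fun i => |x i|) ≤ quad M x := by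
  simp only [quad, Finset.mul_sum]
  refine Finset.sum_le_sum fun i _ => Finset.sum_le_sum fun j _ => ?_
  by_cases hij : i = j
  · subst hij
    rw [comparisonMatrix_self]
    have := abs_mul_abs_self (x i)
    exact le_of_eq (by linear_combination M i i * this)
  · rw [comparisonMatrix_of_ne M hij]
    have := neg_abs_le (x i * (M i j * x j))
    rw [abs_mul, abs_mul] at this
    linarith

theorem comparisonMatrix_succAbove (M : Fin (n + 1) → Fin (n + 1) → ℝ) (i : Fin (n + 1))
    (j k : Fin n) : comparisonMatrix (fun j k => M (i.succAbove j) (i.succAbove k)) j k =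
      comparisonMatrix M (i.succAbove j) (i.succAbove k) := by
  simp [comparisonMatrix]

/-- As `y i = 0`, the form is that of the submatrix without `i`, which is semidefinite, so `y` is a
null vector of it. Nothing follows for row `i` itself. -/
theorem comparisonMatrix_mulVec_eq_zero {M : Fin (n + 1) → Fin (n + 1) → ℝ} {i : Fin (n + 1)}
    (hC : IsPSD (comparisonMatrix fun j k => M (i.succAbove j) (i.succAbove k)))
    {y : Fin (n + 1) → ℝ} (hi : y i = 0) (hy : quad (comparisonMatrix M) y ≤ 0) {j : Fin (n + 1)}
    (hj : j ≠ i) : ∑ k, comparisonMatrix M j k * y k = 0 := by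
  have e : ∀ j, ∑ k, comparisonMatrix M j k * y k =
      ∑ k, comparisonMatrix M j (i.succAbove k) * y (i.succAbove k) := fun j => by
    rw [Fin.sum_univ_succAbove _ i, hi]; simp
  have hq : quad (comparisonMatrix fun j k => M (i.succAbove j) (i.succAbove k))
      (fun k => y (i.succAbove k)) = quad (comparisonMatrix M) y := by
    simp only [quad, e, comparisonMatrix_succAbove]
    rw [Fin.sum_univ_succAbove _ i, hi]; simp
  obtain ⟨k, rfl⟩ := Fin.exists_succAbove_eq hj
  have := hC.mulVec_eq_zero (le_antisymm (hq.trans_le hy) (hC.2 _)) k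
  rw [e]
  simpa only [comparisonMatrix_succAbove] using this

/-- In an irreducible diagonal block, the principal submatrix that is left when two indices are
removed is nonsingular. -/
theorem eq_zero_of_quad_eq_zero {M : Fin (n + 1) → Fin (n + 1) → ℝ}
    (hC : ∀ i : Fin (n + 1),
      IsPSD (comparisonMatrix fun j k => M (i.succAbove j) (i.succAbove k)))
    {R : Fin (n + 1) → Fin (n + 1) → Bool} (hR : IsBlockRelation M R) {b₁ b₂ : Fin (n + 1)}
    (hb : b₁ ≠ b₂) {x : Fin (n + 1) → ℝ} (h₁ : x b₁ = 0) (h₂ : x b₂ = 0) (hx : quad M x = 0)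
    {k : Fin (n + 1)} (hk : R b₁ k = true) : x k = 0 := by
  have hy := (quad_comparisonMatrix_abs_le M x).trans hx.le
  -- Removing `b₂` covers the row `b₁`, removing `b₁` covers all others; this is why two zeros of
  -- `x` are needed.
  have hz : ∀ j, ∑ k, comparisonMatrix M j k * |x k| = 0 := fun j => by
    by_cases hj : j = b₁
    · exact comparisonMatrix_mulVec_eq_zero (hC b₂) (by simp [h₂]) hy (by rw [hj]; exact hb)
    · exact comparisonMatrix_mulVec_eq_zero (hC b₁) (by simp [h₁]) hy hj
  refine hR.connected (fun i => x i = 0) (fun i j hij hi => ?_) b₁ k hk h₁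
  by_cases h : i = j
  · rw [← h]; exact hi
  -- In a row with `x i = 0` all terms are nonpositive and sum to zero, so `x` vanishes at every
  -- index joined to `i`; thus the zero at `b₁` spreads through the block.
  have hle : ∀ k ∈ univ, comparisonMatrix M i k * |x k| ≤ 0 := fun k _ => by
    by_cases hik : i = k
    · rw [← hik, hi]; simp
    · rw [comparisonMatrix_of_ne M hik]
      exact mul_nonpos_of_nonpos_of_nonneg (by simp) (abs_nonneg _)
  have := (Finset.sum_eq_zero_iff_of_nonpos hle).1 (hz i) j (Finset.mem_univ j)
  rw [comparisonMatrix_of_ne M h] at this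
  rcases mul_eq_zero.1 this with h' | h'
  · exact absurd (by simpa using h') hij
  · simpa using h'

/-- The vector equal to `1` at `i` and to `-h` on `s` has the Schur entry as its form value. -/
theorem InvOn.schur_ne_zero {M : Fin n → Fin n → ℝ} {s : Finset (Fin n)}
    {B : Fin n → Fin n → ℝ} (hB : InvOn M s B) {i : Fin n} (hi : i ∉ s)
    (hnd : ∀ x : Fin n → ℝ, (∀ k ∉ insert i s, x k = 0) → quad M x = 0 → x i = 0) :
    M i i - ∑ j ∈ s, M i j * ∑ k ∈ s, B j k * M k i ≠ 0 := by
  intro h0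
  set h : Fin n → ℝ := fun j => ∑ k ∈ s, B j k * M k i
  set x : Fin n → ℝ := fun j => if j = i then 1 else if j ∈ s then -h j else 0
  have hne : ∀ k ∈ s, k ≠ i := fun k hk => by rintro rfl; exact hi hk
  have hx : ∀ k, ∑ j, M k j * x j = M k i - ∑ j ∈ s, M k j * h j := by
    intro k
    rw [← Finset.sum_subset (Finset.subset_univ (insert i s)) fun j _ hj => ?_,
      Finset.sum_insert hi, sub_eq_add_neg, ← Finset.sum_neg_distrib]
    · congr 1
      · simp [x]
      · exact Finset.sum_congr rfl fun j hj => by simp [x, hne j hj, hj]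
    · rw [Finset.mem_insert, not_or] at hj
      simp [x, hj.1, hj.2]
  have := hnd x (fun k hk => by
    rw [Finset.mem_insert, not_or] at hk
    simp [x, hk.1, hk.2]) (Finset.sum_eq_zero fun k _ => by
      rw [hx]
      by_cases hk : k = i
      · subst hk; rw [h0, mul_zero]
      · by_cases hks : k ∈ s
        · rw [hB.mulVec (fun j => M j i) hks, sub_self, mul_zero]
        · simp [x, hk, hks])
  simp [x] at this

/-! ### Solving one block -/

/-- The vector `x` satisfies the equations `q + M x = 0` and the bounds for the indices in `C`. -/
def SolvesOn (M : Fin n → Fin n → ℝ) (q : Fin n → ℝ) (u : Fin n → WithTop ℝ) (C : Fin n → Bool)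
    (x : Fin n → ℝ) : Prop :=
  ∀ k, C k = true → q k + ∑ j, M k j * x j = 0 ∧ 0 ≤ x k ∧ (x k : WithTop ℝ) ≤ u k

/-- The rows of a block involve only its own variables, so work on later blocks does not spoil it.
-/
theorem SolvesOn.congr {M : Fin n → Fin n → ℝ} {q : Fin n → ℝ} {u : Fin n → WithTop ℝ}
    {C : Fin n → Bool} (hC : ∀ k j, C k = true → M k j ≠ 0 → C j = true) {x x' : Fin n → ℝ}
    (h : SolvesOn M q u C x) (hx : ∀ k, C k = true → x' k = x k) : SolvesOn M q u C x' := by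
  intro k hk
  have : ∑ j, M k j * x' j = ∑ j, M k j * x j := Finset.sum_congr rfl fun j _ => by
    by_cases h0 : M k j = 0
    · simp [h0]
    · rw [hx j (hC k j hk h0)]
  rw [this, hx k hk]
  exact h k hk

/-- As the form has no nontrivial zero supported on `α`, the Schur entry at every bordering step is
nonzero, so no reordering of the indices is needed. -/
theorem blockInverse_spec {M : Fin n → Fin n → ℝ} (hM : ∀ i j, M i j = M j i)
    {inα : Fin n → Bool} (Z : Fin n → Fin n → ℝ)
    (hnd : ∀ x : Fin n → ℝ, (∀ k, inα k = false → x k = 0) → quad M x = 0 → ∀ k, x k = 0) :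
    InvOn M {k | inα k} (blockInverse M inα Z).eval.2 := by
  let P (m : ℕ) (s : (Fin n → Bool) × (Fin n → Fin n → ℝ)) : Prop :=
    (∀ k, s.1 k = true ↔ inα k = true ∧ k.1 < m) ∧ InvOn M {k | s.1 k} s.2
  have : P n (blockInverse M inα Z).eval := by
    refine loop_induction P ⟨by simp, by simpa using invOn_empty⟩ ?_
    rintro k ⟨a, B⟩ ⟨h₁, h₂⟩
    dsimp only at h₁ h₂ ⊢
    have hk : k ∉ (univ.filter fun j => a j = true) := by simp [h₁]
    by_cases hα : inα k = true
    · rw [if_pos hα]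
      simp only [eval_bind, eval_schurEntry, eval_pure]
      refine ⟨fun j => ?_, ?_⟩
      · by_cases hj : j = k
        · subst hj; simp [hα]
        · have : (j : ℕ) ≠ k := fun h => hj (Fin.ext h)
          simp only [Function.update_of_ne hj, h₁]
          exact and_congr_right fun _ => by omega
      · have e : (univ.filter fun j => Function.update a k true j = true) =
            insert k (univ.filter fun j => a j = true) := by
          ext j
          by_cases hj : j = k
          · subst hj; simp
          · simp [hj]
        rw [e]
        refine h₂.addIndex hM hk (fun _ _ => rfl) rfl (h₂.schur_ne_zero hk fun x hx hq => ?_)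
        refine hnd x (fun j hj => hx j ?_) hq k
        rw [Finset.mem_insert, not_or]
        exact ⟨fun h => by rw [h, hα] at hj; simp at hj, by simp [h₁, hj]⟩
    · rw [if_neg hα]
      refine ⟨fun j => ?_, h₂⟩
      rw [eval_pure, h₁]
      refine and_congr_right fun hj => ⟨fun h => by omega, fun h => ?_⟩
      have : (j : ℕ) ≠ k := fun h => hα (by rwa [← Fin.ext h])
      omega
  have e : (univ.filter fun k => inα k = true) =
      univ.filter fun k => (blockInverse M inα Z).eval.1 k = true := by
    ext k; simp [this.1 k]
  rw [e]
  exact this.2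

/-- The condition that the index `k` of a block imposes on the values `y` and `z` of the two
variables that are not eliminated; `r` is the value of the right-hand side of the row. -/
def RowCondition (u : Fin n → WithTop ℝ) (inα : Fin n → Bool) (b₁ : Fin n) (y z r : ℝ)
    (k : Fin n) : Prop :=
  if inα k = true then 0 ≤ -r ∧ ((-r : ℝ) : WithTop ℝ) ≤ u k
  else r = 0 ∧ if k = b₁ then 0 ≤ y ∧ (y : WithTop ℝ) ≤ u k else 0 ≤ z ∧ (z : WithTop ℝ) ≤ u k

theorem blockRow_spec (u : Fin n → WithTop ℝ) (inC inα : Fin n → Bool) (b₁ : Fin n)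
    (g₁ g₂ qb : Fin n → ℝ) (L : List (ℝ × ℝ × ℝ)) (k : Fin n) (y z : ℝ) :
    (∀ e ∈ (blockRow u inC inα b₁ g₁ g₂ qb 0 1 L k).eval, 0 ≤ e.1 * y + e.2.1 * z + e.2.2) ↔
      (∀ e ∈ L, 0 ≤ e.1 * y + e.2.1 * z + e.2.2) ∧ (inC k = true →
        RowCondition u inα b₁ y z (qb k + (g₁ k * y + g₂ k * z)) k) := by
  have top : ∀ r : ℝ, (r : WithTop ℝ) ≤ none := fun r => le_top (a := (r : WithTop ℝ))
  have coe : ∀ r c : ℝ, (r : WithTop ℝ) ≤ some c ↔ r ≤ c := fun r c => WithTop.coe_le_coe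
  have eqz : ∀ r : ℝ, r = 0 ↔ 0 ≤ -r ∧ 0 ≤ r := fun r =>
    ⟨fun h => by simp [h], fun h => by linarith [h.1, h.2]⟩
  by_cases hC : inC k = true
  swap
  · simp [blockRow, hC]
  have e₁ : -g₁ k * y + -g₂ k * z + -qb k = -(qb k + (g₁ k * y + g₂ k * z)) := by ring
  have e₂ : g₁ k * y + g₂ k * z + qb k = qb k + (g₁ k * y + g₂ k * z) := by ring
  simp only [blockRow, hC, if_true, eval_bind, eval_neg, eval_ite, RowCondition, true_imp_iff]
  by_cases hα : inα k = true
  · simp only [hα, if_true]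
    rcases u k with _ | c
    · simp only [eval_pure, List.forall_mem_cons, e₁, top, and_true]
      exact and_comm
    · simp only [eval_bind, eval_add, eval_pure, List.forall_mem_cons, e₁, coe]
      have : 0 ≤ g₁ k * y + g₂ k * z + (qb k + c) ↔ -(qb k + (g₁ k * y + g₂ k * z)) ≤ c :=
        ⟨fun h => by linarith, fun h => by linarith⟩
      rw [this]
      tauto
  · simp only [hα, if_false, Bool.false_eq_true]
    rw [eqz]
    by_cases hk : k = b₁
    · simp only [hk, if_true] at e₁ e₂ ⊢
      rcases u b₁ with _ | c
      · simp only [eval_pure, List.forall_mem_cons, e₁, e₂, top, and_true, one_mul, zero_mul,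
          add_zero]
        tauto
      · simp only [eval_pure, List.forall_mem_cons, e₁, e₂, coe, one_mul, zero_mul,
          add_zero]
        have : 0 ≤ -1 * y + c ↔ y ≤ c := ⟨fun h => by linarith, fun h => by linarith⟩
        rw [this]
        tauto
    · simp only [hk, if_false]
      rcases u k with _ | c
      · simp only [eval_pure, List.forall_mem_cons, e₁, e₂, top, and_true, one_mul, zero_mul,
          add_zero, zero_add]
        tauto
      · simp only [eval_pure, List.forall_mem_cons, e₁, e₂, coe, one_mul, zero_mul,
          add_zero, zero_add]
        have : 0 ≤ -1 * z + c ↔ z ≤ c := ⟨fun h => by linarith, fun h => by linarith⟩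
        rw [this]
        tauto

theorem blockSolution_spec (u : Fin n → WithTop ℝ) (inC inα : Fin n → Bool) (b₁ : Fin n)
    (b₂ : Option (Fin n)) (x g₁ g₂ qb : Fin n → ℝ) :
    (∀ x', (blockSolution u inC inα b₁ b₂ x g₁ g₂ qb 0 1).eval = some x' → ∃ y z,
      (∀ k, inC k = true → RowCondition u inα b₁ y z (qb k + (g₁ k * y + g₂ k * z)) k) ∧
      x' = fun k => if k = b₁ then y else if some k = b₂ then z else if inC k = true then
        -(qb k + (g₁ k * y + g₂ k * z)) else x k) ∧
    ((∃ y z, ∀ k, inC k = true → RowCondition u inα b₁ y z (qb k + (g₁ k * y + g₂ k * z)) k) →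
      ∃ x', (blockSolution u inC inα b₁ b₂ x g₁ g₂ qb 0 1).eval = some x') := by
  simp only [blockSolution, eval_bind]
  generalize hL : (loop (K := ℝ) ([] : List (ℝ × ℝ × ℝ)) _).eval = L
  have hL' : ∀ y z, (∀ e ∈ L, 0 ≤ e.1 * y + e.2.1 * z + e.2.2) ↔ ∀ k, inC k = true →
      RowCondition u inα b₁ y z (qb k + (g₁ k * y + g₂ k * z)) k := by
    have := loop_induction (K := ℝ) (n := n) (s := []) (f := blockRow u inC inα b₁ g₁ g₂ qb 0 1)
      (fun m L => ∀ y z, (∀ e ∈ L, 0 ≤ e.1 * y + e.2.1 * z + e.2.2) ↔ ∀ k : Fin n, k.1 < m →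
        inC k = true → RowCondition u inα b₁ y z (qb k + (g₁ k * y + g₂ k * z)) k) (by simp) (by
        intro k L h y z
        rw [blockRow_spec, h]
        refine ⟨fun h j hj => ?_, fun h => ⟨fun j hj => h j (by omega), h k (by omega)⟩⟩
        rcases Nat.lt_succ_iff_lt_or_eq.1 hj with hj | hj
        · exact h.1 j hj
        · rw [Fin.ext hj]; exact h.2)
    rw [hL] at this
    intro y z
    rw [this]
    exact ⟨fun h k => h k k.2, fun h k _ => h k⟩
  obtain ⟨hs, hc⟩ := solveTwoVar_spec L
  rcases hsol : (solveTwoVar L).eval with _ | ⟨y, z⟩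
  · simp only [eval_pure]
    refine ⟨fun x' h => (by cases h), ?_⟩
    rintro ⟨y, z, h⟩
    obtain ⟨y, z, h⟩ := hc ⟨y, z, (hL' y z).2 h⟩
    rw [hsol] at h; cases h
  · simp only [eval_bind, eval_tab, eval_ite, eval_pure, eval_mul, eval_add, eval_neg]
    refine ⟨?_, fun _ => ⟨_, rfl⟩⟩
    rintro _ ⟨⟩
    exact ⟨y, z, (hL' y z).1 (hs y z hsol), rfl⟩

theorem solveBlock_spec {M : Fin n → Fin n → ℝ} (hM : IsPSD M) (q : Fin n → ℝ)
    (u : Fin n → WithTop ℝ) {C : Fin n → Bool}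
    (hC : ∀ k j, C k = true → M k j ≠ 0 → C j = true) {b₁ : Fin n} (hb₁ : C b₁ = true)
    (hnd : ∀ b₂ x, b₁ ≠ b₂ → x b₁ = 0 → x b₂ = 0 → quad M x = 0 → ∀ k, C k = true → x k = 0)
    (x : Fin n → ℝ) :
    (∀ x', (solveBlock M q u C b₁ x).eval = some x' →
      (∀ k, C k = false → x' k = x k) ∧ SolvesOn M q u C x') ∧
    ((∃ x', SolvesOn M q u C x') → ∃ x', (solveBlock M q u C b₁ x).eval = some x') := by
  simp only [solveBlock_eq, eval_bind, eval_lit, Nat.cast_zero, Nat.cast_one]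
  have hfirst := findFirst_spec (K := ℝ) fun j : Fin n => pure (C j && decide (j ≠ b₁))
  generalize (findFirst (K := ℝ) fun j : Fin n => pure (C j && decide (j ≠ b₁))).eval = b₂
    at hfirst ⊢
  simp only [eval_pure, Bool.and_eq_true, decide_eq_true_eq, Bool.and_eq_false_iff,
    decide_eq_false_iff_not, not_not] at hfirst
  generalize hα : (fun k => C k && decide (k ≠ b₁) && decide (some k ≠ b₂)) = inα
  have hα' : ∀ k, inα k = true ↔ C k = true ∧ k ≠ b₁ ∧ some k ≠ b₂ := fun k => by
    rw [← hα]; simp [and_assoc]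
  generalize (tab2 (K := ℝ) (n := n) fun _ _ => pure (0 : ℝ)).eval = Z
  have hB : InvOn M {k | inα k} (blockInverse M inα Z).eval.2 := by
    refine blockInverse_spec hM.1 Z fun x hx hq k => ?_
    by_cases hk : C k = true
    · rcases b₂ with _ | b
      · rcases hfirst.2 rfl k with h | h
        · rw [hk] at h; cases h
        · exact hx k (Bool.eq_false_iff.2 fun h' => ((hα' k).1 h').2.1 h)
      · refine hnd b x (hfirst.1 b rfl).1.2.symm
          (hx _ (Bool.eq_false_iff.2 fun h' => ((hα' _).1 h').2.1 rfl))
          (hx _ (Bool.eq_false_iff.2 fun h' => ((hα' _).1 h').2.2 rfl)) hq k hk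
    · exact hx k (Bool.eq_false_iff.2 fun h' => hk ((hα' k).1 h').1)
  generalize (blockInverse M inα Z).eval.2 = B at hB ⊢
  -- the column of the second variable
  obtain ⟨m₂, hm₂⟩ : ∃ m₂ : Fin n → ℝ, m₂ = match b₂ with
    | none => fun _ => 0
    | some b => fun j => M j b := ⟨_, rfl⟩
  have key : ∀ g₂, g₂ = bar M {k | inα k} B m₂ →
      (∀ x', (blockSolution u C inα b₁ b₂ x (transform M inα B fun j => M j b₁).eval g₂
        (transform M inα B q).eval 0 1).eval = some x' →
        (∀ k, C k = false → x' k = x k) ∧ SolvesOn M q u C x') ∧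
      ((∃ x', SolvesOn M q u C x') → ∃ x', (blockSolution u C inα b₁ b₂ x
        (transform M inα B fun j => M j b₁).eval g₂
        (transform M inα B q).eval 0 1).eval = some x') := by
    rintro _ rfl
    rw [eval_transform, eval_transform]
    obtain ⟨hsound, hcompl⟩ := blockSolution_spec u C inα b₁ b₂ x
      (bar M {k | inα k} B fun j => M j b₁) (bar M {k | inα k} B m₂) (bar M {k | inα k} B q)
    set s : Finset (Fin n) := univ.filter fun k => inα k = true with hs
    have hmem : ∀ k, k ∈ s ↔ inα k = true := fun k => by simp [hs]
    -- the right-hand side after the two variables have been fixed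
    have hbar : ∀ y z k, bar M s B q k + (bar M s B (fun j => M j b₁) k * y +
        bar M s B m₂ k * z) = bar M s B (fun j => q j + y * M j b₁ + z * m₂ j) k := by
      intro y z k
      rw [bar_add_smul (fun j => q j + y * M j b₁) m₂ z k, bar_add_smul q (fun j => M j b₁) y k]
      ring
    simp only [hbar] at hsound hcompl
    have hrow : ∀ (X : Fin n → ℝ) (y z : ℝ), X b₁ = y → (∀ b, b₂ = some b → X b = z) → ∀ k,
        C k = true → q k + ∑ j, M k j * X j =
          q k + y * M k b₁ + z * m₂ k + ∑ j ∈ s, M k j * X j := by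
      intro X y z hy hz k hk
      -- A row of the block meets only `b₁`, `b₂` and `α`, and these are disjoint.
      have hterm : ∀ j, M k j * X j = (if j = b₁ then M k j * X j else 0) +
          (if some j = b₂ then M k j * X j else 0) + (if j ∈ s then M k j * X j else 0) := by
        intro j
        by_cases h0 : M k j = 0
        · simp [h0]
        have hjC := hC k j hk h0
        by_cases h₁ : j = b₁
        · have h₂ : some j ≠ b₂ := fun h => (hfirst.1 j h.symm).1.2 h₁
          have h₃ : j ∉ s := by rw [hmem, hα']; exact fun h => h.2.1 h₁
          rw [if_pos h₁, if_neg h₂, if_neg h₃]; ring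
        · by_cases h₂ : some j = b₂
          · have h₃ : j ∉ s := by rw [hmem, hα']; exact fun h => h.2.2 h₂
            rw [if_neg h₁, if_pos h₂, if_neg h₃]; ring
          · have h₃ : j ∈ s := by rw [hmem, hα']; exact ⟨hjC, h₁, h₂⟩
            rw [if_neg h₁, if_neg h₂, if_pos h₃]; ring
      rw [Finset.sum_congr rfl fun j _ => hterm j, Finset.sum_add_distrib, Finset.sum_add_distrib]
      have e₂ : ∑ j, (if some j = b₂ then M k j * X j else 0) = z * m₂ k := by
        rcases b₂ with _ | b
        · simp [hm₂]
        · simp [hm₂, hz b rfl, mul_comm]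
      rw [e₂]
      simp [hy]
      ring
    refine ⟨fun x' hx' => ?_, ?_⟩
    · obtain ⟨y, z, hcond, hx'⟩ := hsound x' hx'
      have hX : ∀ k ∈ s, x' k = -bar M s B (fun j => q j + y * M j b₁ + z * m₂ j) k :=
        fun k hk => by
          obtain ⟨h₁, h₂, h₃⟩ := (hα' k).1 ((hmem k).1 hk)
          simp [hx', h₁, h₂, h₃]
      refine ⟨fun k hk => ?_, fun k hk => ?_⟩
      · have h₁ : k ≠ b₁ := by rintro rfl; rw [hb₁] at hk; cases hk
        have h₂ : some k ≠ b₂ := fun h => by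
          have := (hfirst.1 k h.symm).1.1
          rw [hk] at this; cases this
        simp [hx', h₁, h₂, hk]
      · have hg := hrow x' y z (by simp [hx']) (fun b hb => by
          simp [hx', (hfirst.1 b hb).1.2, hb]) k hk
        rw [hg, Finset.sum_congr rfl fun j hj => by rw [hX j hj]]
        have hc := hcond k hk
        simp only [mul_neg, Finset.sum_neg_distrib]
        by_cases hks : k ∈ s
        · rw [hB.sum_mul_bar _ hks]
          rw [hX k hks]
          rw [RowCondition, if_pos ((hmem k).1 hks)] at hc
          exact ⟨by ring, hc⟩
        · rw [RowCondition, if_neg (mt (hmem k).2 hks), bar_of_notMem hks] at hc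
          refine ⟨by linarith [hc.1], ?_⟩
          by_cases h₁ : k = b₁
          · simpa [hx', h₁] using hc.2
          · have h₂ : some k = b₂ := by
              by_contra h₂
              exact hks ((hmem k).2 ((hα' k).2 ⟨hk, h₁, h₂⟩))
            simpa [hx', h₁, h₂] using hc.2
    · rintro ⟨X, hX⟩
      -- In a block of order one the second variable has zero coefficients and any value will do.
      obtain ⟨z, hz⟩ : ∃ z, ∀ b, b₂ = some b → X b = z := by
        rcases b₂ with _ | b
        · exact ⟨0, by simp⟩
        · exact ⟨X b, by rintro _ ⟨⟩; rfl⟩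
      refine hcompl ⟨X b₁, z, fun k hk => ?_⟩
      have hg := fun k hk => (hrow X (X b₁) z rfl hz k hk).symm.trans (hX k hk).1
      have hXs : ∀ k ∈ s, X k = -bar M s B (fun j => q j + X b₁ * M j b₁ + z * m₂ j) k := by
        intro k hk
        rw [bar_of_mem hk, ← Finset.sum_neg_distrib]
        have := hB.unique hM.1 (y := X) (r := fun j => -(q j + X b₁ * M j b₁ + z * m₂ j))
          (fun i hi => by linarith [hg i ((hα' i).1 ((hmem i).1 hi)).1]) hk
        rw [this]
        exact Finset.sum_congr rfl fun j _ => by ring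
      obtain ⟨-, h₀, hu⟩ := hX k hk
      rw [RowCondition]
      split_ifs with h₁ h₂
      · rw [← hXs k ((hmem k).2 h₁)]
        exact ⟨h₀, hu⟩
      all_goals
        have hks : k ∉ s := mt (hmem k).1 h₁
        refine ⟨?_, ?_⟩
        · rw [bar_of_notMem hks]
          have h := hg k hk
          rw [Finset.sum_congr rfl fun j hj => by rw [hXs j hj]] at h
          simp only [mul_neg, Finset.sum_neg_distrib] at h
          linarith
      · rw [← h₂]; exact ⟨h₀, hu⟩
      · have h₃ : some k = b₂ := by
          by_contra h₃
          exact h₁ ((hα' k).2 ⟨hk, h₂, h₃⟩)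
        rw [← hz k h₃.symm]; exact ⟨h₀, hu⟩
  rcases b₂ with _ | b
  · simp only [eval_bind]
    refine key _ ?_
    funext k
    simp [hm₂, bar]
  · simp only [eval_bind]
    refine key _ ?_
    rw [eval_transform, hm₂]

/-- Correctness of the final check. -/
theorem finalCheck_spec {M : Fin (n + 1) → Fin (n + 1) → ℝ} (hM : IsPSD M)
    (hC : ∀ i : Fin (n + 1),
      IsPSD (comparisonMatrix fun j k => M (i.succAbove j) (i.succAbove k)))
    (q : Fin (n + 1) → ℝ) (u : Fin (n + 1) → WithTop ℝ) :
    (∃ x, (finalCheck M q u).eval = .optimal x ∧ SolvesOn M q u (fun _ => true) x) ∨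
    ((finalCheck M q u).eval = .noSolution ∧ ¬ ∃ x, SolvesOn M q u (fun _ => true) x) := by
  have hR := sameBlock_spec hM.1
  simp only [finalCheck, eval_bind]
  generalize (sameBlock M).eval = R at hR ⊢
  have hclosed : ∀ i k j, R i k = true → M k j ≠ 0 → R i j = true := fun i k j h h' =>
    hR.trans i k j h (hR.edge k j h')
  have hblock := fun i => solveBlock_spec hM q u (hclosed i) (hR.refl i)
    fun b₂ x hb h₁ h₂ hq k hk => eq_zero_of_quad_eq_zero hC hR hb h₁ h₂ hq hk
  generalize hres : (loop (K := ℝ) (n := n + 1) (some _) _).eval = res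
  -- A block counts as solved once the loop has passed its least index `r`; at other indices the
  -- loop does nothing.
  let P (m : ℕ) (s : Option (Fin (n + 1) → ℝ)) : Prop :=
    (∀ x, s = some x → ∀ r : Fin (n + 1), r.1 < m → (∀ j < r, R r j = false) →
      SolvesOn M q u (R r) x) ∧ ((∃ x, SolvesOn M q u (fun _ => true) x) → ∃ x, s = some x)
  have hP : P (n + 1) res := by
    rw [← hres]
    refine loop_induction P ⟨fun x _ r hr => absurd hr (Nat.not_lt_zero _), fun _ => ⟨_, rfl⟩⟩ ?_
    rintro i (_ | x) ⟨h₁, h₂⟩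
    · refine ⟨fun x hx => (by cases hx), fun h => ?_⟩
      obtain ⟨x, hx⟩ := h₂ h
      cases hx
    have h₁ := h₁ x rfl
    obtain ⟨hf₁, hf₂⟩ := findFirst_spec (K := ℝ) fun j => pure (R i j)
    simp only [eval_bind]
    rcases hf : (findFirst (K := ℝ) fun j => pure (R i j)).eval with _ | j
    · have := hf₂ hf i
      rw [eval_pure, hR.refl] at this; cases this
    obtain ⟨hj, hmin⟩ := hf₁ j hf
    simp only [eval_pure] at hj hmin
    simp only [eval_ite, eval_pure]
    by_cases hji : j = i
    · rw [if_pos hji]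
      obtain ⟨hs, hc⟩ := hblock i x
      refine ⟨fun x' hx' r hr hrep => ?_, fun ⟨y, hy⟩ => hc ⟨y, fun k _ => hy k rfl⟩⟩
      obtain ⟨hout, hsol⟩ := hs x' hx'
      rcases Nat.lt_succ_iff_lt_or_eq.1 hr with hlt | heq
      · refine (h₁ r hlt hrep).congr (hclosed r) fun k hk => hout k ?_
        rw [Bool.eq_false_iff]
        intro hik
        have := hmin r (by rw [hji]; exact hlt)
        rw [hR.trans i k r hik (hR.symm r k hk)] at this
        cases this
      · rw [Fin.ext heq]; exact hsol
    · rw [if_neg hji]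
      refine ⟨?_, fun _ => ⟨x, rfl⟩⟩
      rintro _ ⟨⟩ r hr hrep
      rcases Nat.lt_succ_iff_lt_or_eq.1 hr with hlt | heq
      · exact h₁ r hlt hrep
      · obtain rfl : r = i := Fin.ext heq
        have hle : j < r := by
          rcases lt_trichotomy j r with h | h | h
          · exact h
          · exact absurd h hji
          · have := hmin r h
            rw [hR.refl] at this; cases this
        rw [hrep j hle] at hj; cases hj
  rcases res with _ | x
  · refine Or.inr ⟨rfl, fun h => ?_⟩
    obtain ⟨x, hx⟩ := hP.2 h
    cases hx
  · refine Or.inl ⟨x, rfl, fun k _ => ?_⟩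
    obtain ⟨r, hr, hmin⟩ := Finset.exists_min_image (univ.filter fun j => R k j = true) id
      ⟨k, by simp [hR.refl]⟩
    simp only [Finset.mem_filter, Finset.mem_univ, true_and, id] at hr hmin
    refine hP.1 x rfl r r.2 (fun j hj => ?_) k (hR.symm k r hr)
    rw [Bool.eq_false_iff]
    exact fun h => absurd (hmin j (hR.trans k r j hr h)) (not_le.2 hj)

end Blocks

/-! ## Correctness of the algorithm -/

section Resolve

variable {n : ℕ} {M : Fin (n + 1) → Fin (n + 1) → ℝ} {q : Fin (n + 1) → ℝ}
  {u : Fin (n + 1) → WithTop ℝ} {i : Fin (n + 1)} {c : ℝ}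

theorem kktAt_insertNth {y : Fin n → ℝ} (h : KKT (fun j k => M (i.succAbove j) (i.succAbove k))
    (fun j => q (i.succAbove j) + M (i.succAbove j) i * c) (fun j => u (i.succAbove j)) y)
    (k : Fin n) : KKTAt M q u (i.insertNth c y) (i.succAbove k) := by
  refine (h k).congr (by simp) rfl ?_
  simp [Fin.sum_univ_succAbove _ i, add_assoc]

/-- By symmetry the shift of the linear term contributes `c (Mv)_i = 0` along the ray. -/
theorem isRay_insertNth_of_shift (hM : IsPSD M) {v : Fin n → ℝ}
    (h : IsRay (fun j k => M (i.succAbove j) (i.succAbove k))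
      (fun j => q (i.succAbove j) + M (i.succAbove j) i * c) (fun j => u (i.succAbove j)) v) :
    IsRay M q u (i.insertNth 0 v) := by
  have hr := isRay_insertNth_zero (q := fun j => q j + M j i * c) (u := u) hM h
  refine ⟨hr.nonneg, hr.eq_zero, hr.mulVec, ?_⟩
  have h₁ := hr.neg
  have h₂ := hr.mulVec i
  generalize (i.insertNth 0 v : Fin (n + 1) → ℝ) = w at h₁ h₂ ⊢
  have e : ∑ j, (q j + M j i * c) * w j = ∑ j, q j * w j + c * ∑ j, M i j * w j := by
    rw [Finset.mul_sum, ← Finset.sum_add_distrib]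
    exact Finset.sum_congr rfl fun j _ => by rw [hM.1 i j]; ring
  rw [e, h₂] at h₁
  linarith

/-- Hence the sign test says the same about every optimal `x` with `x_i = c`, whichever solution `y`
of the reduced problem has been computed. -/
theorem kkt_gradient_eq (hM : IsPSD M) {y : Fin n → ℝ}
    (h : KKT (fun j k => M (i.succAbove j) (i.succAbove k))
      (fun j => q (i.succAbove j) + M (i.succAbove j) i * c) (fun j => u (i.succAbove j)) y)
    {x : Fin (n + 1) → ℝ} (hx : KKT M q u x) (hxi : x i = c) :
    ∑ j, M i j * x j = M i i * c + ∑ j, M i (i.succAbove j) * y j := by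
  have := mulVec_eq_of_kktAt hM (q := q) (u := u) (x := x) (y := i.insertNth c y) (fun j => by
    refine Fin.succAboveCases i ?_ (fun k => ?_) j
    · left; simp [hxi]
    · exact Or.inr ⟨hx _, kktAt_insertNth h k⟩) i
  rw [this]
  simp [Fin.sum_univ_succAbove _ i]

theorem tryIndex_spec (hM : IsPSD M)
    (hC : IsPSD (comparisonMatrix fun j k => M (i.succAbove j) (i.succAbove k)))
    (hu : ∀ i, 0 < u i) :
    (∃ o, (tryIndex M q u i).eval = some o ∧ Resolves M q u o) ∨
    ((tryIndex M q u i).eval = none ∧ ∀ x, KKT M q u x → 0 < x i ∧ (x i : WithTop ℝ) < u i) := by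
  have hpppa := fun r => pppa_spec r (hM.submatrix_succAbove i) hC fun j => hu (i.succAbove j)
  have hu0 : ((0 : ℝ) : WithTop ℝ) < u i := hu i
  simp only [tryIndex, eval_bind, eval_tab2, eval_tab, eval_pure]
  rcases hpppa fun j => q (i.succAbove j) with ⟨y, hy, hk⟩ | ⟨hy, v, hv⟩
  swap
  · simp only [hy, eval_pure]
    exact Or.inl ⟨_, rfl, Or.inr ⟨rfl, _, isRay_insertNth_zero hM hv⟩⟩
  simp only [hy, eval_bind, eval_add, eval_sumOn, eval_mul, Finset.filter_true, eval_ite,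
    eval_isNeg, decide_eq_true_eq]
  have hk' : KKT (fun j k => M (i.succAbove j) (i.succAbove k))
      (fun j => q (i.succAbove j) + M (i.succAbove j) i * 0) (fun j => u (i.succAbove j)) y := by
    simpa using hk
  by_cases hg : q i + ∑ j, M i (i.succAbove j) * y j < 0
  swap
  · simp only [hg, if_false, eval_lit, Nat.cast_zero, eval_pure]
    refine Or.inl ⟨_, rfl, Or.inl ⟨_, rfl, fun j => ?_⟩⟩
    refine Fin.succAboveCases i ?_ (fun k => kktAt_insertNth hk' k) j
    refine ⟨by simp, by simpa using hu0.le, fun h => by simp at h, fun _ => ?_⟩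
    simpa [Fin.sum_univ_succAbove _ i] using hg
  simp only [hg, if_true]
  -- At `x_i = 0 < u_i` optimality requires a nonnegative gradient, but it would equal the negative
  -- value found with `y`.
  have hpos : ∀ x, KKT M q u x → 0 < x i := fun x hx => by
    refine lt_of_le_of_ne (hx i).nonneg fun h0 => ?_
    have e := kkt_gradient_eq hM hk' hx h0.symm
    have := (hx i).grad_nonneg (by rw [← h0]; exact hu0)
    rw [e] at this
    linarith
  rcases hui : u i with _ | c
  · exact Or.inr ⟨rfl, fun x hx => ⟨hpos x hx, WithTop.coe_lt_top _⟩⟩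
  simp only [eval_bind, eval_tab, eval_add, eval_mul]
  rcases hpppa fun j => q (i.succAbove j) + M (i.succAbove j) i * c with ⟨y, hy, hk⟩ | ⟨hy, v, hv⟩
  swap
  · simp only [hy, eval_pure]
    exact Or.inl ⟨_, rfl, Or.inr ⟨rfl, _, isRay_insertNth_of_shift hM hv⟩⟩
  simp only [hy, eval_bind, eval_add, eval_sumOn, eval_mul, Finset.filter_true, eval_ite,
    eval_isPos, decide_eq_true_eq, eval_pure]
  by_cases hg : 0 < q i + M i i * c + ∑ j, M i (i.succAbove j) * y j
  · rw [if_pos hg]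
    refine Or.inr ⟨rfl, fun x hx => ⟨hpos x hx, lt_of_le_of_ne (hui ▸ (hx i).le) fun h0 => ?_⟩⟩
    have h0 : x i = c := WithTop.coe_injective h0
    have e := kkt_gradient_eq hM hk hx h0
    have := (hx i).grad_nonpos (hpos x hx)
    rw [e] at this
    linarith
  · rw [if_neg hg]
    refine Or.inl ⟨_, rfl, Or.inl ⟨_, rfl, fun j => ?_⟩⟩
    refine Fin.succAboveCases i ?_ (fun k => kktAt_insertNth hk k) j
    have hc : 0 < c := by
      rw [hui] at hu0
      exact WithTop.coe_lt_coe.1 hu0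
    refine ⟨by simpa using hc.le, by rw [Fin.insertNth_apply_same, hui]; rfl, fun _ => ?_,
      fun h => ?_⟩
    · simpa [Fin.sum_univ_succAbove _ i, add_assoc] using hg
    · rw [Fin.insertNth_apply_same, hui] at h
      exact absurd h (lt_irrefl (c : WithTop ℝ))

theorem resolveQP_spec (hM : IsPSD M)
    (hC : ∀ i : Fin (n + 1),
      IsPSD (comparisonMatrix fun j k => M (i.succAbove j) (i.succAbove k)))
    (hu : ∀ i, 0 < u i) :
    (∃ x, (resolveQP M q u).eval = .optimal x ∧ IsOptimal M q u x) ∨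
      ((resolveQP M q u).eval = .noSolution ∧ ¬ ∃ x, IsOptimal M q u x) := by
  have hres : ∀ o, Resolves M q u o → (∃ x, o = .optimal x ∧ IsOptimal M q u x) ∨
      (o = .noSolution ∧ ¬ ∃ x, IsOptimal M q u x) := by
    rintro _ (⟨x, rfl, hx⟩ | ⟨rfl, v, hv⟩)
    · exact Or.inl ⟨x, rfl, hx.isOptimal hM⟩
    · exact Or.inr ⟨rfl, hv.not_exists_isOptimal hM⟩
  simp only [resolveQP, eval_bind]
  generalize hr : (loop (K := ℝ) (n := n + 1) (none : Option (Outcome ℝ (n + 1))) _).eval = res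
  let P (m : ℕ) (s : Option (Outcome ℝ (n + 1))) : Prop :=
    (∃ o, s = some o ∧ Resolves M q u o) ∨ (s = none ∧ ∀ j : Fin (n + 1), j.1 < m →
      ∀ x, KKT M q u x → 0 < x j ∧ (x j : WithTop ℝ) < u j)
  have hP : P (n + 1) res := by
    rw [← hr]
    refine loop_induction P (Or.inr ⟨rfl, fun j hj => absurd hj (Nat.not_lt_zero _)⟩) ?_
    rintro i s (⟨o, rfl, ho⟩ | ⟨rfl, h⟩)
    · exact Or.inl ⟨o, rfl, ho⟩
    · rcases tryIndex_spec (q := q) hM (hC i) hu with h' | ⟨h', hi⟩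
      · exact Or.inl h'
      · refine Or.inr ⟨h', fun j hj => ?_⟩
        rcases Nat.lt_succ_iff_lt_or_eq.1 hj with hj | hj
        · exact h j hj
        · rw [Fin.ext hj]; exact hi
  rcases hP with ⟨o, rfl, ho⟩ | ⟨rfl, h⟩
  · exact hres o ho
  · rcases finalCheck_spec hM hC q u with ⟨x, hx, hs⟩ | ⟨hx, hs⟩
    · refine Or.inl ⟨x, hx, KKT.isOptimal hM fun j => ?_⟩
      obtain ⟨h₁, h₂, h₃⟩ := hs j rfl
      exact ⟨h₂, h₃, fun _ => h₁.le, fun _ => h₁.ge⟩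
    -- All indices have been tried, so an optimal `x` would be strictly interior, and both gradient
    -- inequalities would hold in every row.
    · refine Or.inr ⟨hx, fun ⟨x, hopt⟩ => hs ⟨x, fun j _ => ?_⟩⟩
      have hk := hopt.kkt hM
      obtain ⟨h₁, h₂⟩ := h j j.2 x hk
      exact ⟨le_antisymm ((hk j).grad_nonpos h₁) ((hk j).grad_nonneg h₂), (hk j).nonneg, (hk j).le⟩

/-- The comparison matrices of the principal submatrices of order `n`. -/
theorem WeaklyQuasiDominant.isPSD_comparisonMatrix {M : Matrix (Fin (n + 1)) (Fin (n + 1)) ℝ}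
    (h : WeaklyQuasiDominant 1 M) (i : Fin (n + 1)) :
    IsPSD (comparisonMatrix fun j k => M (i.succAbove j) (i.succAbove k)) := by
  have h' := h.2 (univ.erase i) (by simp)
  let f (j : Fin n) : (univ.erase i : Finset (Fin (n + 1))) :=
    ⟨i.succAbove j, by simp [Fin.succAbove_ne]⟩
  have hf : (comparisonMatrix fun j k => M (i.succAbove j) (i.succAbove k)) =
      (comparisonMatrix (M.submatrix (fun j : (univ.erase i : Finset (Fin (n + 1))) => (j : _))
        fun j => (j : _))).submatrix f f := by
    ext j k
    simp [comparisonMatrix, f]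
  rw [hf]
  exact isPSD_of_posSemidef (h'.submatrix f)

end Resolve

/-! ## The number of operations -/

section Cost

variable {K α β σ : Type} [Field K] [LinearOrder K] {n : ℕ}

/-- The summand `d` collects what the preceding steps have been charged. The continuation is bounded
for every possible result, so the values computed play no role. -/
theorem cost_bind_add_le {a c d : ℕ} {p : Prog K α} {f : α → Prog K β} (h : p.cost ≤ a)
    (hf : ∀ x, (f x).cost + (a + d) ≤ c) : (p >>= f).cost + d ≤ c := by
  have := hf p.eval
  rw [cost_bind]
  omega

theorem cost_bind_le {a c : ℕ} {p : Prog K α} {f : α → Prog K β} (h : p.cost ≤ a)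
    (hf : ∀ x, (f x).cost + a ≤ c) : (p >>= f).cost ≤ c := by
  have := hf p.eval
  rw [cost_bind]
  omega

/-! ### Costs of linear algebra and pivoting -/

theorem cost_transform_le (M : Fin n → Fin n → K) (inα : Fin n → Bool) (B : Fin n → Fin n → K)
    (r : Fin n → K) : (transform M inα B r).cost ≤ 6 * (n + 1) ^ 2 := by
  have hs (v w : Fin n → K) := cost_sumOn_le (c := inα) (f := fun j => mul (v j) (w j)) (b := 1)
    fun _ => le_rfl
  refine cost_bind_le (cost_tab_le fun i => hs (B i) r) fun y => ?_
  have := cost_tab_le (n := n) (c := n * 3 + 2)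
    (f := fun i => if inα i then pure (y i) else do
      sub (r i) (← sumOn inα fun j => mul (M i j) (y j))) fun i => by
    have := hs (M i) y
    simp only [cost_ite, cost_bind, cost_pure, cost_sub]
    split_ifs <;> omega
  refine (Nat.add_le_add_right this _).trans ?_
  nlinarith

theorem cost_schurEntry_le (M : Fin n → Fin n → K) (inα : Fin n → Bool) (B : Fin n → Fin n → K)
    (i : Fin n) : (schurEntry M inα B i).cost ≤ 3 * (n + 1) ^ 2 := by
  have hs (v w : Fin n → K) := cost_sumOn_le (c := inα) (f := fun j => mul (v j) (w j)) (b := 1)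
    fun _ => le_rfl
  refine cost_bind_le (cost_tab_le fun k => hs (B k) fun j => M j i) fun h => ?_
  refine cost_bind_add_le (hs (M i) h) fun t => ?_
  refine cost_bind_add_le le_rfl fun s => ?_
  simp only [cost_pure, cost_sub]
  nlinarith

theorem cost_addIndex_le (B : Fin n → Fin n → K) (i : Fin n) (h : Fin n → K) (s : K) :
    (addIndex B i h s).cost ≤ 4 * (n + 1) ^ 2 := by
  refine (cost_tab2_le (c := 3) fun k l => ?_).trans (by nlinarith)
  split_ifs <;> simp

theorem cost_dropIndex_le (B : Fin n → Fin n → K) (j : Fin n) :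
    (dropIndex B j).cost ≤ 4 * (n + 1) ^ 2 := by
  refine (cost_tab2_le (c := 3) fun k l => ?_).trans (by nlinarith)
  simp

theorem cost_shiftedLinearTerm_le (M : Fin n → Fin n → K) (q : Fin n → K) (u : Fin n → WithTop K)
    (st : Fin n → Status) : (shiftedLinearTerm M q u st).cost ≤ 3 * (n + 1) ^ 2 := by
  refine (cost_tab_le (c := n * 3 + 2) fun i => ?_).trans (by nlinarith)
  refine cost_bind_le (cost_sumOn_le (b := 1) fun k => ?_) fun t => ?_
  · rcases u k with _ | c <;> exact le_rfl
  · simp only [cost_add]; omega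

theorem cost_keepMax_le {τ : Type} (best : Option (K × τ)) (r : K) (t : τ) :
    (keepMax best r t).cost ≤ 1 := by
  rcases best with _ | b <;> simp [keepMax]

theorem cost_keepMin_le {τ : Type} (best : Option (K × τ)) (r : K) (t : τ) :
    (keepMin best r t).cost ≤ 1 := by
  rcases best with _ | b <;> simp [keepMin]

theorem cost_criticalValue_le (u : Fin n → WithTop K) (st : Fin n → Status) (qb pb : Fin n → K) :
    (criticalValue u st qb pb).cost ≤ 8 * n := by
  refine (cost_loop_le (c := 7) fun best i => ?_).trans (by omega)
  refine cost_bind_le (cost_isPos _).le fun b => ?_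
  have hk := fun r => cost_keepMax_le best r i
  rcases b
  · simp
  · rcases st i <;> rcases u i with _ | c <;> simp
    all_goals grind

theorem cost_blockingValue_le (u : Fin n → WithTop K) (st : Fin n → Status) (qb pb h : Fin n → K)
    (τ : K) (i : Fin n) : (blockingValue u st qb pb h τ i).cost ≤ 12 * n + 1 := by
  refine cost_bind_le (a := n * 12) (cost_loop_le fun best j => ?_) fun best => ?_
  · split_ifs
    · refine cost_bind_le (cost_mul _ _).le fun _ => ?_
      refine cost_bind_add_le (cost_add _ _).le fun _ => ?_
      refine cost_bind_add_le (cost_isPos _).le fun b => ?_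
      rcases b
      · refine cost_bind_add_le (cost_isNeg _).le fun b => ?_
        rcases b
        · simp
        · rcases u j with _ | c
          · simp
          · refine cost_bind_add_le (cost_add _ _).le fun _ => ?_
            refine cost_bind_add_le (cost_neg _).le fun _ => ?_
            refine cost_bind_add_le (cost_div _ _).le fun _ => ?_
            exact Nat.add_le_add_right (cost_keepMin_le _ _ _) _
      · refine cost_bind_add_le (cost_neg _).le fun _ => ?_
        refine cost_bind_add_le (cost_div _ _).le fun _ => ?_
        exact (Nat.add_le_add_right (cost_keepMin_le _ _ _) _).trans (by omega)
    · simp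
  · rcases u i with _ | c
    · simp; omega
    · exact (Nat.add_le_add_right (cost_keepMin_le _ _ _) _).trans (by omega)

theorem cost_pivotLoop_le (M : Fin n → Fin n → K) (q : Fin n → K) (u : Fin n → WithTop K)
    (p : Fin n → K) : ∀ (fuel : ℕ) (st : Fin n → Status) (B : Fin n → Fin n → K),
    (pivotLoop M q u p fuel st B).cost ≤ fuel * (60 * (n + 1) ^ 2)
  | 0, _, _ => by simp [pivotLoop]
  | fuel + 1, st, B => by
    have ih := cost_pivotLoop_le M q u p fuel
    have hN : n + 1 ≤ (n + 1) ^ 2 := Nat.le_self_pow two_ne_zero _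
    rw [Nat.succ_mul]
    generalize fuel * (60 * (n + 1) ^ 2) = F at ih ⊢
    have hT := cost_transform_le M (isBetween st) B
    have hD := cost_dropIndex_le (K := K) (n := n)
    have hA := cost_addIndex_le (K := K) (n := n)
    have hS := cost_schurEntry_le M
    unfold pivotLoop
    refine cost_bind_le cost_step.le fun _ => ?_
    refine cost_bind_add_le (cost_shiftedLinearTerm_le M q u st) fun _ => ?_
    refine cost_bind_add_le (hT _) fun qb => ?_
    refine cost_bind_add_le (hT _) fun pb => ?_
    refine cost_bind_add_le (cost_criticalValue_le u st qb pb) fun crit => ?_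
    rcases crit with _ | c
    on_goal 2 =>
      dsimp only
      refine cost_bind_add_le (cost_isPos _).le fun b => ?_
      split_ifs
    all_goals
      try dsimp only
      refine cost_bind_add_le (cost_pure _).le fun crit => ?_
      rcases crit with _ | ⟨τ, i⟩
      · refine cost_bind_add_le (a := n * 3) (cost_tab_le fun i => ?_) fun _ => ?_
        · rcases st i <;> rcases u i with _ | c <;> simp
        · simp only [cost_pure]; omega
      · dsimp only
        split_ifs
        · refine cost_bind_add_le (hD _ _) fun _ => ?_
          exact (Nat.add_le_add_right (ih _ _) _).trans (by omega)
        · refine cost_bind_add_le (hS _ _ _) fun (h, s) => ?_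
          refine cost_bind_add_le (cost_isPos _).le fun b => ?_
          split_ifs
          · refine cost_bind_add_le (hA _ _ _ _) fun _ => ?_
            exact (Nat.add_le_add_right (ih _ _) _).trans (by omega)
          · refine cost_bind_add_le (cost_blockingValue_le _ _ _ _ _ _ _) fun t => ?_
            rcases t with _ | ⟨_, j, side⟩
            · simp only [cost_pure]; omega
            · dsimp only
              split_ifs
              · exact (Nat.add_le_add_right (ih _ _) _).trans (by omega)
              · refine cost_bind_add_le (hD _ _) fun _ => ?_
                refine cost_bind_add_le (hS _ _ _) fun (h, s) => ?_
                refine cost_bind_add_le (hA _ _ _ _) fun _ => ?_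
                exact (Nat.add_le_add_right (ih _ _) _).trans (by omega)

theorem cost_comparison_le (M : Fin n → Fin n → K) :
    (comparison M).cost ≤ 5 * (n + 1) ^ 2 := by
  refine (cost_tab2_le (c := 4) fun i j => ?_).trans (by nlinarith)
  simp only [cost_ite, cost_bind, cost_pure, cost_isPos, cost_neg]
  split_ifs <;> omega

theorem cost_parametricVector_le (M : Fin n → Fin n → K) (d : Fin n → K) :
    (parametricVector M d).cost ≤ 10 * (n + 1) ^ 2 := by
  refine cost_bind_le (cost_comparison_le M) fun C => ?_
  refine cost_bind_add_le (cost_lit _).le fun two => ?_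
  refine (Nat.add_le_add_right (cost_tab_le (c := n * 4 + 2) fun i => ?_) _).trans (by nlinarith)
  refine cost_bind_le (cost_sumOn_le (b := 2) fun j => ?_) fun _ => ?_
  · simp
  · simp only [cost_div]; omega

theorem cost_dominanceVector_le : ∀ {n : ℕ} (A : Fin n → Fin n → K),
    (dominanceVector A).cost ≤ 8 * n ^ 3
  | 0, A => by simp [dominanceVector]
  | n + 1, A => by
    have ih (S : Fin n → Fin n → K) := cost_dominanceVector_le S
    have hN : 8 * n ^ 3 + (4 * n ^ 2 + 4 * n + 8) ≤ 8 * (n + 1) ^ 3 := by nlinarith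
    unfold dominanceVector
    refine cost_bind_le (cost_isPos _).le fun b => ?_
    split_ifs
    · refine cost_bind_add_le (cost_tab2_le (c := 3) fun j k => ?_) fun S => ?_
      · simp
      refine cost_bind_add_le (ih S) fun d => ?_
      refine cost_bind_add_le (cost_sumOn_le (b := 1) fun k => le_rfl) fun t => ?_
      refine cost_bind_add_le (cost_isNeg _).le fun b => ?_
      split_ifs <;> simp <;> nlinarith
    · refine cost_bind_add_le (cost_tab2_le (c := 0) fun j k => le_rfl) fun S => ?_
      refine cost_bind_add_le (ih S) fun d => ?_
      simp
      nlinarith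

/-- Each reduction costs `O(N²)`, with `N` fixed while the order shrinks. The pivoting loop runs at
most once, at the end, and accounts for the cubic term. -/
theorem cost_reduceAndPivot_le {N : ℕ} : ∀ (fuel : ℕ) {n : ℕ} (M : Fin n → Fin n → K)
    (q : Fin n → K) (u : Fin n → WithTop K) (d : Fin n → K), n + 1 ≤ N →
    (reduceAndPivot fuel M q u d).cost ≤ fuel * (40 * N ^ 2) + 130 * N ^ 3
  | 0, _, _, _, _, _, _ => by simp [reduceAndPivot]
  | _ + 1, 0, _, _, _, _, _ => by simp [reduceAndPivot]
  | fuel + 1, n + 1, M, q, u, d, hn => by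
    have ih (n) := cost_reduceAndPivot_le (N := N) fuel (n := n)
    have h₁ : n ≤ N := by omega
    have h₂ : N ≤ N ^ 2 := Nat.le_self_pow two_ne_zero _
    have h₃ : (n + 1 + 1) ^ 2 ≤ N ^ 2 := Nat.pow_le_pow_left hn _
    have h₄ : (n + 1) ^ 2 ≤ N ^ 2 := Nat.pow_le_pow_left (by omega) _
    rw [Nat.succ_mul, add_right_comm]
    generalize fuel * (40 * N ^ 2) = F at ih ⊢
    unfold reduceAndPivot
    refine cost_bind_le cost_step.le fun _ => ?_
    refine cost_bind_add_le ((cost_parametricVector_le M d).trans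
      (Nat.mul_le_mul_left 10 h₃)) fun p => ?_
    refine cost_bind_add_le (cost_findFirst_le (c := 6) fun i => ?_) fun bad => ?_
    · simp only [cost_bind, cost_ite, cost_pure, cost_isPos, cost_isNeg]
      split_ifs <;> omega
    rcases bad with _ | i
    · refine cost_bind_add_le (cost_tab2_le (c := 1) fun _ _ => le_rfl) fun zero => ?_
      refine (Nat.add_le_add_right (cost_pivotLoop_le M q u p _ _ zero) _).trans ?_
      have h₅ : (2 * (n + 1) + 1) * (60 * (n + 1 + 1) ^ 2) ≤ (2 * N) * (60 * N ^ 2) :=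
        Nat.mul_le_mul (by omega) (Nat.mul_le_mul_left _ h₃)
      have h₆ : (2 * N) * (60 * N ^ 2) = 120 * N ^ 3 := by ring
      nlinarith
    · refine cost_bind_add_le (cost_isPos _).le fun b => ?_
      split_ifs
      · rcases u i with _ | c
        · refine cost_bind_add_le (cost_tab2_le (c := 3) fun j k => by simp) fun S => ?_
          refine cost_bind_add_le (cost_tab_le (c := 3) fun j => by simp) fun r => ?_
          refine cost_bind_add_le (ih _ _ _ _ _ (by omega)) fun o => ?_
          rcases o with x | _ | _
          · refine cost_bind_add_le (cost_sumOn_le (b := 1) fun k => le_rfl) fun t => ?_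
            simp only [cost_bind, cost_add, cost_div, cost_neg, cost_pure]
            nlinarith
          · simp only [cost_pure]; nlinarith
          · simp only [cost_pure]; nlinarith
        · refine cost_bind_add_le (cost_tab2_le (c := 2) fun j k => ?_) fun M' => ?_
          · split_ifs <;> simp
          refine cost_bind_add_le (cost_tab_le (c := 4) fun j => ?_) fun q' => ?_
          · simp only [cost_bind, cost_mul, cost_add, cost_ite, cost_neg, cost_pure]
            split_ifs <;> omega
          refine cost_bind_add_le (ih _ _ _ _ _ (by omega)) fun o => ?_
          rcases o with x | _ | _ <;>
          · simp only [cost_bind, cost_sub, cost_pure]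
            nlinarith
      · refine cost_bind_add_le (cost_isNeg _).le fun b => ?_
        dsimp only
        split_ifs
        on_goal 1 => rcases u i with _ | c
        on_goal 3 => refine cost_bind_add_le (cost_lit _).le fun _ => ?_
        all_goals
          try dsimp only
          refine cost_bind_add_le (cost_pure _).le fun fixed => ?_
          rcases fixed with _ | c
          · simp only [cost_pure]; nlinarith
          · refine cost_bind_add_le (ih _ _ _ _ _ (by omega)) fun o => ?_
            rcases o with x | _ | _ <;>
            · simp only [cost_pure]
              nlinarith

theorem cost_pppa_le (M : Fin n → Fin n → K) (q : Fin n → K) (u : Fin n → WithTop K) :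
    (pppa M q u).cost ≤ 250 * (n + 1) ^ 3 := by
  refine cost_bind_le (cost_comparison_le M) fun C => ?_
  refine cost_bind_add_le (cost_dominanceVector_le C) fun d => ?_
  refine (Nat.add_le_add_right (cost_reduceAndPivot_le (N := n + 1) _ M q u d le_rfl) _).trans ?_
  have := Nat.zero_le (n ^ 3)
  have := Nat.zero_le (n ^ 2)
  ring_nf
  omega

/-! ### The final check -/

theorem cost_solveOneVar_le (L : List (K × K)) : (solveOneVar L).cost ≤ 14 * L.length + 1 := by
  refine cost_bind_le (cost_lit _).le fun zero => ?_
  refine cost_bind_add_le (cost_loopList_le (c := 8) (fun b e => ?_) L _) fun bounds => ?_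
  · refine cost_bind_le (cost_isPos _).le fun p => ?_
    split_ifs
    · refine cost_bind_add_le (cost_div _ _).le fun _ => ?_
      refine cost_bind_add_le (cost_neg _).le fun _ => ?_
      refine cost_bind_add_le (cost_keepMax_le _ _ _) fun _ => ?_
      simp
    · refine cost_bind_add_le (cost_isNeg _).le fun p => ?_
      split_ifs
      · refine cost_bind_add_le (cost_div _ _).le fun _ => ?_
        refine cost_bind_add_le (cost_neg _).le fun _ => ?_
        refine cost_bind_add_le (cost_keepMin_le _ _ _) fun _ => ?_
        simp
      · simp
  · refine cost_bind_add_le (cost_loopList_le (c := 4) (fun ok e => ?_) L _) fun ok => ?_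
    · simp
    · simp only [cost_pure]; omega


theorem cost_solveTwoVar_le (L : List (K × K × K)) :
    (solveTwoVar L).cost ≤ 50 * (L.length + 1) ^ 2 := by
  simp only [solveTwoVar]
  rw [cost_bind]
  generalize hparts : (loopList (K := K) L
    (([], [], []) : List (K × K × K) × List (K × K × K) × List (K × K)) _).eval = parts
  have hp : parts.1.length + parts.2.1.length + parts.2.2.length ≤ L.length := by
    rw [← hparts]
    refine loopList_induction (fun l (s : List (K × K × K) × List (K × K × K) × List (K × K)) =>
      s.1.length + s.2.1.length + s.2.2.length ≤ l.length) (by simp) (fun l a s h => ?_) L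
    simp only [eval_bind, eval_ite, eval_pure, List.length_append, List.length_singleton]
    split_ifs <;> simp only [List.length_cons] <;> omega
  rw [add_comm]
  refine (Nat.add_le_add_left (cost_loopList_le (c := 4) (fun s e => ?_) L _) _).trans ?_
  · simp only [cost_bind, cost_ite, cost_pure, cost_isPos, cost_isNeg]
    split_ifs <;> omega
  rw [cost_bind]
  generalize helim : (loopList (K := K) parts.1 parts.2.2 _).eval = elim
  -- One inequality for each pair of opposite signs, besides those without the second variable. Here
  -- the bound depends on the lists computed, so `eval` has to be followed.
  have he : elim.length ≤ (L.length + 1) ^ 2 := by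
    have : elim.length ≤ parts.2.2.length + parts.1.length * parts.2.1.length := by
      rw [← helim]
      refine loopList_induction (fun l (s : List (K × K)) =>
        s.length ≤ parts.2.2.length + l.length * parts.2.1.length) (by simp)
        (fun l a s h => ?_) parts.1
      have := loopList_induction (K := K) (s := s) (f := fun acc' f => do
          let a' ← sub (← mul a.2.1 f.1) (← mul f.2.1 a.1)
          let c ← sub (← mul a.2.1 f.2.2) (← mul f.2.1 a.2.2)
          pure ((a', c) :: acc')) (fun l' (t : List (K × K)) => t.length ≤ s.length + l'.length)
        (by simp) (fun l' b t ht => by simp; omega) parts.2.1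
      refine this.trans ?_
      simp only [List.length_append, List.length_singleton, Nat.succ_mul]
      omega
    nlinarith
  rw [add_right_comm, add_comm]
  refine (Nat.add_le_add_left (Nat.add_le_add_right (cost_loopList_le
    (fun acc e => cost_loopList_le (c := 6) (fun acc' f => by simp) _ _) _ _) _) _).trans ?_
  have hpn : parts.1.length * (parts.2.1.length * (6 + 1) + 1) ≤ 7 * (L.length + 1) ^ 2 := by
    nlinarith
  have hN : L.length + 1 ≤ (L.length + 1) ^ 2 := Nat.le_self_pow two_ne_zero _
  refine cost_bind_add_le (cost_solveOneVar_le elim) fun y => ?_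
  rcases y with _ | y
  · simp only [cost_pure]; omega
  · dsimp only
    rw [cost_bind]
    generalize hrest : (loopList (K := K) L ([] : List (K × K)) _).eval = rest
    have hr : rest.length ≤ L.length := by
      rw [← hrest]
      refine loopList_induction (fun l (s : List (K × K)) => s.length ≤ l.length) (by simp)
        (fun l a s h => ?_) L
      simpa using h
    rw [add_right_comm, add_comm]
    refine (Nat.add_le_add_left (Nat.add_le_add_right (cost_loopList_le (c := 2)
      (fun acc e => by simp) _ _) _) _).trans ?_
    refine cost_bind_add_le (cost_solveOneVar_le rest) fun z => ?_
    rcases z with _ | z <;> simp only [cost_pure] <;> omega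

theorem cost_blockRow_le (u : Fin n → WithTop K) (inC inα : Fin n → Bool) (b₁ : Fin n)
    (g₁ g₂ qb : Fin n → K) (zero one : K) (L : List (K × K × K)) (k : Fin n) :
    (blockRow u inC inα b₁ g₁ g₂ qb zero one L k).cost ≤ 8 := by
  unfold blockRow
  split_ifs <;> rcases u k with _ | c <;> simp

theorem length_blockRow_le (u : Fin n → WithTop K) (inC inα : Fin n → Bool) (b₁ : Fin n)
    (g₁ g₂ qb : Fin n → K) (zero one : K) (L : List (K × K × K)) (k : Fin n) :
    (blockRow u inC inα b₁ g₁ g₂ qb zero one L k).eval.length ≤ L.length + 4 := by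
  unfold blockRow
  split_ifs <;> rcases u k with _ | c <;> simp

theorem cost_blockSolution_le (u : Fin n → WithTop K) (inC inα : Fin n → Bool) (b₁ : Fin n)
    (b₂ : Option (Fin n)) (x : Fin n → K) (g₁ g₂ qb : Fin n → K) (zero one : K) :
    (blockSolution u inC inα b₁ b₂ x g₁ g₂ qb zero one).cost ≤ 1000 * (n + 1) ^ 2 := by
  unfold blockSolution
  rw [cost_bind, add_comm]
  refine (Nat.add_le_add_left (cost_loop_le (c := 8) fun L k =>
    cost_blockRow_le u inC inα b₁ g₁ g₂ qb zero one L k) _).trans ?_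
  generalize hL : (loop (K := K) ([] : List (K × K × K)) _).eval = L
  have hl : L.length ≤ 4 * n := by
    rw [← hL]
    refine loop_induction (fun m (L : List (K × K × K)) => L.length ≤ 4 * m) (by simp)
      fun i t ht => (length_blockRow_le _ _ _ _ _ _ _ _ _ _ _).trans (by omega)
  refine cost_bind_add_le (a := 50 * (4 * n + 1) ^ 2) ((cost_solveTwoVar_le L).trans ?_)
    fun s => ?_
  · gcongr
  · rcases s with _ | ⟨y, z⟩
    · simp only [cost_pure]; nlinarith
    · refine cost_bind_add_le (cost_tab_le (c := 6) fun k => ?_) fun _ => ?_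
      · split_ifs <;> simp
      · simp only [cost_pure]; nlinarith

theorem cost_blockInverse_le (M : Fin n → Fin n → K) (inα : Fin n → Bool)
    (Z : Fin n → Fin n → K) : (blockInverse M inα Z).cost ≤ 8 * (n + 1) ^ 3 := by
  refine (cost_loop_le (c := 7 * (n + 1) ^ 2) fun s k => ?_).trans (by nlinarith)
  split_ifs
  · refine cost_bind_le (cost_schurEntry_le _ _ _ _) fun (h, e) => ?_
    refine cost_bind_add_le (cost_addIndex_le _ _ _ _) fun _ => ?_
    simp only [cost_pure]
    omega
  · simp

theorem cost_solveBlock_le (M : Fin n → Fin n → K) (q : Fin n → K) (u : Fin n → WithTop K)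
    (inC : Fin n → Bool) (b₁ : Fin n) (x : Fin n → K) :
    (solveBlock M q u inC b₁ x).cost ≤ 1050 * (n + 1) ^ 3 := by
  have hN : (n + 1) ^ 2 ≤ (n + 1) ^ 3 := Nat.pow_le_pow_right (by omega) (by omega)
  have hN' : n + 1 ≤ (n + 1) ^ 2 := Nat.le_self_pow two_ne_zero _
  rw [solveBlock_eq]
  refine cost_bind_le (cost_lit _).le fun zero => ?_
  refine cost_bind_add_le (cost_lit _).le fun one => ?_
  refine cost_bind_add_le (cost_findFirst_le (c := 0) fun _ => le_rfl) fun b₂ => ?_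
  refine cost_bind_add_le (cost_tab2_le (c := 0) fun _ _ => le_rfl) fun Z => ?_
  refine cost_bind_add_le (cost_blockInverse_le _ _ _) fun (_, B) => ?_
  refine cost_bind_add_le (cost_transform_le _ _ _ _) fun qb => ?_
  refine cost_bind_add_le (cost_transform_le _ _ _ _) fun g₁ => ?_
  have hZ : n * (n * (0 + 1) + 1) ≤ (n + 1) ^ 2 := by nlinarith
  rcases b₂ with _ | b
  · refine cost_bind_add_le (cost_tab_le (c := 0) fun _ => le_rfl) fun g₂ => ?_
    exact (Nat.add_le_add_right (cost_blockSolution_le _ _ _ _ _ _ _ _ _ _ _) _).trans (by omega)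
  · refine cost_bind_add_le (cost_transform_le _ _ _ _) fun g₂ => ?_
    exact (Nat.add_le_add_right (cost_blockSolution_le _ _ _ _ _ _ _ _ _ _ _) _).trans (by omega)

theorem cost_sameBlock_le (M : Fin n → Fin n → K) : (sameBlock M).cost ≤ 10 * (n + 1) ^ 3 := by
  refine cost_bind_le (cost_tab2_le (c := 4) fun i j => ?_) fun R => ?_
  · simp only [cost_ite, cost_bind, cost_pure, cost_isPos, cost_isNeg]
    split_ifs <;> omega
  · refine (Nat.add_le_add_right (cost_loop_le fun R k => cost_tab2_le (c := 0)
      fun i j => le_rfl) _).trans ?_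
    have := Nat.zero_le (n ^ 3)
    have := Nat.zero_le (n ^ 2)
    ring_nf
    omega

theorem cost_finalCheck_le (M : Fin n → Fin n → K) (q : Fin n → K) (u : Fin n → WithTop K) :
    (finalCheck M q u).cost ≤ 1100 * (n + 1) ^ 4 := by
  have hN : (n + 1) ^ 3 ≤ (n + 1) ^ 4 := Nat.pow_le_pow_right (by omega) (by omega)
  have hN' : n + 1 ≤ (n + 1) ^ 3 := Nat.le_self_pow (by omega) _
  refine cost_bind_le (cost_sameBlock_le M) fun R => ?_
  refine cost_bind_add_le (cost_tab_le (c := 1) fun _ => le_rfl) fun x₀ => ?_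
  refine cost_bind_add_le (cost_loop_le (c := 1051 * (n + 1) ^ 3) fun s i => ?_) fun res => ?_
  · rcases s with _ | x
    · simp
    · refine cost_bind_le (cost_findFirst_le (c := 0) fun _ => le_rfl) fun j => ?_
      have := cost_solveBlock_le M q u (R i) i x
      rcases j with _ | j
      · simp only [cost_pure]; omega
      · dsimp only
        split_ifs
        · omega
        · simp only [cost_pure]; omega
  · have : n * (1051 * (n + 1) ^ 3 + 1) + 1051 * (n + 1) ^ 3 ≤ 1051 * (n + 1) ^ 4 + n := by
      -- At most `n` blocks with a cubic cost each; the constant `1051` also covers the search for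
      -- the least index of a block.
      rw [pow_succ _ 3]; nlinarith
    rcases res with _ | x <;> simp only [cost_pure] <;> omega

/-! ### The algorithm -/

theorem cost_tryIndex_le (M : Fin (n + 1) → Fin (n + 1) → K) (q : Fin (n + 1) → K)
    (u : Fin (n + 1) → WithTop K) (i : Fin (n + 1)) :
    (tryIndex M q u i).cost ≤ 600 * (n + 1) ^ 3 := by
  have hN : (n + 1) ^ 2 ≤ (n + 1) ^ 3 := Nat.pow_le_pow_right (by omega) (by omega)
  have hN' : n + 1 ≤ (n + 1) ^ 2 := Nat.le_self_pow two_ne_zero _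
  have hZ : n * (n * (0 + 1) + 1) ≤ (n + 1) ^ 2 := by nlinarith
  have hp := cost_pppa_le (K := K) (n := n)
  generalize (n + 1) ^ 3 = P at hN hp ⊢
  generalize (n + 1) ^ 2 = Q at hN hN' hZ
  refine cost_bind_le (cost_tab2_le (c := 0) fun _ _ => le_rfl) fun M' => ?_
  refine cost_bind_add_le (cost_tab_le (c := 0) fun _ => le_rfl) fun u' => ?_
  refine cost_bind_add_le (cost_tab_le (c := 0) fun _ => le_rfl) fun qlb => ?_
  refine cost_bind_add_le (hp _ _ _) fun o => ?_
  rcases o with x | _ | _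
  · refine cost_bind_add_le (cost_sumOn_le (b := 1) fun _ => le_rfl) fun t => ?_
    refine cost_bind_add_le (cost_add _ _).le fun g => ?_
    refine cost_bind_add_le (cost_isNeg _).le fun b => ?_
    split_ifs
    · rcases u i with _ | c
      · simp only [cost_pure]; omega
      · refine cost_bind_add_le (cost_tab_le (c := 2) fun _ => by simp) fun qub => ?_
        refine cost_bind_add_le (hp _ _ _) fun o => ?_
        rcases o with x | _ | _
        · refine cost_bind_add_le (cost_mul _ _).le fun _ => ?_
          refine cost_bind_add_le (cost_add _ _).le fun _ => ?_
          refine cost_bind_add_le (cost_sumOn_le (b := 1) fun _ => le_rfl) fun t => ?_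
          refine cost_bind_add_le (cost_add _ _).le fun g => ?_
          refine cost_bind_add_le (cost_isPos _).le fun b => ?_
          split_ifs <;> simp only [cost_pure] <;> linarith
        · simp only [cost_pure]; omega
        · simp only [cost_pure]; omega
    · simp only [cost_bind, cost_lit, cost_pure]; omega
  · simp only [cost_pure]; omega
  · simp only [cost_pure]; omega

theorem cost_resolveQP_le (M : Fin (n + 1) → Fin (n + 1) → K) (q : Fin (n + 1) → K)
    (u : Fin (n + 1) → WithTop K) : (resolveQP M q u).cost ≤ 18300 * (n + 1) ^ 4 := by
  refine cost_bind_le (cost_loop_le (c := 600 * (n + 1) ^ 3) fun s i => ?_) fun res => ?_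
  · rcases s with _ | o
    · exact cost_tryIndex_le M q u i
    · simp
  · have hN : n + 1 ≤ (n + 1) ^ 4 := Nat.le_self_pow (by omega) _
    have h₁ : (n + 1) * (600 * (n + 1) ^ 3 + 1) = 600 * (n + 1) ^ 4 + (n + 1) := by ring
    rcases res with _ | o
    · refine (Nat.add_le_add_right (cost_finalCheck_le M q u) _).trans ?_
      -- The final check runs at order `n + 1`, and `(n + 2)⁴ ≤ 16 (n + 1)⁴`. This gives `600 + 16 ·
      -- 1100 = 18200`; the rest of the constant absorbs the linear term.
      have h₂ : (n + 1 + 1) ^ 4 ≤ (2 * (n + 1)) ^ 4 := Nat.pow_le_pow_left (by omega) _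
      have h₃ : (2 * (n + 1)) ^ 4 = 16 * (n + 1) ^ 4 := by ring
      omega
    · simp only [cost_pure]; omega

end Cost

end BoundedQP

theorem theorem7p2 :
    ∃ C : ℕ, ∀ (n : ℕ) (M : Matrix (Fin (n + 1)) (Fin (n + 1)) ℝ) (q : Fin (n + 1) → ℝ)
      (u : Fin (n + 1) → WithTop ℝ), BoundedQP.WeaklyQuasiDominant 1 M → (∀ i, 0 < u i) →
      ((∃ x, (BoundedQP.resolveQP M q u).eval = .optimal x ∧ BoundedQP.IsOptimal M q u x) ∨
        ((BoundedQP.resolveQP M q u).eval = .noSolution ∧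
          ¬ ∃ x, BoundedQP.IsOptimal M q u x)) ∧
      (BoundedQP.resolveQP M q u).cost ≤ C * (n + 1) ^ 4 := by
  exact ⟨18300, fun n M q u hW hu =>
    ⟨BoundedQP.resolveQP_spec (BoundedQP.isPSD_of_posSemidef hW.1) hW.isPSD_comparisonMatrix hu,
      BoundedQP.cost_resolveQP_le M q u⟩⟩
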